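/- There are a word-RAM program $P$ and a constant $C$ with the following properties. Let $G$ be a simple planar graph with vertex set $\{0,\dots,n-1\}$, presented to $P$ by adjacency lists in an arbitrary order (no embedding is given), and let the word length be any $w\ge C(\lfloor\log_2 n\rfloor+1)$. After a finite preprocessing, $P$ outputs an initial assignment of cc-identifiers, i.e. of integers with at most $C(\lfloor\log_2 n\rfloor+1)$ bits, to the vertices of $G$, such that two vertices have the same cc-identifier if and only if they lie in the same connected component. Then edges of $G$ are deleted one after another in any order. Each deletion is revealed to $P$ (by the two end points of the edge) only after $P$ has answered the previous one. After every deletion $P$ returns exactly the list of those vertices whose cc-identifier changes, with their new identifiers, and the resulting identifiers are cc-identifiers of the current graph. A vertex changes its identifier only in a deletion after which its connected component has at most half as many vertices as before. The total running time, that is the total number of instructions executed to handle all deletions, is at most $C\,n\log_2 n$. If the adjacency lists are given in the cyclic order of a planar embedding of $G$ and $n\ge 2$, then this bound holds for the preprocessing and all deletions together. -/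

import Mathlib

namespace DecrementalConnectivity

/-! ### Planar graphs, presented by adjacency lists -/

/-- A presentation of the graph `G` by adjacency lists: for every vertex `v`, the list of its
neighbours, each occurring once. Every list is in addition read as a cyclic order, so that a
presentation is also a rotation system of `G`. -/
structure AdjacencyLists {n : ℕ} (G : SimpleGraph (Fin n)) where
  nbrs : Fin n → List (Fin n)
  nodup : ∀ v, (nbrs v).Nodup
  mem_nbrs : ∀ v u, u ∈ nbrs v ↔ G.Adj v u

namespace AdjacencyLists

variable {n : ℕ} {G : SimpleGraph (Fin n)}

/-- Face tracing: the dart `(u, v)` is followed on the boundary of its face by the dart that leaves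
`v` towards the cyclic successor of `u` in the list of `v`. -/
def faceNext (A : AdjacencyLists G) (d : G.Dart) : G.Dart :=
  have h : d.fst ∈ A.nbrs d.snd := (A.mem_nbrs _ _).2 d.adj.symm
  ⟨(d.snd, (A.nbrs d.snd).next d.fst h), (A.mem_nbrs _ _).1 (List.next_mem _ _ h)⟩

/-- The sum over the connected components of `G` of their numbers of faces: the orbits of
`faceNext` on the darts, and one face for every component that is an isolated vertex. -/
noncomputable def numFaces (A : AdjacencyLists G) : ℕ :=
  Nat.card (Quot fun d e : G.Dart => A.faceNext d = e) + Nat.card {v : Fin n // ∀ u, ¬ G.Adj v u}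

/-- The rotation system is a (combinatorial) planar embedding, i.e. it has genus zero.
A component of genus `g` has `|V| - |E| + |F| = 2 - 2 * g`, so the equation, which is
summed over all components, says that every component is embedded in the sphere. (If the components
are drawn in a common plane, then their outer faces are identified, and the equation
reads `|V| - |E| + |F| = |CC| + 1`.) -/
def IsPlanarEmbedding (A : AdjacencyLists G) : Prop :=
  n + A.numFaces = G.edgeSet.ncard + 2 * Nat.card G.ConnectedComponent

/-- The input words that present `G` to a machine: `n`, and then for every vertex `0, …, n - 1` its
degree followed by its list of neighbours. -/
def encode (A : AdjacencyLists G) : List ℕ :=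
  n :: (List.finRange n).flatMap fun v => (A.nbrs v).length :: (A.nbrs v).map Fin.val

end AdjacencyLists

/-- A graph is planar if it has a planar embedding. -/
def IsPlanar {n : ℕ} (G : SimpleGraph (Fin n)) : Prop :=
  ∃ A : AdjacencyLists G, A.IsPlanarEmbedding

/-! ### The machine model: an interactive word RAM -/

/-- Instructions of the word RAM. Arguments named `d`, `a`, `b` are register numbers and arguments
named `l` are program positions. -/
inductive Instr
  /-- `R[d] := k` -/
  | const (d k : ℕ)
  /-- `R[d] := R[a] + R[b]` -/
  | add (d a b : ℕ)
  /-- `R[d] := max (R[a] - R[b]) 0` -/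
  | sub (d a b : ℕ)
  /-- `R[d] := R[a] * R[b]` -/
  | mul (d a b : ℕ)
  /-- `R[d] := ⌊R[a] / R[b]⌋` -/
  | div (d a b : ℕ)
  /-- `R[d] := M[R[a]]` -/
  | load (d a : ℕ)
  /-- `M[R[a]] := R[b]` -/
  | store (a b : ℕ)
  /-- continue at position `l` -/
  | jump (l : ℕ)
  /-- continue at position `l` if `R[a] < R[b]`, and at the next position otherwise -/
  | jumpLT (a b l : ℕ)
  /-- append the pair `(R[a], R[b])` to the answer to the current request -/
  | emit (a b : ℕ)
  /-- finish the answer to the current request and wait for the next request -/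
  | await

/-- A program is a finite sequence of instructions; it depends neither on the input nor on the word
length. -/
abbrev Program := List Instr

/-- A configuration: position in the program, registers, memory, and the answer emitted so far to
the current request. -/
structure Config where
  pc : ℕ
  reg : ℕ → ℕ
  mem : ℕ → ℕ
  out : List (ℕ × ℕ)

namespace Config

/-- The initial configuration: the input is in memory, all other words are `0`. -/
def start (input : List ℕ) : Config where
  pc := 0
  reg := fun _ => 0
  mem := fun i => input.getD i 0
  out := []

/-- Write `x` to register `d`, truncated to `w` bits, and go to the next position. -/
def setReg (w : ℕ) (c : Config) (d x : ℕ) : Config :=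
  { c with pc := c.pc + 1, reg := Function.update c.reg d (x % 2 ^ w) }

/-- A waiting configuration receives the request `(x, y)` in its registers `0` and `1`. -/
def resume (c : Config) (x y : ℕ) : Config :=
  { c with
    pc := c.pc + 1
    reg := Function.update (Function.update c.reg 0 x) 1 y
    out := [] }

end Config

/-- The effect of one instruction on words of `w` bits; `await` has no successor of its own. -/
def Instr.exec (w : ℕ) (c : Config) : Instr → Option Config
  | const d k => some (c.setReg w d k)
  | add d a b => some (c.setReg w d (c.reg a + c.reg b))
  | sub d a b => some (c.setReg w d (c.reg a - c.reg b))
  | mul d a b => some (c.setReg w d (c.reg a * c.reg b))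
  | div d a b => some (c.setReg w d (c.reg a / c.reg b))
  | load d a => some (c.setReg w d (c.mem (c.reg a)))
  | store a b => some { c with
      pc := c.pc + 1
      mem := Function.update c.mem (c.reg a) (c.reg b) }
  | jump l => some { c with pc := l }
  | jumpLT a b l => some { c with pc := if c.reg a < c.reg b then l else c.pc + 1 }
  | emit a b => some { c with pc := c.pc + 1, out := c.out ++ [(c.reg a, c.reg b)] }
  | await => none

/-- `Runs P w c t c'`: on words of `w` bits, the program `P` executes exactly `t` instructions from
the configuration `c`, the last of them being an `await` at which it waits in configuration `c'`. -/
inductive Runs (P : Program) (w : ℕ) : Config → ℕ → Config → Prop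
  | wait {c : Config} (h : P[c.pc]? = some Instr.await) : Runs P w c 1 c
  | step {c c₁ c' : Config} {i : Instr} {t : ℕ} (hi : P[c.pc]? = some i)
      (he : i.exec w c = some c₁) (h : Runs P w c₁ t c') : Runs P w c (t + 1) c'

/-! ### Decremental connectivity -/

section Connectivity

variable {n : ℕ}

/-- `es` is a sequence of successive edge deletions from `G`. An edge is named by its end points, in
either order. -/
def IsDeletionSequence : SimpleGraph (Fin n) → List (Fin n × Fin n) → Prop
  | _, [] => True
  | G, (u, v) :: es => G.Adj u v ∧ IsDeletionSequence (G.deleteEdges {s(u, v)}) es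

/-- `ident` assigns cc-identifiers of at most `b` bits to the vertices of `G`. -/
def IsCCIdentifier (G : SimpleGraph (Fin n)) (b : ℕ) (ident : Fin n → ℕ) : Prop :=
  (∀ v, ident v < 2 ^ b) ∧ ∀ u v, ident u = ident v ↔ G.Reachable u v

/-- `out` is a list, without repetitions, of the vertices in `S` with their identifiers. -/
def ListsIdentifiers (out : List (ℕ × ℕ)) (S : Set (Fin n)) (ident : Fin n → ℕ) : Prop :=
  ∃ vs : List (Fin n), vs.Nodup ∧ (∀ v, v ∈ vs ↔ v ∈ S) ∧
    out = vs.map fun v => (v.val, ident v)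

/-- The number of vertices of the connected component of `v` in `G`. -/
noncomputable def componentSize (G : SimpleGraph (Fin n)) (v : Fin n) : ℕ :=
  {u : Fin n | G.Reachable v u}.ncard

/-- `Handles P w b c G ident es T`: the program `P` waits in configuration `c`, the current graph is
`G`, its current cc-identifiers are `ident`, and `P` handles the deletions `es`, which arrive one at
a time, in total time `T`. After every deletion its answer is exactly the list of the changes that
lead to cc-identifiers of the new graph; a vertex changes its identifier only if the size of its
component drops to at most one half. -/
inductive Handles (P : Program) (w b : ℕ) :
    Config → SimpleGraph (Fin n) → (Fin n → ℕ) → List (Fin n × Fin n) → ℕ → Prop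
  | nil (c : Config) (G : SimpleGraph (Fin n)) (ident : Fin n → ℕ) : Handles P w b c G ident [] 0
  | cons {c c' : Config} {G G' : SimpleGraph (Fin n)} {ident ident' : Fin n → ℕ} {u v : Fin n}
      {es : List (Fin n × Fin n)} {t T : ℕ}
      (hG : G' = G.deleteEdges {s(u, v)})
      (hrun : Runs P w (c.resume u v) t c')
      (hlist : ListsIdentifiers c'.out {x | ident' x ≠ ident x} ident')
      (hident : IsCCIdentifier G' b ident')
      (hhalf : ∀ x, ident' x ≠ ident x → 2 * componentSize G' x ≤ componentSize G x)
      (hrest : Handles P w b c' G' ident' es T) :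
      Handles P w b c G ident ((u, v) :: es) (t + T)

end Connectivity

end DecrementalConnectivity

open DecrementalConnectivity

/-!
The program keeps a planar embedding of the graph and detects, with a union-find structure on the
darts, when a deletion disconnects a component; only then does it search the two sides.

**Detection.** Let `A` be a planar embedding of `G` and let `H` be a subgraph. Deleting an edge
merges the faces on its two sides, so the faces of `H` are the classes of darts of `G` generated by
face tracing in `G` and by `d ~ d.symm` for the deleted edges (`dualStep`). By Euler's formula an
edge of `H` is a bridge if and only if it has the same face on both sides
(`AdjacencyLists.IsPlanarEmbedding.not_reachable_iff`). One direction holds for every rotation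
system: along a class of darts, the number of darts entering one side of a cut equals the number of
darts leaving it. The converse is a count: the number of classes minus the number of edges minus the
number of components never decreases under deletions, it would increase if a non-bridge had the
same face on both sides, and its values for `G` (Euler's formula) and for the edgeless graph leave
no room for an increase.

**Splitting.** If the deletion of `uv` disconnects `u` from `v`, then searches from `u` and from `v`
take turns until one of them is complete and has found at most half of the old component
(`wp_duel`); the vertices that it has found get a fresh identifier. The running time is
proportional to the sum of `deg + 1` over a side with at most half of the vertices. Each vertex is
on such a side at most `log₂ n` times, so the potential `∑ v, (deg v + 1) * log₂ |component of v|`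
pays for all searches (`potential_add_compWeight_le`, `wp_delete`), and a planar graph has at most
`3 * n` edges (`AdjacencyLists.IsPlanarEmbedding.ncard_edgeSet_le`). Union by size costs
`O(log n)` for each of the edges.

**Preprocessing.** The program tests whether the given lists form a planar embedding, which it
decides by counting faces and components and comparing with Euler's formula (`wp_test`). If they do
not, then it enumerates all rotation systems in the order of an odometer until it finds a planar
embedding (`wp_search`). This is slow, but only finiteness is required in that case.

**Machine.** The program is written in a small structured language with straight-line blocks,
branches and loops, operating on registers and 16 arrays; `Exec.steps` shows that its compiled form
simulates it with the same number of instructions. Programs of this language are verified with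
weakest preconditions that account for time (`WP`). The arrays have length `n * n + n + 1` and are
zero at the start, so that dictionaries indexed by pairs of vertices need no initialization.

Throughout, registers `0` and `1` hold the request, and registers `2` to `6` hold `n`, `1`, `0`, the
length of the input and an upper bound for the identifiers in use. The arrays are: `0` the input,
`1`, `2` the union-find structure of the vertices, `3`, `4` that of the dart positions, `5` the
table of the positions of the current darts (`uv` at index `u * n + v`), `6` the adjacency matrix,
`7` the identifiers, `8` the component sizes by identifier, `9` the marks and `10` the queues of the
searches, `11` the start of each list in the input, `12` the owner of each position, `13` the
candidate rotation system.
-/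

namespace DecrementalConnectivity

/-! ### A structured language over the word RAM -/

/-- A state of the structured language: registers, a family of arrays, and the answer emitted so
far. -/
structure St where
  reg : ℕ → ℕ
  arr : ℕ → ℕ → ℕ
  out : List (ℕ × ℕ)

/-- Straight-line operations; `rd d k a` is `R[d] := A_k[R[a]]` and `wr k a b` is
`A_k[R[a]] := R[b]`. -/
inductive Op
  | const (d k : ℕ)
  | add (d a b : ℕ)
  | sub (d a b : ℕ)
  | mul (d a b : ℕ)
  | rd (d k a : ℕ)
  | wr (k a b : ℕ)
  | emit (a b : ℕ)

namespace Op

/-- The effect of an operation, in exact arithmetic. -/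
def run (s : St) : Op → St
  | const d k => { s with reg := Function.update s.reg d k }
  | add d a b => { s with reg := Function.update s.reg d (s.reg a + s.reg b) }
  | sub d a b => { s with reg := Function.update s.reg d (s.reg a - s.reg b) }
  | mul d a b => { s with reg := Function.update s.reg d (s.reg a * s.reg b) }
  | rd d k a => { s with reg := Function.update s.reg d (s.arr k (s.reg a)) }
  | wr k a b => { s with
      arr := Function.update s.arr k (Function.update (s.arr k) (s.reg a) (s.reg b)) }
  | emit a b => { s with out := s.out ++ [(s.reg a, s.reg b)] }

/-- The conditions under which an operation is faithful on words of size `U` with at most `16`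
arrays of length `B`. -/
def ok (B U : ℕ) (s : St) : Op → Prop
  | const _ k => k < 16
  | add _ a b => s.reg a + s.reg b < U
  | sub _ _ _ => True
  | mul _ a b => s.reg a * s.reg b < U
  | rd _ k a => k < 16 ∧ s.reg a < B
  | wr k a _ => k < 16 ∧ s.reg a < B
  | emit _ _ => True

/-- The number of instructions of the compiled operation. -/
def cost : Op → ℕ
  | rd _ _ _ => 4
  | wr _ _ _ => 4
  | _ => 1

/-- The machine register of a register of the structured language. The machine registers `2` and
`3` are reserved for the array length and for addresses. -/
def mreg (r : ℕ) : ℕ := if r < 2 then r else r + 2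

/-- The instructions of an operation; array `k` starts at address `k * B`, where `B` is held in
machine register `2`. -/
def code : Op → List Instr
  | const d k => [.const (mreg d) k]
  | add d a b => [.add (mreg d) (mreg a) (mreg b)]
  | sub d a b => [.sub (mreg d) (mreg a) (mreg b)]
  | mul d a b => [.mul (mreg d) (mreg a) (mreg b)]
  | rd d k a => [.const 3 k, .mul 3 3 2, .add 3 3 (mreg a), .load (mreg d) 3]
  | wr k a b => [.const 3 k, .mul 3 3 2, .add 3 3 (mreg a), .store 3 (mreg b)]
  | emit a b => [.emit (mreg a) (mreg b)]

end Op

/-- The effect of a block of operations. -/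
def runOps : List Op → St → St
  | [], s => s
  | o :: l, s => runOps l (o.run s)

/-- All operations of a block are faithful. -/
def okOps (B U : ℕ) : List Op → St → Prop
  | [], _ => True
  | o :: l, s => o.ok B U s ∧ okOps B U l (o.run s)

/-- The number of instructions of a block. -/
def costOps : List Op → ℕ
  | [] => 0
  | o :: l => o.cost + costOps l

/-- Commands of the structured language; tests compare two registers by `<`. -/
inductive Cmd
  | blk (l : List Op)
  | seq (c d : Cmd)
  | ite (a b : ℕ) (c d : Cmd)
  | loop (a b : ℕ) (c : Cmd)

infixr:60 " ;; " => Cmd.seq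

/-- Big-step semantics, with the exact number of machine instructions. -/
inductive Exec (B U : ℕ) : Cmd → St → ℕ → St → Prop
  | blk {l : List Op} {s : St} (h : okOps B U l s) : Exec B U (.blk l) s (costOps l) (runOps l s)
  | seq {c d : Cmd} {s s₁ s₂ : St} {t₁ t₂ : ℕ} (h₁ : Exec B U c s t₁ s₁)
      (h₂ : Exec B U d s₁ t₂ s₂) : Exec B U (c ;; d) s (t₁ + t₂) s₂
  | iteT {a b : ℕ} {c d : Cmd} {s s₁ : St} {t : ℕ} (hab : s.reg a < s.reg b)
      (h : Exec B U c s t s₁) : Exec B U (.ite a b c d) s (t + 1) s₁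
  | iteF {a b : ℕ} {c d : Cmd} {s s₁ : St} {t : ℕ} (hab : ¬ s.reg a < s.reg b)
      (h : Exec B U d s t s₁) : Exec B U (.ite a b c d) s (t + 2) s₁
  | loopF {a b : ℕ} {c : Cmd} {s : St} (hab : ¬ s.reg a < s.reg b) :
      Exec B U (.loop a b c) s 2 s
  | loopT {a b : ℕ} {c : Cmd} {s s₁ s₂ : St} {t₁ t₂ : ℕ} (hab : s.reg a < s.reg b)
      (h₁ : Exec B U c s t₁ s₁) (h₂ : Exec B U (.loop a b c) s₁ t₂ s₂) :
      Exec B U (.loop a b c) s (t₁ + 2 + t₂) s₂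

/-! ### Compilation -/

/-- The length of the compiled code. -/
def Cmd.size : Cmd → ℕ
  | .blk l => costOps l
  | .seq c d => c.size + d.size
  | .ite _ _ c d => c.size + d.size + 2
  | .loop _ _ c => c.size + 3

/-- The code of a command that starts at position `o`. -/
def Cmd.code : Cmd → ℕ → List Instr
  | .blk l, _ => l.flatMap Op.code
  | .seq c d, o => c.code o ++ d.code (o + c.size)
  | .ite a b c d, o =>
      .jumpLT (Op.mreg a) (Op.mreg b) (o + d.size + 2) ::
        (d.code (o + 1) ++ .jump (o + d.size + 2 + c.size) :: c.code (o + d.size + 2))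
  | .loop a b c, o =>
      .jumpLT (Op.mreg a) (Op.mreg b) (o + 2) :: .jump (o + c.size + 3) ::
        (c.code (o + 2) ++ [.jump o])

theorem Op.code_length (o : Op) : o.code.length = o.cost := by
  cases o <;> rfl

theorem flatMap_code_length (l : List Op) : (l.flatMap Op.code).length = costOps l := by
  induction l with
  | nil => rfl
  | cons o l ih => simp [List.flatMap_cons, costOps, ih, Op.code_length]

theorem Cmd.code_length (c : Cmd) (o : ℕ) : (c.code o).length = c.size := by
  induction c generalizing o with
  | blk l => rw [Cmd.code, flatMap_code_length, Cmd.size]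
  | seq c d ihc ihd => simp [Cmd.code, Cmd.size, ihc, ihd]
  | ite a b c d ihc ihd => simp [Cmd.code, Cmd.size, ihc, ihd]; omega
  | loop a b c ih => simp [Cmd.code, Cmd.size, ih]

/-- `Steps P w c t c'`: the program executes `t` instructions, none of them an `await`, from `c` to
`c'`. -/
inductive Steps (P : Program) (w : ℕ) : Config → ℕ → Config → Prop
  | refl (c : Config) : Steps P w c 0 c
  | step {c c₁ c' : Config} {i : Instr} {t : ℕ} (hi : P[c.pc]? = some i)
      (he : i.exec w c = some c₁) (h : Steps P w c₁ t c') : Steps P w c (t + 1) c'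

theorem Steps.trans {P : Program} {w : ℕ} {c c₁ c₂ : Config} {t₁ t₂ : ℕ}
    (h₁ : Steps P w c t₁ c₁) (h₂ : Steps P w c₁ t₂ c₂) : Steps P w c (t₁ + t₂) c₂ := by
  induction h₁ with
  | refl c => simpa using h₂
  | step hi he _ ih => rw [Nat.add_right_comm]; exact .step hi he (ih h₂)

theorem Steps.single {P : Program} {w : ℕ} {c c₁ : Config} {i : Instr}
    (hi : P[c.pc]? = some i) (he : i.exec w c = some c₁) : Steps P w c 1 c₁ :=
  .step hi he (.refl _)

theorem Steps.runs {P : Program} {w : ℕ} {c c₁ c₂ : Config} {t₁ t₂ : ℕ}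
    (h₁ : Steps P w c t₁ c₁) (h₂ : Runs P w c₁ t₂ c₂) : Runs P w c (t₁ + t₂) c₂ := by
  induction h₁ with
  | refl c => simpa using h₂
  | step hi he _ ih => rw [Nat.add_right_comm]; exact .step hi he (ih h₂)

/-- The machine configuration `c` represents the state `s`. All words are below `2 ^ w`, so that
no operation that is `ok` is truncated. -/
structure Sim (w B : ℕ) (s : St) (c : Config) : Prop where
  reg : ∀ r, c.reg (Op.mreg r) = s.reg r
  len : c.reg 2 = B
  arr : ∀ k < 16, ∀ i < B, c.mem (k * B + i) = s.arr k i
  out : c.out = s.out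
  reg_lt : ∀ r, c.reg r < 2 ^ w
  mem_lt : ∀ a, c.mem a < 2 ^ w

theorem Op.mreg_inj {a b : ℕ} : Op.mreg a = Op.mreg b ↔ a = b := by
  unfold Op.mreg; split_ifs <;> omega

theorem Op.mreg_ne_two (a : ℕ) : Op.mreg a ≠ 2 := by
  unfold Op.mreg; split_ifs <;> omega

theorem Op.mreg_ne_three (a : ℕ) : Op.mreg a ≠ 3 := by
  unfold Op.mreg; split_ifs <;> omega

theorem Sim.setReg {w B : ℕ} {s : St} {c : Config} (h : Sim w B s c) (d x : ℕ) (hx : x < 2 ^ w) :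
    Sim w B { s with reg := Function.update s.reg d x } (c.setReg w (Op.mreg d) x) := by
  refine ⟨fun r => ?_, ?_, h.arr, h.out, fun r => ?_, h.mem_lt⟩
  · simp only [Config.setReg, Function.update_apply, Op.mreg_inj, Nat.mod_eq_of_lt hx, h.reg]
  · simp only [Config.setReg, Function.update_apply, (Op.mreg_ne_two d).symm, if_false, h.len]
  · simp only [Config.setReg, Function.update_apply, Nat.mod_eq_of_lt hx]
    split_ifs
    exacts [hx, h.reg_lt r]

theorem Sim.setScratch {w B : ℕ} {s : St} {c : Config} (h : Sim w B s c) (x : ℕ) :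
    Sim w B s (c.setReg w 3 x) := by
  refine ⟨fun r => ?_, ?_, h.arr, h.out, fun r => ?_, h.mem_lt⟩
  · simp only [Config.setReg, Function.update_apply, Op.mreg_ne_three, if_false, h.reg]
  · simpa [Config.setReg, Function.update_apply] using h.len
  · simp only [Config.setReg, Function.update_apply]
    split_ifs
    exacts [Nat.mod_lt _ (by positivity), h.reg_lt r]

theorem add_mul_eq_iff {B k l i j : ℕ} (hi : i < B) (hj : j < B) :
    k * B + i = l * B + j ↔ k = l ∧ i = j := by
  constructor
  · intro h
    have h1 : (k * B + i) / B = k := by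
      rw [Nat.mul_comm, Nat.mul_add_div (by omega), Nat.div_eq_of_lt hi, Nat.add_zero]
    have h2 : (l * B + j) / B = l := by
      rw [Nat.mul_comm, Nat.mul_add_div (by omega), Nat.div_eq_of_lt hj, Nat.add_zero]
    have h3 : k = l := by rw [← h1, ← h2, h]
    subst h3
    omega
  · rintro ⟨rfl, rfl⟩; rfl

/-- The three instructions that compute the address of an array entry. -/
theorem steps_address {P : Program} {w B : ℕ} {s : St} {c : Config} (h : Sim w B s c) {k a : ℕ}
    (hB : 16 * B ≤ 2 ^ w) (hk : k < 16) (ha : s.reg a < B) (i : Instr)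
    (hP : ∀ j, j < 4 → P[c.pc + j]? =
      [Instr.const 3 k, .mul 3 3 2, .add 3 3 (Op.mreg a), i][j]?) :
    ∃ c', Steps P w c 3 c' ∧ Sim w B s c' ∧ c'.pc = c.pc + 3 ∧ c'.reg 3 = k * B + s.reg a := by
  have hkB : k * B + s.reg a < 2 ^ w := by
    have : k * B ≤ 15 * B := Nat.mul_le_mul_right _ (by omega)
    omega
  have hk' : k < 2 ^ w := by
    have : k * 1 ≤ k * B := Nat.mul_le_mul_left _ (by omega)
    omega
  have e1 : (Instr.mul 3 3 2).exec w (c.setReg w 3 k) =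
      some ((c.setReg w 3 k).setReg w 3 (k * B)) := by
    simp [Instr.exec, Config.setReg, Nat.mod_eq_of_lt hk', h.len]
  have e2 : (Instr.add 3 3 (Op.mreg a)).exec w ((c.setReg w 3 k).setReg w 3 (k * B)) =
      some (((c.setReg w 3 k).setReg w 3 (k * B)).setReg w 3 (k * B + s.reg a)) := by
    simp [Instr.exec, Config.setReg, Op.mreg_ne_three, h.reg,
      Nat.mod_eq_of_lt (show k * B < 2 ^ w by omega)]
  refine ⟨((c.setReg w 3 k).setReg w 3 (k * B)).setReg w 3 (k * B + s.reg a),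
    .step (hP 0 (by omega)) rfl (.step (hP 1 (by omega)) e1
      (.step (hP 2 (by omega)) e2 (.refl _))),
    ((h.setScratch _).setScratch _).setScratch _, rfl, ?_⟩
  simp [Config.setReg, Nat.mod_eq_of_lt hkB]

theorem steps_op {P : Program} {w B : ℕ} {s : St} {c : Config} (h : Sim w B s c)
    (hB : 16 * B ≤ 2 ^ w) (hB0 : 0 < B) (o : Op) (hok : o.ok B (2 ^ w) s)
    (hP : ∀ j, j < o.code.length → P[c.pc + j]? = o.code[j]?) :
    ∃ c', Steps P w c o.cost c' ∧ Sim w B (o.run s) c' ∧ c'.pc = c.pc + o.cost := by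
  cases o with
  | const d k =>
    refine ⟨_, .single (hP 0 (by simp [Op.code])) rfl, h.setReg d k ?_, rfl⟩
    simp only [Op.ok] at hok; omega
  | add d a b =>
    refine ⟨_, .single (hP 0 (by simp [Op.code])) rfl, ?_, rfl⟩
    rw [h.reg, h.reg]; exact h.setReg d _ hok
  | sub d a b =>
    refine ⟨_, .single (hP 0 (by simp [Op.code])) rfl, ?_, rfl⟩
    rw [h.reg, h.reg]; refine h.setReg d _ ((Nat.sub_le _ _).trans_lt ?_)
    rw [← h.reg]; exact h.reg_lt _
  | mul d a b =>
    refine ⟨_, .single (hP 0 (by simp [Op.code])) rfl, ?_, rfl⟩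
    rw [h.reg, h.reg]; exact h.setReg d _ hok
  | rd d k a =>
    obtain ⟨c', h1, h2, h3, h4⟩ := steps_address h hB hok.1 hok.2 _ hP
    refine ⟨_, h1.trans (.single (i := .load (Op.mreg d) 3) ?_ rfl), ?_, ?_⟩
    · rw [h3]; exact hP 3 (by simp [Op.code])
    · rw [h4, h2.arr k hok.1 _ hok.2]
      refine h2.setReg d _ ?_
      rw [← h2.arr k hok.1 _ hok.2]; exact h2.mem_lt _
    · simp [Config.setReg, h3, Op.cost]
  | wr k a b =>
    obtain ⟨c', h1, h2, h3, h4⟩ := steps_address h hB hok.1 hok.2 _ hP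
    refine ⟨_, h1.trans (.single (i := .store 3 (Op.mreg b)) ?_ rfl), ?_, ?_⟩
    · rw [h3]; exact hP 3 (by simp [Op.code])
    · refine ⟨h2.reg, h2.len, fun l hl i hi => ?_, h2.out, h2.reg_lt, fun x => ?_⟩
      · simp only [Op.run, Function.update_apply, h4, h2.reg]
        simp only [add_mul_eq_iff hi hok.2]
        by_cases hlk : l = k
        · subst hlk
          by_cases hia : i = s.reg a
          · simp [hia]
          · simp [hia, h2.arr l hl i hi]
        · simp [hlk, h2.arr l hl i hi]
      · simp only [Function.update_apply]
        split_ifs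
        exacts [h2.reg_lt _, h2.mem_lt _]
    · simp [h3, Op.cost]
  | emit a b =>
    refine ⟨_, .single (hP 0 (by simp [Op.code])) rfl, ?_, rfl⟩
    refine ⟨h.reg, h.len, h.arr, ?_, h.reg_lt, h.mem_lt⟩
    simp [Op.run, h.out, h.reg]

theorem steps_ops {P : Program} {w B : ℕ} {s : St} {c : Config} (h : Sim w B s c)
    (hB : 16 * B ≤ 2 ^ w) (hB0 : 0 < B) (l : List Op) (hok : okOps B (2 ^ w) l s)
    {pre post : List Instr} (hP : P = pre ++ (l.flatMap Op.code ++ post)) (hc : c.pc = pre.length) :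
    ∃ c', Steps P w c (costOps l) c' ∧ Sim w B (runOps l s) c' ∧ c'.pc = c.pc + costOps l := by
  induction l generalizing s c pre with
  | nil => exact ⟨c, .refl _, h, rfl⟩
  | cons o l ih =>
    rw [List.flatMap_cons] at hP
    obtain ⟨c₁, h1, h2, h3⟩ := steps_op (P := P) h hB hB0 o hok.1 (by
      intro j hj
      subst hP
      rw [hc, List.getElem?_append_right (by omega), List.append_assoc,
        List.getElem?_append_left (by omega)]
      congr 1; omega)
    obtain ⟨c₂, h4, h5, h6⟩ := ih h2 hok.2 (pre := pre ++ o.code) (by simpa using hP)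
      (by rw [h3, hc, List.length_append, Op.code_length])
    exact ⟨c₂, h1.trans h4, h5, by rw [h6, h3, costOps, Nat.add_assoc]⟩

theorem getElem?_of_eq_append {P pre l : List Instr} {i : Instr} {k : ℕ} (hP : P = pre ++ i :: l)
    (hk : k = pre.length) : P[k]? = some i := by
  subst hP; subst hk; simp

/-- The compiler is correct, and exact in its running time. -/
theorem Exec.steps {P : Program} {w B : ℕ} (hB : 16 * B ≤ 2 ^ w) (hB0 : 0 < B) {cmd : Cmd}
    {s s' : St} {t : ℕ} (he : Exec B (2 ^ w) cmd s t s') {c : Config} (h : Sim w B s c)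
    {pre post : List Instr} (hP : P = pre ++ (cmd.code c.pc ++ post)) (hc : c.pc = pre.length) :
    ∃ c', Steps P w c t c' ∧ Sim w B s' c' ∧ c'.pc = c.pc + cmd.size := by
  have setpc : ∀ {s : St} {c : Config} (q : ℕ), Sim w B s c → Sim w B s { c with pc := q } :=
    fun q h => ⟨h.reg, h.len, h.arr, h.out, h.reg_lt, h.mem_lt⟩
  induction he generalizing c pre post with
  | blk hok => exact steps_ops h hB hB0 _ hok hP hc
  | @seq cc dd s s1 s2 t1 t2 _ _ ih1 ih2 =>
    simp only [Cmd.code] at hP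
    obtain ⟨c1, h1, h2, h3⟩ := ih1 h (pre := pre) (post := dd.code (c.pc + cc.size) ++ post)
      (by simpa using hP) hc
    obtain ⟨c2, h4, h5, h6⟩ := ih2 h2 (pre := pre ++ cc.code c.pc) (post := post)
      (by rw [h3]; simpa using hP) (by rw [h3, List.length_append, Cmd.code_length, hc])
    exact ⟨c2, h1.trans h4, h5, by rw [h6, h3, Cmd.size, Nat.add_assoc]⟩
  | @iteT a b cc dd s s1 t hab _ ih =>
    simp only [Cmd.code] at hP
    have e : (Instr.jumpLT (Op.mreg a) (Op.mreg b) (c.pc + dd.size + 2)).exec w c =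
        some { c with pc := c.pc + dd.size + 2 } := by
      simp [Instr.exec, h.reg, hab]
    obtain ⟨c1, h1, h2, h3⟩ := ih (setpc (c.pc + dd.size + 2) h)
      (pre := pre ++ .jumpLT (Op.mreg a) (Op.mreg b) (c.pc + dd.size + 2) ::
        (dd.code (c.pc + 1) ++ [.jump (c.pc + dd.size + 2 + cc.size)])) (post := post)
      (by simpa using hP)
      (by simp [Cmd.code_length, hc]; omega)
    refine ⟨c1, .step (getElem?_of_eq_append (by simpa using hP) hc) e h1, h2, ?_⟩
    rw [h3]; simp only [Cmd.size]; omega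
  | @iteF a b cc dd s s1 t hab _ ih =>
    simp only [Cmd.code] at hP
    have e : (Instr.jumpLT (Op.mreg a) (Op.mreg b) (c.pc + dd.size + 2)).exec w c =
        some { c with pc := c.pc + 1 } := by
      simp only [Instr.exec, h.reg, hab, if_false]
    obtain ⟨c1, h1, h2, h3⟩ := ih (setpc (c.pc + 1) h)
      (pre := pre ++ [.jumpLT (Op.mreg a) (Op.mreg b) (c.pc + dd.size + 2)])
      (post := .jump (c.pc + dd.size + 2 + cc.size) :: cc.code (c.pc + dd.size + 2) ++ post)
      (by simpa using hP)
      (by simp [hc])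
    refine ⟨{ c1 with pc := c.pc + dd.size + 2 + cc.size },
      .step (getElem?_of_eq_append (by simpa using hP) hc) e (h1.trans (.single
        (i := .jump (c.pc + dd.size + 2 + cc.size)) (getElem?_of_eq_append
        (pre := pre ++ .jumpLT (Op.mreg a) (Op.mreg b) (c.pc + dd.size + 2) :: dd.code (c.pc + 1))
        (l := cc.code (c.pc + dd.size + 2) ++ post) (by simpa using hP) ?_) rfl)),
      setpc _ h2, ?_⟩
    · rw [h3]; simp [Cmd.code_length, hc]; omega
    · simp only [Cmd.size]; omega
  | @loopF a b cc s hab =>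
    simp only [Cmd.code] at hP
    have e : (Instr.jumpLT (Op.mreg a) (Op.mreg b) (c.pc + 2)).exec w c =
        some { c with pc := c.pc + 1 } := by
      simp only [Instr.exec, h.reg, hab, if_false]
    refine ⟨{ c with pc := c.pc + cc.size + 3 },
      .step (getElem?_of_eq_append (by simpa using hP) hc) e (.single
        (i := .jump (c.pc + cc.size + 3)) (getElem?_of_eq_append
        (pre := pre ++ [.jumpLT (Op.mreg a) (Op.mreg b) (c.pc + 2)])
        (by simp only [List.cons_append, List.append_assoc, List.nil_append] at hP ⊢; exact hP)
        (by simp [hc])) rfl),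
      setpc _ h, ?_⟩
    simp only [Cmd.size]; omega
  | @loopT a b cc s s1 s2 t1 t2 hab _ _ ih1 ih2 =>
    have hP' := hP
    simp only [Cmd.code] at hP
    have e : (Instr.jumpLT (Op.mreg a) (Op.mreg b) (c.pc + 2)).exec w c =
        some { c with pc := c.pc + 2 } := by
      simp [Instr.exec, h.reg, hab]
    obtain ⟨c1, h1, h2, h3⟩ := ih1 (setpc (c.pc + 2) h)
      (pre := pre ++ [.jumpLT (Op.mreg a) (Op.mreg b) (c.pc + 2), .jump (c.pc + cc.size + 3)])
      (post := .jump c.pc :: post) (by simpa using hP) (by simp [hc])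
    obtain ⟨c2, h4, h5, h6⟩ := ih2 (setpc c.pc h2) (pre := pre) (post := post) hP' hc
    have h7 : Steps P w c (t1 + 2 + t2) c2 := by
      have h8 : Steps P w c1 1 { c1 with pc := c.pc } := .single (i := .jump c.pc)
        (getElem?_of_eq_append (l := post)
          (pre := pre ++ .jumpLT (Op.mreg a) (Op.mreg b) (c.pc + 2) :: .jump (c.pc + cc.size + 3) ::
            cc.code (c.pc + 2)) (by simpa using hP)
          (by rw [h3]; simp [Cmd.code_length, hc]; omega)) rfl
      have h9 := (Steps.single (getElem?_of_eq_append (by simpa using hP) hc) e).trans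
        ((h1.trans h8).trans h4)
      rwa [show 1 + (t1 + 1 + t2) = t1 + 2 + t2 by omega] at h9
    exact ⟨c2, h7, h5, h6⟩

/-! ### Program logic -/

/-- From the state `s`, the command terminates after `t` instructions in a state `s'` with
`Q t s'`. -/
def WP (B U : ℕ) (c : Cmd) (s : St) (Q : ℕ → St → Prop) : Prop :=
  ∃ t s', Exec B U c s t s' ∧ Q t s'

theorem WP.mono {B U : ℕ} {c : Cmd} {s : St} {Q Q' : ℕ → St → Prop} (h : WP B U c s Q)
    (hQ : ∀ t s', Q t s' → Q' t s') : WP B U c s Q' := by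
  obtain ⟨t, s', h1, h2⟩ := h
  exact ⟨t, s', h1, hQ t s' h2⟩

theorem WP.blk {B U : ℕ} {l : List Op} {s : St} {Q : ℕ → St → Prop} (h : okOps B U l s)
    (hQ : Q (costOps l) (runOps l s)) : WP B U (.blk l) s Q :=
  ⟨_, _, .blk h, hQ⟩

theorem WP.seq {B U : ℕ} {c d : Cmd} {s : St} {Q : ℕ → St → Prop}
    (h : WP B U c s fun t s' => WP B U d s' fun t' s'' => Q (t + t') s'') :
    WP B U (c ;; d) s Q := by
  obtain ⟨t, s', h1, t', s'', h2, h3⟩ := h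
  exact ⟨_, _, .seq h1 h2, h3⟩

theorem WP.ite {B U : ℕ} {a b : ℕ} {c d : Cmd} {s : St} {Q : ℕ → St → Prop}
    (h1 : s.reg a < s.reg b → WP B U c s fun t s' => Q (t + 1) s')
    (h2 : ¬ s.reg a < s.reg b → WP B U d s fun t s' => Q (t + 2) s') :
    WP B U (.ite a b c d) s Q := by
  by_cases h : s.reg a < s.reg b
  · obtain ⟨t, s', h3, h4⟩ := h1 h
    exact ⟨_, _, .iteT h h3, h4⟩
  · obtain ⟨t, s', h3, h4⟩ := h2 h
    exact ⟨_, _, .iteF h h3, h4⟩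

/-- Loops: `I m s` says that the state `s` satisfies the invariant, and that the remaining
iterations take at most `m` instructions. -/
theorem WP.loop {B U : ℕ} {a b : ℕ} {c : Cmd} (I : ℕ → St → Prop)
    (hI : ∀ m s, I m s → s.reg a < s.reg b →
      WP B U c s fun t s' => ∃ m', t + 2 + m' ≤ m ∧ I m' s')
    {m : ℕ} {s : St} (h : I m s) :
    WP B U (.loop a b c) s fun t s' =>
      t ≤ m + 2 ∧ (∃ m', m' ≤ m ∧ I m' s') ∧ ¬ s'.reg a < s'.reg b := by
  induction m using Nat.strong_induction_on generalizing s with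
  | _ m ih =>
    by_cases hab : s.reg a < s.reg b
    · obtain ⟨t, s', h1, m', h2, h3⟩ := hI m s h hab
      obtain ⟨t', s'', h4, h5, ⟨m'', h6, h7⟩, h8⟩ := ih m' (by omega) h3
      exact ⟨_, _, .loopT hab h1 h4, by omega, ⟨m'', by omega, h7⟩, h8⟩
    · exact ⟨2, s, .loopF hab, by omega, ⟨m, le_rfl, h⟩, hab⟩

/-- Counting loops. -/
theorem WP.for {B U : ℕ} {a b : ℕ} {c : Cmd} (N K : ℕ) (I : ℕ → St → Prop)
    (hI : ∀ i s, i < N → s.reg a = i → s.reg b = N → I i s →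
      WP B U c s fun t s' => t ≤ K ∧ s'.reg a = i + 1 ∧ s'.reg b = N ∧ I (i + 1) s')
    {i : ℕ} {s : St} (hi : i ≤ N) (ha : s.reg a = i) (hb : s.reg b = N) (h : I i s) :
    WP B U (.loop a b c) s fun t s' =>
      t ≤ (N - i) * (K + 2) + 2 ∧ s'.reg a = N ∧ s'.reg b = N ∧ I N s' := by
  refine (WP.loop (fun m s => ∃ i ≤ N, m = (N - i) * (K + 2) ∧ s.reg a = i ∧ s.reg b = N ∧ I i s)
    ?_ ⟨i, hi, rfl, ha, hb, h⟩).mono ?_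
  · rintro m s ⟨i, hi, rfl, ha, hb, h⟩ hab
    refine (hI i s (by omega) ha hb h).mono ?_
    rintro t s' ⟨h1, h2, h3, h4⟩
    refine ⟨(N - (i + 1)) * (K + 2), ?_, i + 1, by omega, rfl, h2, h3, h4⟩
    obtain ⟨j, hj⟩ : ∃ j, N - i = j + 1 := ⟨N - i - 1, by omega⟩
    rw [hj, show N - (i + 1) = j by omega, Nat.add_mul]
    omega
  · rintro t s' ⟨h1, ⟨m', -, i', hi', -, ha', hb', h'⟩, h2⟩
    obtain rfl : i' = N := by omega
    exact ⟨h1, ha', hb', h'⟩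

/-! ### Counting classes -/

/-- If the fibres of `g` arise from those of `f` by merging at most the fibres of `a` and `b`, then
`g` has at most one fibre less. -/
theorem card_le_card_succ_of_merge {α β γ : Type*} [Finite γ] {f : α → β} {g : α → γ}
    (hf : f.Surjective) (a b : α)
    (h : ∀ x y, g x = g y → f x = f y ∨ (f x = f a ∧ f y = f b) ∨ (f x = f b ∧ f y = f a)) :
    Nat.card β ≤ Nat.card γ + 1 := by
  classical
  let F : β → Option γ := fun q => if q = f a then none else some (g (hf q).choose)
  have hF : F.Injective := by
    intro p q hpq
    simp only [F] at hpq
    have hp := (hf p).choose_spec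
    have hq := (hf q).choose_spec
    split_ifs at hpq with h1 h2 h2
    · rw [h1, h2]
    · rcases h _ _ (Option.some.inj hpq) with h3 | ⟨h3, -⟩ | ⟨-, h3⟩
      · rw [← hp, ← hq, h3]
      · exact absurd (hp ▸ h3) h1
      · exact absurd (hq ▸ h3) h2
  have := Nat.card_le_card_of_injective F hF
  rwa [Finite.card_option] at this

theorem card_le_card_of_fibres {α β γ : Type*} [Finite γ] {f : α → β} {g : α → γ}
    (hf : f.Surjective) (h : ∀ x y, g x = g y → f x = f y) : Nat.card β ≤ Nat.card γ := by
  refine Nat.card_le_card_of_injective (fun q => g (hf q).choose) fun p q hpq => ?_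
  have hp := (hf p).choose_spec
  have hq := (hf q).choose_spec
  rw [← hp, ← hq, h _ _ hpq]

theorem quot_mk_eq_iff {α : Type*} {r : α → α → Prop} {x y : α} :
    Quot.mk r x = Quot.mk r y ↔ Relation.EqvGen r x y :=
  ⟨Quot.eqvGen_exact, Quot.eqvGen_sound⟩

/-- The equivalence relation generated by `r` and one more pair `(a, b)`, in terms of a function
`f` that has the classes of `r` as fibres. -/
theorem eqvGen_insert_iff {α β : Type*} {r r' : α → α → Prop} {f : α → β} {a b : α}
    (hf : ∀ x y, f x = f y ↔ Relation.EqvGen r x y) (hr : ∀ x y, r x y → r' x y) (hab : r' a b)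
    (h : ∀ x y, r' x y → r x y ∨ (x = a ∧ y = b) ∨ (x = b ∧ y = a)) (x y : α) :
    Relation.EqvGen r' x y ↔
      f x = f y ∨ (f x = f a ∧ f y = f b) ∨ (f x = f b ∧ f y = f a) := by
  constructor
  · intro hxy
    induction hxy with
    | rel x y hxy =>
      rcases h x y hxy with h1 | ⟨rfl, rfl⟩ | ⟨rfl, rfl⟩
      · exact .inl ((hf _ _).2 (.rel _ _ h1))
      · simp
      · simp
    | refl x => simp
    | symm x y _ ih => grind
    | trans x y z _ _ ih1 ih2 => grind
  · have hm : ∀ x y, f x = f y → Relation.EqvGen r' x y := fun x y hxy =>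
      Relation.EqvGen.mono hr _ _ ((hf _ _).1 hxy)
    rintro (h1 | ⟨h1, h2⟩ | ⟨h1, h2⟩)
    · exact hm _ _ h1
    · exact (hm _ _ h1).trans _ _ _ ((Relation.EqvGen.rel _ _ hab).trans _ _ _ (hm _ _ h2.symm))
    · exact (hm _ _ h1).trans _ _ _
        (((Relation.EqvGen.rel _ _ hab).symm _ _).trans _ _ _ (hm _ _ h2.symm))

/-! ### Duality between edge deletions and merged faces -/

section Duality

variable {n : ℕ} {G : SimpleGraph (Fin n)}

instance finite_dart : Finite G.Dart := by
  classical exact inferInstance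

theorem AdjacencyLists.faceNext_injective (A : AdjacencyLists G) :
    Function.Injective A.faceNext := by
  intro d e h
  have h1 : d.snd = e.snd := congrArg (fun x : G.Dart => x.fst) h
  have h2 := congrArg (fun x : G.Dart => x.snd) h
  obtain ⟨⟨u, v⟩, hd⟩ := d
  obtain ⟨⟨u', v'⟩, he⟩ := e
  simp only at h1
  subst h1
  simp only [AdjacencyLists.faceNext] at h2
  have hu : u ∈ A.nbrs v := (A.mem_nbrs _ _).2 hd.symm
  have hu' : u' ∈ A.nbrs v := (A.mem_nbrs _ _).2 he.symm
  have h3 := List.prev_next _ (A.nodup v) u hu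
  have h4 := List.prev_next _ (A.nodup v) u' hu'
  simp only [h2] at h3
  have : u = u' := h3.symm.trans h4
  subst this
  rfl

/-- One step between darts on the sphere without the deleted edges: to the next dart of the face, or
across a deleted edge. The classes generated by it are the faces of the current graph `H`, in terms
of the original embedding of `G`. -/
def dualStep (A : AdjacencyLists G) (H : SimpleGraph (Fin n)) (d e : G.Dart) : Prop :=
  A.faceNext d = e ∨ (e = d.symm ∧ ¬ H.Adj d.fst d.snd)

/-- The two sides of a bridge belong to one face. Otherwise consider the darts in the face of `d`
that cross the cut given by the bridge: as the face is closed under `faceNext`, equally many of them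
cross in both directions; but all of them except `d` come in opposite pairs. -/
theorem eqvGen_dualStep_of_bridge (A : AdjacencyLists G) {H : SimpleGraph (Fin n)} (hH : H ≤ G)
    {u v : Fin n} (huv : H.Adj u v) (hb : ¬ (H.deleteEdges {s(u, v)}).Reachable u v) :
    Relation.EqvGen (dualStep A H) ⟨(u, v), hH huv⟩ ⟨(v, u), (hH huv).symm⟩ := by
  classical
  by_contra hcon
  set d0 : G.Dart := ⟨(u, v), hH huv⟩ with hd0
  set H' := H.deleteEdges {s(u, v)} with hH'
  let χ : Fin n → ℤ := fun x => if H'.Reachable u x then 1 else 0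
  let f : G.Dart → ℤ := fun d => χ d.fst - χ d.snd
  let Cl : Finset G.Dart := Finset.univ.filter fun d => Relation.EqvGen (dualStep A H) d0 d
  have hCl : ∀ d, d ∈ Cl ↔ Relation.EqvGen (dualStep A H) d0 d := by simp [Cl]
  have hnext : ∀ d, A.faceNext d ∈ Cl ↔ d ∈ Cl := by
    intro d
    rw [hCl, hCl]
    have : Relation.EqvGen (dualStep A H) d (A.faceNext d) := .rel _ _ (.inl rfl)
    exact ⟨fun h => h.trans _ _ _ (this.symm _ _), fun h => h.trans _ _ _ this⟩
  -- the sum over the face telescopes along `faceNext`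
  have hsum1 : ∑ d ∈ Cl, f d = 0 := by
    rw [Finset.sum_sub_distrib, sub_eq_zero]
    symm
    refine Finset.sum_bij (fun d _ => A.faceNext d) (fun d hd => (hnext d).2 hd)
      (fun _ _ _ _ h => A.faceNext_injective h) (fun e he => ?_) (fun d _ => rfl)
    obtain ⟨d, rfl⟩ := (Finite.injective_iff_surjective.1 A.faceNext_injective) e
    exact ⟨d, (hnext d).1 he, rfl⟩
  -- off `d0`, it cancels along `symm`
  have hcross : ∀ d ∈ Cl.erase d0, f d ≠ 0 → d.symm ∈ Cl.erase d0 := by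
    intro d hd hfd
    rw [Finset.mem_erase, hCl] at hd
    have hne : d ≠ d0.symm := by
      rintro rfl; exact hcon hd.2
    have hnadj : ¬ H.Adj d.fst d.snd := by
      intro hadj
      apply hfd
      have hadj' : H'.Adj d.fst d.snd := by
        rw [hH', SimpleGraph.deleteEdges_adj]
        refine ⟨hadj, fun hmem => ?_⟩
        rw [Set.mem_singleton_iff, Sym2.eq_iff] at hmem
        rcases hmem with ⟨h1, h2⟩ | ⟨h1, h2⟩
        · exact hd.1 (SimpleGraph.Dart.ext _ _ (Prod.ext h1 h2))
        · exact hne (SimpleGraph.Dart.ext _ _ (Prod.ext h1 h2))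
      have : H'.Reachable u d.fst ↔ H'.Reachable u d.snd :=
        ⟨fun h => h.trans hadj'.reachable, fun h => h.trans hadj'.symm.reachable⟩
      simp only [f, χ, this, sub_self]
    rw [Finset.mem_erase, hCl]
    refine ⟨fun h => hne ?_, hd.2.trans _ _ _ (.rel _ _ (.inr ⟨rfl, hnadj⟩))⟩
    rw [← h, SimpleGraph.Dart.symm_symm]
  have hsum2 : ∑ d ∈ Cl.erase d0, f d = 0 := by
    have hsymm : ∀ d, f d.symm = - f d := fun d => by
      simp only [f, neg_sub]; rfl
    rw [← Finset.sum_filter_ne_zero]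
    refine Finset.sum_involution (fun d _ => d.symm) (fun d _ => by rw [hsymm]; ring)
      (fun d _ _ => d.symm_ne) (fun d hd => ?_) (fun d _ => d.symm_symm)
    rw [Finset.mem_filter] at hd ⊢
    exact ⟨hcross d hd.1 hd.2, by rw [hsymm]; simpa using hd.2⟩
  have hmem : d0 ∈ Cl := (hCl _).2 (.refl _)
  have h3 : f d0 = 1 := by simp [f, χ, d0, hb]
  rw [← Finset.add_sum_erase _ _ hmem, hsum2, h3] at hsum1
  norm_num at hsum1

/-- The number of faces of the current graph `H` that contain a dart of the original graph. -/
noncomputable def dualClasses (A : AdjacencyLists G) (H : SimpleGraph (Fin n)) : ℕ :=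
  Nat.card (Quot (dualStep A H))

theorem dualStep_mono (A : AdjacencyLists G) {H H' : SimpleGraph (Fin n)} (h : H' ≤ H)
    (d e : G.Dart) (hde : dualStep A H d e) : dualStep A H' d e :=
  hde.imp id fun h1 => ⟨h1.1, fun h2 => h1.2 (h h2)⟩

theorem dualStep_deleteEdges (A : AdjacencyLists G) {H : SimpleGraph (Fin n)} {u v : Fin n}
    (huv : G.Adj u v) (d e : G.Dart) (h : dualStep A (H.deleteEdges {s(u, v)}) d e) :
    dualStep A H d e ∨ (d = ⟨(u, v), huv⟩ ∧ e = ⟨(v, u), huv.symm⟩) ∨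
      (d = ⟨(v, u), huv.symm⟩ ∧ e = ⟨(u, v), huv⟩) := by
  rcases h with h | ⟨rfl, h⟩
  · exact .inl (.inl h)
  · by_cases hd : H.Adj d.fst d.snd
    · rw [SimpleGraph.deleteEdges_adj, not_and_not_right] at h
      have h1 := h hd
      rw [Set.mem_singleton_iff, Sym2.eq_iff] at h1
      right
      rcases h1 with ⟨h1, h2⟩ | ⟨h1, h2⟩
      · exact .inl ⟨SimpleGraph.Dart.ext _ _ (Prod.ext h1 h2),
          SimpleGraph.Dart.ext _ _ (Prod.ext h2 h1)⟩
      · exact .inr ⟨SimpleGraph.Dart.ext _ _ (Prod.ext h1 h2),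
          SimpleGraph.Dart.ext _ _ (Prod.ext h2 h1)⟩
    · exact .inl (.inr ⟨rfl, hd⟩)

theorem not_adj_deleteEdges {H : SimpleGraph (Fin n)} {u v : Fin n} :
    ¬ (H.deleteEdges {s(u, v)}).Adj u v := by
  simp [SimpleGraph.deleteEdges_adj]

/-- Deleting an edge merges at most the faces on its two sides. -/
theorem eqvGen_dualStep_deleteEdges (A : AdjacencyLists G) {H : SimpleGraph (Fin n)}
    {u v : Fin n} (huv : G.Adj u v) (d e : G.Dart) {β : Type*} {f : G.Dart → β}
    (hf : ∀ d e, f d = f e ↔ Relation.EqvGen (dualStep A H) d e) :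
    Relation.EqvGen (dualStep A (H.deleteEdges {s(u, v)})) d e ↔
      f d = f e ∨ (f d = f ⟨(u, v), huv⟩ ∧ f e = f ⟨(v, u), huv.symm⟩) ∨
        (f d = f ⟨(v, u), huv.symm⟩ ∧ f e = f ⟨(u, v), huv⟩) :=
  eqvGen_insert_iff hf (dualStep_mono A (SimpleGraph.deleteEdges_le _))
    (show dualStep A (H.deleteEdges {s(u, v)}) ⟨(u, v), huv⟩ ⟨(v, u), huv.symm⟩ from
      .inr ⟨rfl, not_adj_deleteEdges⟩) (dualStep_deleteEdges A huv) d e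

/-- Deleting an edge splits at most the component of its end points. -/
theorem reachable_deleteEdges {H : SimpleGraph (Fin n)} {u v : Fin n} {x y : Fin n}
    (h : H.Reachable x y) :
    (H.deleteEdges {s(u, v)}).Reachable x y ∨
      ((H.deleteEdges {s(u, v)}).Reachable x u ∧ (H.deleteEdges {s(u, v)}).Reachable y v) ∨
      ((H.deleteEdges {s(u, v)}).Reachable x v ∧ (H.deleteEdges {s(u, v)}).Reachable y u) := by
  set H' := H.deleteEdges {s(u, v)} with hH'
  rw [SimpleGraph.reachable_iff_reflTransGen] at h
  induction h with
  | refl => exact .inl (.refl _)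
  | @tail y z _ hyz ih =>
    by_cases he : s(y, z) = s(u, v)
    · rw [Sym2.eq_iff] at he
      rcases he with ⟨rfl, rfl⟩ | ⟨rfl, rfl⟩
      · rcases ih with h1 | ⟨h1, -⟩ | ⟨h1, -⟩
        · exact .inr (.inl ⟨h1, .refl _⟩)
        · exact .inr (.inl ⟨h1, .refl _⟩)
        · exact .inl h1
      · rcases ih with h1 | ⟨h1, -⟩ | ⟨h1, -⟩
        · exact .inr (.inr ⟨h1, .refl _⟩)
        · exact .inl h1
        · exact .inr (.inr ⟨h1, .refl _⟩)
    · have hyz' : H'.Reachable y z := by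
        refine SimpleGraph.Adj.reachable ?_
        rw [hH', SimpleGraph.deleteEdges_adj]
        exact ⟨hyz, he⟩
      rcases ih with h1 | ⟨h1, h2⟩ | ⟨h1, h2⟩
      · exact .inl (h1.trans hyz')
      · exact .inr (.inl ⟨h1, hyz'.symm.trans h2⟩)
      · exact .inr (.inr ⟨h1, hyz'.symm.trans h2⟩)

/-- The quantity `dualClasses - |E| - |CC|` does not decrease when an edge is deleted, and increases
if the edge is no bridge and has the same face on both sides. -/
theorem dualClasses_deleteEdges (A : AdjacencyLists G) {H : SimpleGraph (Fin n)} (hH : H ≤ G)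
    {u v : Fin n} (huv : H.Adj u v) :
    dualClasses A H + Nat.card (H.deleteEdges {s(u, v)}).ConnectedComponent ≤
        dualClasses A (H.deleteEdges {s(u, v)}) + Nat.card H.ConnectedComponent + 1 ∧
      ((H.deleteEdges {s(u, v)}).Reachable u v →
        Relation.EqvGen (dualStep A H) ⟨(u, v), hH huv⟩ ⟨(v, u), (hH huv).symm⟩ →
        dualClasses A H + Nat.card (H.deleteEdges {s(u, v)}).ConnectedComponent ≤
          dualClasses A (H.deleteEdges {s(u, v)}) + Nat.card H.ConnectedComponent) := by
  set H' := H.deleteEdges {s(u, v)} with hH'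
  have hfib := fun d e => eqvGen_dualStep_deleteEdges A (hH huv) d e
    (f := Quot.mk (dualStep A H)) (H := H) fun d e => quot_mk_eq_iff
  have hd1 : dualClasses A H ≤ dualClasses A H' + 1 :=
    card_le_card_succ_of_merge (f := Quot.mk (dualStep A H)) (g := Quot.mk (dualStep A H'))
      Quot.mk_surjective ⟨(u, v), hH huv⟩ ⟨(v, u), (hH huv).symm⟩ fun x y h =>
      (hfib x y).1 (quot_mk_eq_iff.1 h)
  have hd2 : Relation.EqvGen (dualStep A H) ⟨(u, v), hH huv⟩ ⟨(v, u), (hH huv).symm⟩ →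
      dualClasses A H ≤ dualClasses A H' := fun hrel =>
    card_le_card_of_fibres (f := Quot.mk (dualStep A H)) (g := Quot.mk (dualStep A H'))
      Quot.mk_surjective fun x y h => by
        have h1 := (hfib x y).1 (quot_mk_eq_iff.1 h)
        have h2 := quot_mk_eq_iff.2 hrel
        rcases h1 with h1 | ⟨h1, h3⟩ | ⟨h1, h3⟩
        · exact h1
        · rw [h1, h3, h2]
        · rw [h1, h3, h2]
  have hc1 : Nat.card H'.ConnectedComponent ≤ Nat.card H.ConnectedComponent + 1 :=
    card_le_card_succ_of_merge (f := H'.connectedComponentMk) (g := H.connectedComponentMk)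
      Quot.mk_surjective u v fun x y h => by
        simp only [SimpleGraph.ConnectedComponent.eq] at h ⊢
        exact reachable_deleteEdges h
  have hc2 : H'.Reachable u v →
      Nat.card H'.ConnectedComponent ≤ Nat.card H.ConnectedComponent := fun hr =>
    card_le_card_of_fibres (f := H'.connectedComponentMk) (g := H.connectedComponentMk)
      Quot.mk_surjective fun x y h => by
        simp only [SimpleGraph.ConnectedComponent.eq] at h ⊢
        rcases reachable_deleteEdges (u := u) (v := v) h with h1 | ⟨h1, h2⟩ | ⟨h1, h2⟩
        · exact h1
        · exact (h1.trans hr).trans h2.symm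
        · exact (h1.trans hr.symm).trans h2.symm
  refine ⟨?_, fun h1 h2 => ?_⟩
  · by_cases hr : H'.Reachable u v
    · have := hc2 hr; omega
    · have := hd2 (eqvGen_dualStep_of_bridge A hH huv hr); omega
  · have := hc2 h1; have := hd2 h2; omega

theorem ncard_edgeSet_deleteEdges {H : SimpleGraph (Fin n)} {u v : Fin n} (huv : H.Adj u v) :
    (H.deleteEdges {s(u, v)}).edgeSet.ncard + 1 = H.edgeSet.ncard := by
  rw [SimpleGraph.edgeSet_deleteEdges]
  exact Set.ncard_sdiff_singleton_add_one huv (Set.toFinite _)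

/-- Iterating `dualClasses_deleteEdges` over the edges of `K` outside `H`: the number of dual classes
minus the numbers of edges and components does not decrease from `K` to `H`. -/
theorem dualClasses_mono (A : AdjacencyLists G) {H K : SimpleGraph (Fin n)} (hK : K ≤ G)
    (hHK : H ≤ K) :
    dualClasses A K + H.edgeSet.ncard + Nat.card H.ConnectedComponent ≤
      dualClasses A H + K.edgeSet.ncard + Nat.card K.ConnectedComponent := by
  induction hm : K.edgeSet.ncard using Nat.strong_induction_on generalizing K with
  | _ m ih =>
    by_cases hKH : K ≤ H
    · obtain rfl := le_antisymm hHK hKH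
      omega
    · simp only [SimpleGraph.le_iff_adj, not_forall] at hKH
      obtain ⟨u, v, huv, hn⟩ := hKH
      have h1 := ncard_edgeSet_deleteEdges huv
      have h2 : H ≤ K.deleteEdges {s(u, v)} := by
        intro x y hxy
        rw [SimpleGraph.deleteEdges_adj]
        refine ⟨hHK hxy, fun he => hn ?_⟩
        rw [Set.mem_singleton_iff] at he
        rw [← SimpleGraph.mem_edgeSet, ← he]
        exact hxy
      have h3 := ih _ (by omega) ((SimpleGraph.deleteEdges_le _).trans hK) h2 rfl
      have h4 := (dualClasses_deleteEdges A hK huv).1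
      omega

/-- An equivalence relation that holds between cyclic neighbours of a list holds throughout it. -/
theorem mem_getElem_next {α : Type*} [DecidableEq α] {l : List α} (hl : l.Nodup)
    {r : α → α → Prop} (hr : Equivalence r) (h : ∀ x (hx : x ∈ l), r x (l.next x hx))
    {x y : α} (hx : x ∈ l) (hy : y ∈ l) : r x y := by
  have h0 : ∀ i (hi : i < l.length), r (l[0]'(by omega)) l[i] := by
    intro i
    induction i with
    | zero => intro hi; exact hr.refl _
    | succ i ih =>
      intro hi
      have h1 := h l[i] (List.getElem_mem _)
      rw [List.next_getElem _ hl] at h1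
      simp only [Nat.mod_eq_of_lt hi] at h1
      exact hr.trans (ih (by omega)) h1
  obtain ⟨i, hi, rfl⟩ := List.mem_iff_getElem.1 hx
  obtain ⟨j, hj, rfl⟩ := List.mem_iff_getElem.1 hy
  exact hr.trans (hr.symm (h0 i hi)) (h0 j hj)

/-- When all edges have been deleted, every component has at most one face. -/
theorem eqvGen_dualStep_bot (A : AdjacencyLists G) {d e : G.Dart}
    (h : G.Reachable d.fst e.fst) : Relation.EqvGen (dualStep A ⊥) d e := by
  have hs : ∀ d : G.Dart, Relation.EqvGen (dualStep A ⊥) d d.symm := fun d =>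
    .rel _ _ (.inr ⟨rfl, fun h => h⟩)
  have hstar : ∀ d e : G.Dart, d.fst = e.fst → Relation.EqvGen (dualStep A ⊥) d e := by
    intro d e hde
    obtain ⟨⟨v, x⟩, hd⟩ := d
    obtain ⟨⟨v', y⟩, he⟩ := e
    simp only at hde
    subst hde
    let r : Fin n → Fin n → Prop := fun x y => (G.Adj v x ↔ G.Adj v y) ∧
      ∀ (hx : G.Adj v x) (hy : G.Adj v y),
      Relation.EqvGen (dualStep A ⊥) ⟨(v, x), hx⟩ ⟨(v, y), hy⟩
    have hr : Equivalence r := by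
      refine ⟨fun x => ⟨Iff.rfl, fun _ _ => .refl _⟩, fun h => ⟨h.1.symm, fun hx hy =>
        (h.2 hy hx).symm _ _⟩, fun h h' => ⟨h.1.trans h'.1, fun hx hy =>
        (h.2 hx (h.1.1 hx)).trans _ _ _ (h'.2 (h.1.1 hx) hy)⟩⟩
    refine (mem_getElem_next (A.nodup v) hr (fun x hx => ?_) ((A.mem_nbrs _ _).2 hd)
      ((A.mem_nbrs _ _).2 he)).2 hd he
    have h1 := (A.mem_nbrs _ _).1 hx
    have h2 := (A.mem_nbrs _ _).1 (List.next_mem _ _ hx)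
    refine ⟨iff_of_true h1 h2, fun _ _ => ?_⟩
    exact (hs ⟨(v, x), h1⟩).trans _ _ _ (.rel _ _ (.inl rfl))
  obtain ⟨⟨v, x⟩, hd⟩ := d
  obtain ⟨⟨w, y⟩, he⟩ := e
  simp only at h
  rw [SimpleGraph.reachable_iff_reflTransGen] at h
  induction h generalizing y with
  | refl => exact hstar _ _ rfl
  | @tail b c _ hbc ih =>
    exact (ih c hbc).trans _ _ _ ((hs _).trans _ _ _ (hstar _ _ rfl))

/-- When every edge is deleted, all darts of a component lie in one dual class, so the dual classes
and the isolated vertices inject into the components. This is the upper end of the count. -/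
theorem dualClasses_bot_le (A : AdjacencyLists G) :
    dualClasses A ⊥ + Nat.card {v : Fin n // ∀ u, ¬ G.Adj v u} ≤
      Nat.card G.ConnectedComponent := by
  rw [dualClasses, ← Nat.card_sum]
  refine Nat.card_le_card_of_injective (fun q => match q with
    | .inl q => G.connectedComponentMk q.out.fst
    | .inr v => G.connectedComponentMk v.1) ?_
  have hiso : ∀ v : {v : Fin n // ∀ u, ¬ G.Adj v u}, ∀ x, G.Reachable v.1 x → x = v.1 := by
    intro v x h
    rw [SimpleGraph.reachable_iff_reflTransGen] at h
    rcases Relation.ReflTransGen.cases_head h with h1 | ⟨c, h1, -⟩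
    · exact h1.symm
    · exact absurd h1 (v.2 c)
  rintro (p | v) (q | w) h
  · simp only [SimpleGraph.ConnectedComponent.eq] at h
    rw [← Quot.out_eq p, ← Quot.out_eq q, quot_mk_eq_iff.2 (eqvGen_dualStep_bot A h)]
  · simp only [SimpleGraph.ConnectedComponent.eq] at h
    exact absurd p.out.adj (hiso w _ h.symm ▸ w.2 _)
  · simp only [SimpleGraph.ConnectedComponent.eq] at h
    exact absurd q.out.adj (hiso v _ h ▸ v.2 _)
  · simp only [SimpleGraph.ConnectedComponent.eq] at h
    rw [Sum.inr.injEq]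
    exact Subtype.ext (hiso w _ h.symm)

theorem numFaces_eq (A : AdjacencyLists G) :
    A.numFaces = dualClasses A G + Nat.card {v : Fin n // ∀ u, ¬ G.Adj v u} := by
  have : (fun d e : G.Dart => A.faceNext d = e) = dualStep A G := by
    funext d e
    simp [dualStep, d.adj]
  rw [AdjacencyLists.numFaces, this, dualClasses]

/-- In a planar embedding, an edge of the current graph is a bridge if and only if the faces on its
two sides have already been merged. -/
theorem AdjacencyLists.IsPlanarEmbedding.not_reachable_iff {A : AdjacencyLists G}
    (hA : A.IsPlanarEmbedding) {H : SimpleGraph (Fin n)} (hH : H ≤ G) {u v : Fin n}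
    (huv : H.Adj u v) : ¬ (H.deleteEdges {s(u, v)}).Reachable u v ↔
      Relation.EqvGen (dualStep A H) ⟨(u, v), hH huv⟩ ⟨(v, u), (hH huv).symm⟩ := by
  refine ⟨eqvGen_dualStep_of_bridge A hH huv, fun hrel hr => ?_⟩
  have h1 := dualClasses_mono A le_rfl hH
  have h2 := (dualClasses_deleteEdges A hH huv).2 hr hrel
  have h3 := dualClasses_mono A ((SimpleGraph.deleteEdges_le {s(u, v)}).trans hH) bot_le
  have h4 := dualClasses_bot_le A
  have h5 := ncard_edgeSet_deleteEdges huv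
  have h6 : Nat.card (⊥ : SimpleGraph (Fin n)).ConnectedComponent = n := by
    rw [Nat.card_congr (β := Fin n), Nat.card_fin]
    refine (Equiv.ofBijective (SimpleGraph.connectedComponentMk ⊥) ⟨fun x y h => ?_,
      Quot.mk_surjective⟩).symm
    simpa using h
  have h7 : (⊥ : SimpleGraph (Fin n)).edgeSet.ncard = 0 := by simp
  rw [AdjacencyLists.IsPlanarEmbedding, numFaces_eq] at hA
  omega

/-! ### The number of edges -/

/-- A cyclic list in which some element is its own successor has only one element. -/
theorem eq_of_next_eq_self {α : Type*} [DecidableEq α] {l : List α} (hl : l.Nodup) {x : α}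
    (hx : x ∈ l) (h : l.next x hx = x) {y : α} (hy : y ∈ l) : y = x := by
  obtain ⟨i, hi, rfl⟩ := List.mem_iff_getElem.1 hx
  obtain ⟨j, hj, rfl⟩ := List.mem_iff_getElem.1 hy
  rw [List.next_getElem _ hl, hl.getElem_inj_iff] at h
  congr 1
  rcases Nat.lt_or_ge (i + 1) l.length with h1 | h1
  · rw [Nat.mod_eq_of_lt h1] at h; omega
  · obtain h2 : i + 1 = l.length := by omega
    rw [h2, Nat.mod_self] at h; omega

/-- A face of length two is the face of a component with a single edge. -/
theorem component_of_faceNext_faceNext (A : AdjacencyLists G) {d : G.Dart}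
    (h : A.faceNext (A.faceNext d) = d) {x : Fin n} (hx : G.Reachable d.fst x) :
    x = d.fst ∨ x = d.snd := by
  obtain ⟨⟨u, v⟩, hd⟩ := d
  have h1 := congrArg (fun x : G.Dart => x.fst) h
  have h2 := congrArg (fun x : G.Dart => x.snd) h
  simp only [AdjacencyLists.faceNext] at h1
  have hv : ∀ y, G.Adj v y → y = u := fun y hy =>
    eq_of_next_eq_self (A.nodup v) ((A.mem_nbrs _ _).2 hd.symm) h1 ((A.mem_nbrs _ _).2 hy)
  have hu : ∀ y, G.Adj u y → y = v := by
    intro y hy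
    refine eq_of_next_eq_self (A.nodup u) ((A.mem_nbrs _ _).2 hd) ?_ ((A.mem_nbrs _ _).2 hy)
    simp only [AdjacencyLists.faceNext] at h2
    simpa only [h1] using h2
  rw [SimpleGraph.reachable_iff_reflTransGen] at hx
  induction hx with
  | refl => exact .inl rfl
  | tail _ hbc ih =>
    rcases ih with rfl | rfl
    · exact .inr (hu _ hbc)
    · exact .inl (hv _ hbc)

theorem faceNext_ne (A : AdjacencyLists G) (d : G.Dart) : A.faceNext d ≠ d := fun h =>
  d.adj.ne (congrArg (fun x : G.Dart => x.fst) h).symm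

/-- A simple planar graph has at most three times as many edges as vertices: all faces have at
least three darts, except those of the components that are isolated vertices or edges. -/
theorem AdjacencyLists.IsPlanarEmbedding.ncard_edgeSet_le {A : AdjacencyLists G}
    (hA : A.IsPlanarEmbedding) : G.edgeSet.ncard ≤ 3 * n := by
  classical
  let Q := Quot fun d e : G.Dart => A.faceNext d = e
  let S := {q : Q // A.faceNext (A.faceNext q.out) = q.out}
  have hmk : ∀ d : G.Dart, Quot.mk (fun d e : G.Dart => A.faceNext d = e) (A.faceNext d) =
      Quot.mk _ d := fun d => (Quot.sound (r := fun d e : G.Dart => A.faceNext d = e) rfl).symm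
  have h1 : 3 * Nat.card Q ≤ Nat.card G.Dart + Nat.card S := by
    have : Nat.card (Q × Fin 3) ≤ Nat.card (G.Dart ⊕ S) := by
      let F : Q × Fin 3 → G.Dart ⊕ S := fun x =>
        if x.2 = 0 then .inl x.1.out else if x.2 = 1 then .inl (A.faceNext x.1.out) else
          if h : A.faceNext (A.faceNext x.1.out) = x.1.out then .inr ⟨x.1, h⟩
          else .inl (A.faceNext (A.faceNext x.1.out))
      -- the class of a dart in the image is determined, and then its position is
      let c : G.Dart ⊕ S → Q := Sum.elim (Quot.mk _) (fun s => s.1)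
      have hc : ∀ x, c (F x) = x.1 := by
        rintro ⟨q, i⟩
        simp only [F, c]
        split_ifs <;> simp [hmk, Quot.out_eq]
      refine Nat.card_le_card_of_injective F fun x y hxy => ?_
      have hq : x.1 = y.1 := by rw [← hc x, ← hc y, hxy]
      obtain ⟨q, i⟩ := x
      obtain ⟨q', j⟩ := y
      simp only at hq
      subst hq
      congr 1
      have n1 := faceNext_ne A q.out
      have n2 := faceNext_ne A (A.faceNext q.out)
      simp only [F] at hxy
      fin_cases i <;> fin_cases j <;> simp at hxy ⊢ <;>
        first
          | exact n1 hxy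
          | exact n1 hxy.symm
          | (split_ifs at hxy with h; simp at hxy; first
            | exact h hxy
            | exact h hxy.symm
            | exact n2 hxy
            | exact n2 hxy.symm)
    rwa [Nat.card_prod, Nat.card_sum, Nat.card_fin, Nat.mul_comm] at this
  have h2 : Nat.card S + Nat.card {v : Fin n // ∀ u, ¬ G.Adj v u} ≤
      Nat.card G.ConnectedComponent := by
    rw [← Nat.card_sum]
    refine Nat.card_le_card_of_injective (fun q => match q with
      | .inl q => G.connectedComponentMk q.1.out.fst
      | .inr v => G.connectedComponentMk v.1) ?_
    have hiso : ∀ v : {v : Fin n // ∀ u, ¬ G.Adj v u}, ∀ x, G.Reachable v.1 x → x = v.1 := by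
      intro v x h
      rw [SimpleGraph.reachable_iff_reflTransGen] at h
      rcases Relation.ReflTransGen.cases_head h with h1 | ⟨c, h1, -⟩
      · exact h1.symm
      · exact absurd h1 (v.2 c)
    rintro (p | v) (q | w) h
    · simp only [SimpleGraph.ConnectedComponent.eq] at h
      have hp := fun x => component_of_faceNext_faceNext A p.2 (x := x)
      have h3 := hp _ h
      have h4 := hp _ (h.trans q.1.out.adj.reachable)
      have h5 := q.1.out.adj.ne
      rw [Sum.inl.injEq]
      refine Subtype.ext ?_
      have h6 : (A.faceNext p.1.out).fst = p.1.out.snd := rfl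
      have h7 : (A.faceNext p.1.out).snd = p.1.out.fst :=
        congrArg (fun x : G.Dart => x.fst) p.2
      rw [← Quot.out_eq q.1]
      rcases h3 with h3 | h3
      · have h4 : q.1.out.snd = p.1.out.snd := h4.resolve_left (h3 ▸ h5.symm)
        rw [← Quot.out_eq p.1]
        congr 1
        exact SimpleGraph.Dart.ext _ _ (Prod.ext h3.symm h4.symm)
      · have h4 : q.1.out.snd = p.1.out.fst := h4.resolve_right (h3 ▸ h5.symm)
        rw [← Quot.out_eq p.1, ← hmk]
        congr 1
        exact SimpleGraph.Dart.ext _ _ (Prod.ext (h6.trans h3.symm) (h7.trans h4.symm))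
    · simp only [SimpleGraph.ConnectedComponent.eq] at h
      exact absurd p.1.out.adj (hiso w _ h.symm ▸ w.2 _)
    · simp only [SimpleGraph.ConnectedComponent.eq] at h
      exact absurd q.1.out.adj (hiso v _ h ▸ v.2 _)
    · simp only [SimpleGraph.ConnectedComponent.eq] at h
      rw [Sum.inr.injEq]
      exact Subtype.ext (hiso w _ h.symm)
  have h3 : Nat.card G.Dart = 2 * G.edgeSet.ncard := by
    rw [Nat.card_eq_fintype_card, SimpleGraph.dart_card_eq_twice_card_edges,
      ← SimpleGraph.coe_edgeFinset, Set.ncard_coe_finset]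
  rw [AdjacencyLists.IsPlanarEmbedding, AdjacencyLists.numFaces] at hA
  change _ + (Nat.card Q + _) = _ at hA
  omega

end Duality

/-! ### Union-find -/

/-- From `s` to `s'`, only the registers in `R` and the arrays in `K` have changed. -/
structure Fr (R K : List ℕ) (s s' : St) : Prop where
  reg : ∀ r, r ∉ R → s'.reg r = s.reg r
  arr : ∀ k, k ∉ K → s'.arr k = s.arr k
  out : s'.out = s.out

theorem Fr.refl (R K : List ℕ) (s : St) : Fr R K s s := ⟨fun _ _ => rfl, fun _ _ => rfl, rfl⟩

theorem Fr.trans {R K : List ℕ} {s s' s'' : St} (h : Fr R K s s') (h' : Fr R K s' s'') :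
    Fr R K s s'' :=
  ⟨fun r hr => (h'.reg r hr).trans (h.reg r hr), fun k hk => (h'.arr k hk).trans (h.arr k hk),
    h'.out.trans h.out⟩

theorem Fr.mono {R K R' K' : List ℕ} {s s' : St} (h : Fr R K s s') (hR : R ⊆ R') (hK : K ⊆ K') :
    Fr R' K' s s' :=
  ⟨fun r hr => h.reg r fun h => hr (hR h), fun k hk => h.arr k fun h => hk (hK h), h.out⟩

/-- The arrays `par` and `sz` represent a union-find forest on `{0, …, N - 1}` with union by size,
in which `rep x` is the root of `x`. -/
structure UFInv (N : ℕ) (par sz rep : ℕ → ℕ) : Prop where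
  par_lt : ∀ x < N, par x < N
  rep_lt : ∀ x < N, rep x < N
  rep_par : ∀ x < N, rep (par x) = rep x
  rep_root : ∀ x < N, par x = x → rep x = x
  root_rep : ∀ x < N, par (rep x) = rep x
  sz_pos : ∀ x < N, 0 < sz x
  sz_le : ∀ x < N, sz x ≤ N
  sz_par : ∀ x < N, par x ≠ x → 2 * sz x ≤ sz (par x)
  sz_root : ∀ x < N, par x = x → sz x = ((Finset.range N).filter fun y => rep y = x).card

theorem UFInv.rep_rep {N : ℕ} {par sz rep : ℕ → ℕ} (h : UFInv N par sz rep) {x : ℕ} (hx : x < N) :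
    rep (rep x) = rep x :=
  h.rep_root _ (h.rep_lt x hx) (h.root_rep x hx)

/-- The number of classes. -/
def numRoots (N : ℕ) (rep : ℕ → ℕ) : ℕ := ((Finset.range N).filter fun x => rep x = x).card

/-- Register `20` becomes the root of its old value. -/
def findCmd (kp : ℕ) : Cmd :=
  .blk [.const 24 1] ;;
  .loop 4 24 (.blk [.rd 21 kp 20, .sub 22 20 21, .sub 23 21 20, .add 24 22 23, .add 20 21 4])

/-- The length of a path to the root is logarithmic, as sizes double along it. -/
theorem wp_find {B U N kp ks : ℕ} {rep : ℕ → ℕ} (hU : 16 * B ≤ U) (hN : N ≤ B) (hkp : kp < 16)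
    {s : St} (h : UFInv N (s.arr kp) (s.arr ks) rep) (hx : s.reg 20 < N) (h4 : s.reg 4 = 0) :
    WP B U (findCmd kp) s fun t s' => t ≤ 10 * (Nat.log 2 N + 1) + 3 ∧
      s'.reg 20 = rep (s.reg 20) ∧ Fr [20, 21, 22, 23, 24] [] s s' := by
  refine WP.seq (WP.blk (by simp [okOps, Op.ok]) ?_)
  refine (WP.loop (fun m s' => s'.reg 20 < N ∧ rep (s'.reg 20) = rep (s.reg 20) ∧
    Fr [20, 21, 22, 23, 24] [] s s' ∧
    (s'.reg 24 = 0 ∧ s.arr kp (s'.reg 20) = s'.reg 20 ∨ s'.reg 24 ≠ 0 ∧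
      m = 10 * (Nat.log 2 N - Nat.log 2 (s.arr ks (s'.reg 20)) + 1)))
    ?_ (m := 10 * (Nat.log 2 N - Nat.log 2 (s.arr ks (s.reg 20)) + 1))
    ⟨?_, ?_, ⟨?_, ?_, ?_⟩, .inr ⟨?_, ?_⟩⟩).mono ?_
  · rintro m s' ⟨h1, h2, h3, h5⟩ h6
    have e4 : s'.reg 4 = 0 := by rw [h3.reg 4 (by decide), h4]
    have ea : s'.arr kp = s.arr kp := h3.arr kp (by simp)
    rcases h5 with ⟨h5, -⟩ | ⟨-, rfl⟩
    · omega
    have hp := h.par_lt _ h1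
    refine WP.blk ?_ ?_
    · simp only [okOps, Op.ok, Op.run, Function.update_apply, ea]
      simp
      omega
    · simp only [costOps, Op.cost, runOps, Op.run, Function.update_apply, ea]
      simp
      simp only [e4, Nat.add_zero]
      by_cases hroot : s.arr kp (s'.reg 20) = s'.reg 20
      · refine ⟨0, by omega, hp, ?_, ⟨fun r hr => ?_, fun k _ => ?_, ?_⟩, ?_⟩
        · rw [hroot, h2]
        · simp at hr
          simp [hr, h3.reg r (by simp [hr])]
        · exact h3.arr k (by simp)
        · exact h3.out
        · left; rw [hroot]; simp [hroot]
      · have h7 := h.sz_par _ h1 hroot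
        have h8 : Nat.log 2 (s.arr ks (s'.reg 20)) + 1 ≤
            Nat.log 2 (s.arr ks (s.arr kp (s'.reg 20))) := by
          rw [← Nat.log_mul_base (by norm_num) (h.sz_pos _ h1).ne']
          exact Nat.log_mono_right (by omega)
        have h9 : Nat.log 2 (s.arr ks (s.arr kp (s'.reg 20))) ≤ Nat.log 2 N :=
          Nat.log_mono_right (h.sz_le _ hp)
        refine ⟨_, ?_, hp, ?_, ⟨fun r hr => ?_, fun k _ => ?_, ?_⟩, .inr ⟨?_, rfl⟩⟩
        · omega
        · rw [h.rep_par _ h1, h2]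
        · simp at hr
          simp [hr, h3.reg r (by simp [hr])]
        · exact h3.arr k (by simp)
        · exact h3.out
        · omega
  · simpa [runOps, Op.run] using hx
  · simp [runOps, Op.run]
  · intro r hr
    simp at hr
    simp [runOps, Op.run, hr]
  · intro _ _; rfl
  · rfl
  · simp [runOps, Op.run]
  · simp [runOps, Op.run]
  · rintro t s' ⟨h1, ⟨m, -, h2, h3, h5, h6⟩, h7⟩
    have e4 : s'.reg 4 = 0 := by rw [h5.reg 4 (by decide), h4]
    simp only [costOps, Op.cost]
    refine ⟨by omega, ?_, h5⟩
    rcases h6 with ⟨-, h6⟩ | ⟨h6, -⟩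
    · rw [← h3, h.rep_root _ h2 h6]
    · omega

/-- Hanging the root `a` below the root `b`. -/
theorem UFInv.link {N : ℕ} {par sz rep : ℕ → ℕ} (h : UFInv N par sz rep) {a b : ℕ} (ha : a < N)
    (hb : b < N) (hpa : par a = a) (hpb : par b = b) (hab : a ≠ b) (hsz : sz a ≤ sz b) :
    UFInv N (Function.update par a b) (Function.update sz b (sz a + sz b))
        (fun x => if rep x = a then b else rep x) ∧
      numRoots N (fun x => if rep x = a then b else rep x) + 1 = numRoots N rep := by
  have hra := h.rep_root a ha hpa
  have hrb := h.rep_root b hb hpb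
  have hcard : sz a + sz b =
      ((Finset.range N).filter fun y => (if rep y = a then b else rep y) = b).card := by
    rw [h.sz_root a ha hpa, h.sz_root b hb hpb, ← Finset.card_union_of_disjoint]
    · congr 1
      ext y
      simp only [Finset.mem_union, Finset.mem_filter]
      split_ifs with h1 <;> simp [h1, hab]
    · rw [Finset.disjoint_filter]
      intro x _ h1 h2
      exact hab (h1.symm.trans h2)
  refine ⟨⟨?_, ?_, ?_, ?_, ?_, ?_, ?_, ?_, ?_⟩, ?_⟩
  · intro x hx
    rw [Function.update_apply]
    split_ifs
    exacts [hb, h.par_lt x hx]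
  · intro x hx
    split_ifs
    exacts [hb, h.rep_lt x hx]
  · intro x hx
    rw [Function.update_apply]
    split_ifs with h1 <;> simp_all [h.rep_par x hx]
  · intro x hx
    rw [Function.update_apply]
    split_ifs with h1 h2 h2
    · intro h3; exact h3
    · intro h3; exact absurd (h1.symm.trans h3.symm) hab
    · intro h3; rw [← h2, h.rep_root x hx h3] at h1; exact absurd rfl h1
    · exact h.rep_root x hx
  · intro x hx
    rw [Function.update_apply]
    split_ifs with h1 h2
    · exact absurd h2.symm hab
    · exact hpb
    · exact h.root_rep x hx
  · intro x hx
    rw [Function.update_apply]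
    have := h.sz_pos x hx
    have := h.sz_pos b hb
    split_ifs <;> omega
  · intro x hx
    rw [Function.update_apply]
    split_ifs
    · rw [hcard]
      exact (Finset.card_filter_le _ _).trans_eq (Finset.card_range N)
    · exact h.sz_le x hx
  · intro x hx
    rw [Function.update_apply]
    split_ifs with h1
    · subst h1
      intro _
      rw [Function.update_of_ne hab, Function.update_self]
      omega
    · intro h2
      have h3 := h.sz_par x hx h2
      have h4 : x ≠ b := fun h => h2 (h ▸ hpb)
      rw [Function.update_of_ne h4, Function.update_apply]
      split_ifs with h5
      · rw [h5] at h3; omega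
      · exact h3
  · intro x hx
    rw [Function.update_apply]
    split_ifs with h1
    · intro h2; exact absurd (h1.symm.trans h2.symm) hab
    · intro h2
      rw [Function.update_apply]
      split_ifs with h3
      · subst h3; exact hcard
      · rw [h.sz_root x hx h2]
        congr 1
        ext y
        simp only [Finset.mem_filter]
        split_ifs with h4
        · simp only [h4]
          exact and_congr_right fun _ => ⟨fun h5 => absurd h5.symm h1, fun h5 => absurd h5.symm h3⟩
        · rfl
  · rw [numRoots, numRoots, ← Finset.card_erase_add_one
      (show a ∈ (Finset.range N).filter fun x => rep x = x by simp [ha, hra])]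
    congr 2
    ext y
    simp only [Finset.mem_filter, Finset.mem_erase, Finset.mem_range]
    split_ifs with h1
    · constructor
      · rintro ⟨h2, rfl⟩; exact absurd (hrb.symm.trans h1) hab.symm
      · rintro ⟨h2, h3, h4⟩; exact absurd (h4.symm.trans h1) h2
    · constructor
      · rintro ⟨h2, h3⟩; exact ⟨fun h4 => h1 (h3.trans h4), h2, h3⟩
      · rintro ⟨-, h⟩; exact h

/-- The classes of the elements in registers `20` and `25` are united. Register `29` tells whether
they were different. -/
def unionCmd (kp ks : ℕ) : Cmd :=
  findCmd kp ;;
  .blk [.add 26 20 4, .add 20 25 4] ;;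
  findCmd kp ;;
  .blk [.sub 22 20 26, .sub 23 26 20, .add 24 22 23, .const 29 0] ;;
  .ite 4 24
    (.blk [.rd 27 ks 26, .rd 28 ks 20, .const 29 1, .add 22 27 28] ;;
      .ite 27 28 (.blk [.wr kp 26 20, .wr ks 20 22]) (.blk [.wr kp 20 26, .wr ks 26 22]))
    (.blk [])

/-- The classes of `rep'` are those of `rep`, except that the classes of `x` and `y` are united. -/
def Merged (N : ℕ) (rep rep' : ℕ → ℕ) (x y : ℕ) : Prop :=
  ∀ a < N, ∀ b < N, rep' a = rep' b ↔
    rep a = rep b ∨ (rep a = rep x ∧ rep b = rep y) ∨ (rep a = rep y ∧ rep b = rep x)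

/-- Besides uniting the two classes, the command records in register `29` whether they were distinct;
the callers use this to keep count of the classes. -/
theorem wp_union {B U N kp ks : ℕ} {rep : ℕ → ℕ} (hU : 16 * B ≤ U) (hN : N ≤ B) (hkp : kp < 16)
    (hks : ks < 16) (hne : kp ≠ ks)
    {s : St} (h : UFInv N (s.arr kp) (s.arr ks) rep) (hx : s.reg 20 < N) (hy : s.reg 25 < N)
    (h4 : s.reg 4 = 0) :
    WP B U (unionCmd kp ks) s fun t s' => t ≤ 60 * (Nat.log 2 N + 1) ∧
      (∃ rep', UFInv N (s'.arr kp) (s'.arr ks) rep' ∧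
        Merged N rep rep' (s.reg 20) (s.reg 25) ∧
        numRoots N rep' + s'.reg 29 = numRoots N rep) ∧
      s'.reg 29 = (if rep (s.reg 20) = rep (s.reg 25) then 0 else 1) ∧
      Fr [20, 21, 22, 23, 24, 26, 27, 28, 29] [kp, ks] s s' := by
  refine WP.seq ((wp_find hU hN hkp h hx h4).mono ?_)
  rintro t₁ s₁ ⟨ht₁, hr₁, hf₁⟩
  have e4 : s₁.reg 4 = 0 := by rw [hf₁.reg 4 (by decide), h4]
  have e25 : s₁.reg 25 = s.reg 25 := hf₁.reg 25 (by decide)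
  have ea : ∀ k, s₁.arr k = s.arr k := fun k => hf₁.arr k (by simp)
  have hxr := h.rep_lt _ hx
  have hyr := h.rep_lt _ hy
  refine WP.seq (WP.blk ?_ ?_)
  · simp [okOps, Op.ok, Op.run, e4, e25, hr₁]
    omega
  generalize hs₂ : runOps _ s₁ = s₂
  simp only [runOps, Op.run, Function.update_apply] at hs₂
  have g20 : s₂.reg 20 = s.reg 25 := by subst hs₂; simp [e4, e25]
  have g26 : s₂.reg 26 = rep (s.reg 20) := by subst hs₂; simp [e4, hr₁]
  have hf₂ : Fr [20, 21, 22, 23, 24, 26] [] s s₂ := by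
    subst hs₂
    refine ⟨fun r hr => ?_, fun k _ => ea k, hf₁.out⟩
    simp only [List.mem_cons, List.not_mem_nil, not_or] at hr
    simp [hr, hf₁.reg r (by simp [hr])]
  have ga : ∀ k, s₂.arr k = s.arr k := fun k => hf₂.arr k (by simp)
  refine WP.seq ((wp_find (ks := ks) hU hN hkp (s := s₂) (by rwa [ga, ga]) (by rwa [g20])
    (by rw [hf₂.reg 4 (by decide), h4])).mono ?_)
  rintro t₃ s₃ ⟨ht₃, hr₃, hf₃⟩
  have hf₃' := hf₂.trans (hf₃.mono (R' := [20, 21, 22, 23, 24, 26]) (by decide) (by decide))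
  rw [g20] at hr₃
  have k26 : s₃.reg 26 = rep (s.reg 20) := by rw [hf₃.reg 26 (by decide), g26]
  have k4 : s₃.reg 4 = 0 := by rw [hf₃'.reg 4 (by decide), h4]
  have ka : ∀ k, s₃.arr k = s.arr k := fun k => hf₃'.arr k (by simp)
  refine WP.seq (WP.blk ?_ ?_)
  · simp [okOps, Op.ok, Op.run, k26, hr₃]
    omega
  generalize hs₄ : runOps _ s₃ = s₄
  simp only [runOps, Op.run, Function.update_apply] at hs₄
  have j20 : s₄.reg 20 = rep (s.reg 25) := by subst hs₄; simp [hr₃]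
  have j26 : s₄.reg 26 = rep (s.reg 20) := by subst hs₄; simp [k26]
  have j29 : s₄.reg 29 = 0 := by subst hs₄; simp
  have j24 : s₄.reg 24 = (rep (s.reg 25) - rep (s.reg 20)) + (rep (s.reg 20) - rep (s.reg 25)) := by
    subst hs₄; simp [k26, hr₃]
  have j4 : s₄.reg 4 = 0 := by subst hs₄; simp [k4]
  have hf₄ : Fr [20, 21, 22, 23, 24, 26, 27, 28, 29] [kp, ks] s s₄ := by
    subst hs₄
    refine ⟨fun r hr => ?_, fun k _ => ka k, hf₃'.out⟩
    simp only [List.mem_cons, List.not_mem_nil, not_or] at hr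
    simp [hr, hf₃'.reg r (by simp [hr])]
  have ja : ∀ k, s₄.arr k = s.arr k := fun k => by subst hs₄; exact ka k
  clear hs₄
  have hpx := h.root_rep _ hx
  have hpy := h.root_rep _ hy
  refine WP.ite (fun hlt => ?_) (fun hlt => ?_)
  · have hne' : rep (s.reg 20) ≠ rep (s.reg 25) := by
      intro h5; rw [j4, j24, h5] at hlt; simp at hlt
    have hszx := h.sz_le _ hxr
    have hszy := h.sz_le _ hyr
    refine WP.seq (WP.blk ?_ (WP.ite (fun hlt' => WP.blk ?_ ?_) (fun hlt' => WP.blk ?_ ?_)))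
    · simp [okOps, Op.ok, Op.run, j26, j20, ja]
      omega
    · simp [okOps, Op.ok, Op.run, runOps, j26, j20, ja]
      omega
    · simp only [runOps, Op.run, Function.update_apply, costOps, Op.cost] at hlt' ⊢
      simp [j26, j20, ja] at hlt'
      obtain ⟨h6, h7⟩ := h.link hxr hyr hpx hpy hne' (by omega)
      refine ⟨by omega, ⟨fun x => if rep x = rep (s.reg 20) then rep (s.reg 25) else rep x, ?_, ?_, ?_⟩,
        ?_, ?_⟩
      rotate_left
      · intro a ha b hb
        dsimp only
        split_ifs with h8 h9 h9
        · simp [h8, h9]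
        · simp [h8, hne', eq_comm]
          tauto
        · simp [h9, hne']
          tauto
        · simp [h8, h9]
      · simpa using h7
      · simp [hne']
      · refine ⟨fun r hr => ?_, fun k hk => ?_, hf₄.out⟩
        · have := hf₄.reg r hr
          simp only [List.mem_cons, List.not_mem_nil, not_or] at hr
          simp [hr, this]
        · simp only [List.mem_cons, List.not_mem_nil, not_or] at hk
          simp [hk, ja]
      · simpa [Function.update_apply, hne, hne.symm, j20, j26, ja] using h6
    · simp [okOps, Op.ok, Op.run, runOps, j26, j20, ja]
      omega
    · simp only [runOps, Op.run, Function.update_apply, costOps, Op.cost] at hlt' ⊢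
      simp [j26, j20, ja] at hlt'
      obtain ⟨h6, h7⟩ := h.link hyr hxr hpy hpx hne'.symm (by omega)
      refine ⟨by omega, ⟨fun x => if rep x = rep (s.reg 25) then rep (s.reg 20) else rep x, ?_, ?_, ?_⟩,
        ?_, ?_⟩
      rotate_left
      · intro a ha b hb
        dsimp only
        split_ifs with h8 h9 h9
        · simp [h8, h9]
        · simp [h8, hne'.symm, eq_comm]
          tauto
        · simp [h9, hne'.symm]
          tauto
        · simp [h8, h9]
      · simpa using h7
      · simp [hne']
      · refine ⟨fun r hr => ?_, fun k hk => ?_, hf₄.out⟩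
        · have := hf₄.reg r hr
          simp only [List.mem_cons, List.not_mem_nil, not_or] at hr
          simp [hr, this]
        · simp only [List.mem_cons, List.not_mem_nil, not_or] at hk
          simp [hk, ja]
      · simpa [Function.update_apply, hne, hne.symm, j20, j26, ja, Nat.add_comm] using h6
  · have heq : rep (s.reg 20) = rep (s.reg 25) := by
      rw [j4, j24] at hlt; omega
    refine WP.blk trivial ⟨?_, ⟨rep, ?_, ?_, ?_⟩, ?_, hf₄⟩
    · simp only [costOps, Op.cost]; omega
    · simpa only [runOps, ja] using h
    · intro a _ b _
      simp only [heq]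
      constructor
      · exact .inl
      · rintro (h5 | ⟨h5, h6⟩ | ⟨h5, h6⟩)
        exacts [h5, h5.trans h6.symm, h5.trans h6.symm]
    · simp only [runOps, j29, Nat.add_zero]
    · simp only [runOps, j29, heq, if_true]

/-- Singletons are a union-find forest. -/
theorem UFInv.init {N : ℕ} {par sz : ℕ → ℕ} (hp : ∀ x < N, par x = x) (hs : ∀ x < N, sz x = 1) :
    UFInv N par sz id := by
  refine ⟨fun x hx => by rwa [hp x hx], fun x hx => hx, fun x hx => hp x hx, fun x hx _ => rfl,
    fun x hx => hp x hx, fun x hx => by rw [hs x hx]; norm_num, fun x hx => by rw [hs x hx]; omega,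
    fun x hx h => absurd (hp x hx) h, fun x hx _ => ?_⟩
  rw [hs x hx, eq_comm, Finset.card_eq_one]
  exact ⟨x, by ext y; simp only [id, Finset.mem_filter, Finset.mem_range, Finset.mem_singleton]; grind⟩

/-! ### Positions in the input -/

section Layout

variable {n : ℕ} {G : SimpleGraph (Fin n)}

/-- The degree of the vertex `v`, as a function on natural numbers. -/
def dg (A : AdjacencyLists G) (v : ℕ) : ℕ := if h : v < n then (A.nbrs ⟨v, h⟩).length else 0

theorem dg_val (A : AdjacencyLists G) (v : Fin n) : dg A v = (A.nbrs v).length := by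
  simp [dg]

theorem length_nbrs_eq (A A' : AdjacencyLists G) (v : Fin n) :
    (A'.nbrs v).length = (A.nbrs v).length := by
  refine List.Perm.length_eq ((List.perm_ext_iff_of_nodup (A'.nodup v) (A.nodup v)).2 fun u => ?_)
  rw [A.mem_nbrs, A'.mem_nbrs]

theorem dg_eq (A A' : AdjacencyLists G) : dg A' = dg A := by
  funext v
  unfold dg
  split_ifs
  exacts [length_nbrs_eq A A' _, rfl]

/-- The position in the input at which the entry of vertex `v` starts, for given degrees `f`. -/
def st (f : ℕ → ℕ) (v : ℕ) : ℕ := 1 + ∑ u ∈ Finset.range v, (f u + 1)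

theorem st_zero (f : ℕ → ℕ) : st f 0 = 1 := rfl

theorem st_succ (f : ℕ → ℕ) (v : ℕ) : st f (v + 1) = st f v + f v + 1 := by
  simp only [st, Finset.sum_range_succ]; ring

theorem st_mono (f : ℕ → ℕ) : Monotone (st f) :=
  monotone_nat_of_le_succ fun v => by rw [st_succ]; omega

theorem st_lt (f : ℕ → ℕ) {v w j : ℕ} (hv : v < w) (hj : j ≤ f v) : st f v + j < st f w := by
  have := st_mono f (show v + 1 ≤ w from hv)
  rw [st_succ] at this
  omega

theorem le_st (f : ℕ → ℕ) (v : ℕ) : v + 1 ≤ st f v := by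
  induction v with
  | zero => rfl
  | succ v ih => rw [st_succ]; omega

theorem st_add_inj (f : ℕ → ℕ) {v w j k : ℕ} (hj : j ≤ f v) (hk : k ≤ f w)
    (h : st f v + j = st f w + k) : v = w ∧ j = k := by
  rcases lt_trichotomy v w with h1 | rfl | h1
  · have := st_lt f h1 hj; omega
  · exact ⟨rfl, by omega⟩
  · have := st_lt f h1 hk; omega

/-- The owner of a position `p` in the input: `v + 1` if a neighbour of `v` is stored at `p`, and `0`
if no neighbour is stored there. -/
noncomputable def own (f : ℕ → ℕ) (p : ℕ) : ℕ :=
  open Classical in if h : ∃ v, ∃ j < f v, p = st f v + 1 + j then h.choose + 1 else 0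

theorem own_dart (f : ℕ → ℕ) {v j : ℕ} (hj : j < f v) : own f (st f v + 1 + j) = v + 1 := by
  have h : ∃ w, ∃ k < f w, st f v + 1 + j = st f w + 1 + k := ⟨v, j, hj, rfl⟩
  rw [own, dif_pos h]
  obtain ⟨k, hk, he⟩ := h.choose_spec
  have := (st_add_inj f (j := j + 1) (k := k + 1) hj hk (by omega)).1
  omega

theorem own_st (f : ℕ → ℕ) (v : ℕ) : own f (st f v) = 0 := by
  rw [own, dif_neg]
  rintro ⟨w, j, hj, he⟩
  have := (st_add_inj f (v := v) (w := w) (j := 0) (k := j + 1) (by omega) hj (by omega)).2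
  omega

theorem exists_of_own_ne_zero {f : ℕ → ℕ} {p : ℕ} (h : own f p ≠ 0) :
    ∃ v, own f p = v + 1 ∧ ∃ j < f v, p = st f v + 1 + j := by
  by_cases h' : ∃ v, ∃ j < f v, p = st f v + 1 + j
  · obtain ⟨v, j, hj, rfl⟩ := h'
    exact ⟨v, own_dart f hj, j, hj, rfl⟩
  · rw [own, dif_neg h'] at h
    exact absurd rfl h

theorem own_zero (f : ℕ → ℕ) : own f 0 = 0 := by
  by_contra h
  obtain ⟨v, -, j, -, h2⟩ := exists_of_own_ne_zero h
  omega

theorem lt_of_own {f : ℕ → ℕ} {p v m : ℕ} (h : own f p = v + 1) (hp : p < st f m) : v < m := by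
  obtain ⟨w, h1, j, hj, rfl⟩ := exists_of_own_ne_zero (f := f) (p := p) (by omega)
  obtain rfl : w = v := by omega
  by_contra hc
  have := st_mono f (show m ≤ w by omega)
  omega

/-- The input words, as a function. -/
def inp (A : AdjacencyLists G) (i : ℕ) : ℕ := A.encode.getD i 0

theorem inp_zero (A : AdjacencyLists G) : inp A 0 = n := rfl

theorem flatMap_take_length (A : AdjacencyLists G) {v : ℕ} (hv : v ≤ n) :
    1 + (((List.finRange n).take v).flatMap fun v =>
      (A.nbrs v).length :: (A.nbrs v).map Fin.val).length = st (dg A) v := by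
  induction v with
  | zero => simp [st_zero]
  | succ v ih =>
    rw [List.take_add_one, List.flatMap_append, List.length_append, ← Nat.add_assoc,
      ih (by omega), st_succ]
    rw [List.getElem?_eq_getElem (by simpa using hv)]
    simp [dg, show v < n from hv, Nat.add_assoc]

theorem length_encode (A : AdjacencyLists G) : A.encode.length = st (dg A) n := by
  rw [← flatMap_take_length A le_rfl, List.take_of_length_le (by simp), AdjacencyLists.encode,
    List.length_cons, Nat.add_comm]

theorem inp_st_add (A : AdjacencyLists G) (v : Fin n) (j : ℕ) (hj : j ≤ (A.nbrs v).length) :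
    inp A (st (dg A) v + j) = ((A.nbrs v).length :: (A.nbrs v).map Fin.val).getD j 0 := by
  have h1 : List.finRange n = (List.finRange n).take v ++ v :: (List.finRange n).drop (v + 1) := by
    conv_lhs => rw [← List.take_append_drop v (List.finRange n)]
    rw [List.drop_eq_getElem_cons (by simp)]
    simp
  rw [inp, AdjacencyLists.encode, h1, List.flatMap_append, List.flatMap_cons,
    ← flatMap_take_length A v.2.le, Nat.add_assoc, Nat.add_comm 1, List.getD_cons_succ,
    List.getD_append_right _ _ _ _ (by omega), Nat.add_sub_cancel_left,
    List.getD_append _ _ _ _ (by simpa using by omega)]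

theorem inp_st (A : AdjacencyLists G) {v : ℕ} (hv : v < n) : inp A (st (dg A) v) = dg A v := by
  have := inp_st_add A ⟨v, hv⟩ 0 (by omega)
  simpa [dg, hv] using this

theorem inp_dart (A : AdjacencyLists G) (v : Fin n) {j : ℕ} (hj : j < (A.nbrs v).length) :
    inp A (st (dg A) v + 1 + j) = (A.nbrs v)[j] := by
  have := inp_st_add A v (j + 1) hj
  rw [Nat.add_assoc, Nat.add_comm 1]
  rw [this, List.getD_cons_succ, List.getD_eq_getElem _ _ (by simpa using hj)]
  simp

theorem inp_of_le (A : AdjacencyLists G) {i : ℕ} (hi : st (dg A) n ≤ i) : inp A i = 0 := by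
  rw [inp, List.getD_eq_default]
  rwa [length_encode]

theorem sum_dg (A : AdjacencyLists G) : ∑ v ∈ Finset.range n, dg A v = 2 * G.edgeSet.ncard := by
  classical
  rw [Finset.sum_range, ← SimpleGraph.coe_edgeFinset, Set.ncard_coe_finset,
    ← SimpleGraph.sum_degrees_eq_twice_card_edges]
  refine Finset.sum_congr rfl fun v _ => ?_
  rw [dg_val, ← SimpleGraph.card_neighborFinset_eq_degree, ← List.toFinset_card_of_nodup (A.nodup v)]
  congr 1
  ext u
  rw [List.mem_toFinset, A.mem_nbrs, SimpleGraph.mem_neighborFinset]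

theorem st_eq (A : AdjacencyLists G) : st (dg A) n = 1 + n + 2 * G.edgeSet.ncard := by
  rw [st, Finset.sum_add_distrib, sum_dg]
  simp; ring

theorem two_mul_edges_le (A : AdjacencyLists G) : 2 * G.edgeSet.ncard ≤ n * n := by
  rw [← sum_dg A]
  calc _ ≤ ∑ v ∈ Finset.range n, n := Finset.sum_le_sum fun v hv => ?_
    _ = n * n := by simp
  rw [dg]
  split_ifs with h
  · exact (A.nodup _).length_le_card.trans_eq (by simp)
  · exact Nat.zero_le _

/-- The array length used by the program. -/
def arrLen (n : ℕ) : ℕ := n * n + n + 1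

theorem st_le_arrLen (A : AdjacencyLists G) : st (dg A) n ≤ arrLen n := by
  have := two_mul_edges_le A
  rw [st_eq, arrLen]; omega

/-- The array `c` holds the lists of `A`, at the positions of the input. -/
def Holds (A : AdjacencyLists G) (c : ℕ → ℕ) : Prop :=
  ∀ (v : Fin n) (j : ℕ) (hj : j < (A.nbrs v).length), c (st (dg A) v + 1 + j) = (A.nbrs v)[j]

theorem holds_inp (A : AdjacencyLists G) : Holds A (inp A) := fun v _ hj => inp_dart A v hj

/-- The position of the dart `(u, v)`. -/
def pos (A : AdjacencyLists G) (u v : Fin n) : ℕ := st (dg A) u + 1 + (A.nbrs u).idxOf v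

theorem own_pos (A : AdjacencyLists G) {u v : Fin n} (h : G.Adj u v) :
    own (dg A) (pos A u v) = u + 1 := by
  refine own_dart _ ?_
  rw [dg_val]
  exact List.idxOf_lt_length_iff.2 ((A.mem_nbrs _ _).2 h)

theorem pos_lt (A : AdjacencyLists G) {u v : Fin n} (h : G.Adj u v) :
    pos A u v < st (dg A) n := by
  have h1 := List.idxOf_lt_length_iff.2 ((A.mem_nbrs _ _).2 h)
  rw [pos, Nat.add_assoc]
  refine st_lt _ u.2 ?_
  rw [dg_val]
  omega

theorem Holds.apply_pos {A : AdjacencyLists G} {c : ℕ → ℕ} (hc : Holds A c) {u v : Fin n}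
    (h : G.Adj u v) : c (pos A u v) = v := by
  have h1 := List.idxOf_lt_length_iff.2 ((A.mem_nbrs _ _).2 h)
  rw [pos, hc u _ h1, List.getElem_idxOf]

theorem pos_inj (A : AdjacencyLists G) {u v u' v' : Fin n} (h : G.Adj u v) (h' : G.Adj u' v')
    (he : pos A u v = pos A u' v') : u = u' ∧ v = v' := by
  have h1 := List.idxOf_lt_length_iff.2 ((A.mem_nbrs _ _).2 h)
  have h2 := List.idxOf_lt_length_iff.2 ((A.mem_nbrs _ _).2 h')
  have h3 := own_pos A h
  rw [he, own_pos A h'] at h3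
  obtain rfl : u' = u := Fin.ext (by omega)
  refine ⟨rfl, ?_⟩
  rw [pos, pos] at he
  exact (List.idxOf_inj ((A.mem_nbrs _ _).2 h)).1 (by omega)

theorem exists_of_own (A : AdjacencyLists G) {p : ℕ} (hp : p < st (dg A) n)
    (h : own (dg A) p ≠ 0) :
    ∃ u v : Fin n, G.Adj u v ∧ p = pos A u v := by
  obtain ⟨v, h1, j, hj, rfl⟩ := exists_of_own_ne_zero h
  have hv := lt_of_own h1 hp
  obtain ⟨v, rfl⟩ : ∃ v' : Fin n, (v' : ℕ) = v := ⟨⟨v, hv⟩, rfl⟩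
  rw [dg_val] at hj
  refine ⟨v, (A.nbrs v)[j], (A.mem_nbrs _ _).1 (List.getElem_mem _), ?_⟩
  rw [pos, (A.nodup v).idxOf_getElem]

theorem pos_lower (A : AdjacencyLists G) (u v : Fin n) : 2 ≤ pos A u v := by
  have := le_st (dg A) u
  rw [pos]; omega

/-- The position of the dart that follows `(u, v)` on its face. -/
theorem pos_faceNext (A : AdjacencyLists G) (d : G.Dart) :
    pos A (A.faceNext d).fst (A.faceNext d).snd =
      if pos A d.snd d.fst < st (dg A) d.snd + dg A d.snd then pos A d.snd d.fst + 1
      else st (dg A) d.snd + 1 := by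
  obtain ⟨⟨u, v⟩, hd⟩ := d
  have h : u ∈ A.nbrs v := (A.mem_nbrs _ _).2 hd.symm
  have h1 := List.idxOf_lt_length_iff.2 h
  have h2 : (A.nbrs v).next u h = (A.nbrs v)[((A.nbrs v).idxOf u + 1) % (A.nbrs v).length]'
      (Nat.mod_lt _ (by omega)) := by
    conv_lhs => arg 2; rw [← List.getElem_idxOf h1]
    rw [List.next_getElem _ (A.nodup v)]
  have h3 : pos A v ((A.nbrs v).next u h) =
      st (dg A) v + 1 + ((A.nbrs v).idxOf u + 1) % (A.nbrs v).length := by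
    rw [h2, pos, (A.nodup v).idxOf_getElem]
  change pos A v ((A.nbrs v).next u h) =
    if pos A v u < st (dg A) v + dg A v then pos A v u + 1 else st (dg A) v + 1
  rw [h3, dg_val]
  split_ifs with h4
  · rw [pos] at h4 ⊢
    rw [Nat.mod_eq_of_lt (by omega)]; omega
  · rw [pos] at h4
    rw [show (A.nbrs v).idxOf u + 1 = (A.nbrs v).length by omega, Nat.mod_self]

/-- The index of the pair `(own p, c p)` in an adjacency matrix. -/
noncomputable def key (f c : ℕ → ℕ) (n p : ℕ) : ℕ := (own f p - 1) * n + c p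

theorem Holds.key_pos {A : AdjacencyLists G} {c : ℕ → ℕ} (hc : Holds A c) {u v : Fin n}
    (h : G.Adj u v) : key (dg A) c n (pos A u v) = u * n + v := by
  rw [key, own_pos A h, hc.apply_pos h, Nat.add_sub_cancel]

theorem mul_add_inj {n u v u' v' : ℕ} (hv : v < n) (hv' : v' < n)
    (h : u * n + v = u' * n + v') : u = u' ∧ v = v' := (add_mul_eq_iff hv hv').1 h

theorem mul_add_lt {n u v : ℕ} (hu : u < n) (hv : v < n) : u * n + v < n * n := by
  have : (u + 1) * n ≤ n * n := Nat.mul_le_mul_right _ hu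
  rw [Nat.add_mul] at this
  omega

/-- Lists of the right lengths, with distinct entries that are neighbours, are adjacency lists. -/
theorem exists_holds (A : AdjacencyLists G) {c : ℕ → ℕ}
    (hlt : ∀ p < st (dg A) n, own (dg A) p ≠ 0 → c p < n)
    (hadj : ∀ p < st (dg A) n, own (dg A) p ≠ 0 →
      ∃ u v : Fin n, G.Adj u v ∧ key (dg A) c n p = u * n + v)
    (hinj : ∀ p < st (dg A) n, ∀ q < st (dg A) n, own (dg A) p ≠ 0 → own (dg A) q ≠ 0 →
      key (dg A) c n p = key (dg A) c n q → p = q) :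
    ∃ A' : AdjacencyLists G, Holds A' c := by
  have hp : ∀ (v : Fin n) (j : ℕ), j < dg A v → st (dg A) v + 1 + j < st (dg A) n := by
    intro v j hj
    rw [Nat.add_assoc]; exact st_lt _ v.2 (by omega)
  have ho : ∀ (v : Fin n) (j : ℕ), j < dg A v → own (dg A) (st (dg A) v + 1 + j) ≠ 0 := by
    intro v j hj
    rw [own_dart _ hj]; omega
  have hkey : ∀ (v : Fin n) (j : ℕ), j < dg A v →
      key (dg A) c n (st (dg A) v + 1 + j) = v * n + c (st (dg A) v + 1 + j) := by
    intro v j hj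
    rw [key, own_dart _ hj, Nat.add_sub_cancel]
  let nb : Fin n → List (Fin n) := fun v =>
    List.ofFn fun j : Fin (dg A v) => ⟨c (st (dg A) v + 1 + j), hlt _ (hp v j j.2) (ho v j j.2)⟩
  have hnd : ∀ v, (nb v).Nodup := by
    intro v
    rw [List.nodup_ofFn]
    intro i j hij
    rw [Fin.mk.injEq] at hij
    have := hinj _ (hp v i i.2) _ (hp v j j.2) (ho v i i.2) (ho v j j.2)
      (by rw [hkey v i i.2, hkey v j j.2, hij])
    exact Fin.ext (by omega)
  have hsub : ∀ v u, u ∈ nb v → G.Adj v u := by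
    intro v u hu
    rw [List.mem_ofFn] at hu
    obtain ⟨j, rfl⟩ := hu
    obtain ⟨x, y, hxy, he⟩ := hadj _ (hp v j j.2) (ho v j j.2)
    rw [hkey v j j.2] at he
    obtain ⟨h1, h2⟩ := mul_add_inj (hlt _ (hp v j j.2) (ho v j j.2)) y.2 he
    obtain rfl : v = x := Fin.ext h1
    convert hxy
  have hmem : ∀ v u, u ∈ nb v ↔ G.Adj v u := by
    intro v u
    refine ⟨hsub v u, fun h => ?_⟩
    have h1 : (nb v).Subperm (A.nbrs v) :=
      List.subperm_of_subset (hnd v) fun x hx => (A.mem_nbrs _ _).2 (hsub v x hx)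
    have h2 := h1.perm_of_length_le (by simp [nb, dg_val])
    exact h2.mem_iff.2 ((A.mem_nbrs _ _).2 h)
  refine ⟨⟨nb, hnd, hmem⟩, fun v j hj => ?_⟩
  rw [dg_eq A]
  simp [nb]

/-- The relation generated on positions by a relation on darts. -/
theorem eqvGen_pos_iff (A : AdjacencyLists G) {r : G.Dart → G.Dart → Prop} {R : ℕ → ℕ → Prop}
    (hR : ∀ a b, R a b ↔ ∃ d e, r d e ∧ a = pos A d.fst d.snd ∧ b = pos A e.fst e.snd)
    (d e : G.Dart) :
    Relation.EqvGen R (pos A d.fst d.snd) (pos A e.fst e.snd) ↔ Relation.EqvGen r d e := by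
  have hinj : ∀ d e : G.Dart, pos A d.fst d.snd = pos A e.fst e.snd → d = e := fun d e h =>
    SimpleGraph.Dart.ext _ _ (Prod.ext (pos_inj A d.adj e.adj h).1 (pos_inj A d.adj e.adj h).2)
  constructor
  · intro h
    have key : ∀ a b, Relation.EqvGen R a b → a = b ∨ ∃ d e, Relation.EqvGen r d e ∧
        a = pos A d.fst d.snd ∧ b = pos A e.fst e.snd := by
      intro a b h
      induction h with
      | rel a b h =>
        obtain ⟨d, e, h1, h2⟩ := (hR a b).1 h
        exact .inr ⟨d, e, .rel _ _ h1, h2⟩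
      | refl a => exact .inl rfl
      | symm a b _ ih =>
        rcases ih with rfl | ⟨d, e, h1, h2, h3⟩
        · exact .inl rfl
        · exact .inr ⟨e, d, h1.symm _ _, h3, h2⟩
      | trans a b c _ _ ih1 ih2 =>
        rcases ih1 with rfl | ⟨d, e, h1, h2, h3⟩
        · exact ih2
        · rcases ih2 with rfl | ⟨d', e', h1', h2', h3'⟩
          · exact .inr ⟨d, e, h1, h2, h3⟩
          · obtain rfl := hinj _ _ (h3.symm.trans h2')
            exact .inr ⟨d, e', h1.trans _ _ _ h1', h2, h3'⟩
    rcases key _ _ h with h | ⟨d', e', h1, h2, h3⟩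
    · rw [hinj _ _ h]; exact .refl _
    · rwa [hinj _ _ h2, hinj _ _ h3]
  · intro h
    induction h with
    | rel d e h => exact .rel _ _ ((hR _ _).2 ⟨d, e, h, rfl, rfl⟩)
    | refl d => exact .refl _
    | symm d e _ ih => exact ih.symm _ _
    | trans d e f _ _ ih1 ih2 => exact ih1.trans _ _ _ ih2

/-- The positions of the input not holding a neighbour are the first one, which holds `n`, and the `n`
positions holding a degree. -/
theorem card_own (A : AdjacencyLists G) :
    ((Finset.range (st (dg A) n)).filter fun p => own (dg A) p = 0).card = n + 1 := by
  classical
  have h1 : ((Finset.range (st (dg A) n)).filter fun p => own (dg A) p ≠ 0).card =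
      2 * G.edgeSet.ncard := by
    rw [← SimpleGraph.coe_edgeFinset, Set.ncard_coe_finset,
      ← SimpleGraph.dart_card_eq_twice_card_edges, ← Finset.card_univ]
    symm
    refine Finset.card_bij (fun d _ => pos A d.fst d.snd) (fun d _ => ?_) (fun d _ e _ h => ?_)
      fun p hp => ?_
    · rw [Finset.mem_filter, Finset.mem_range, own_pos A d.adj]
      exact ⟨pos_lt A d.adj, by omega⟩
    · exact SimpleGraph.Dart.ext _ _ (Prod.ext (pos_inj A d.adj e.adj h).1
        (pos_inj A d.adj e.adj h).2)
    · rw [Finset.mem_filter, Finset.mem_range] at hp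
      obtain ⟨u, v, h, rfl⟩ := exists_of_own A hp.1 hp.2
      exact ⟨⟨(u, v), h⟩, Finset.mem_univ _, rfl⟩
  have h2 := Finset.card_filter_add_card_filter_not (s := Finset.range (st (dg A) n))
    (fun p => own (dg A) p = 0)
  rw [Finset.card_range] at h2
  have h3 := st_eq A
  simp only [ne_eq] at h1
  omega

theorem numRoots_eq_card_image {N : ℕ} {par sz rep : ℕ → ℕ} (h : UFInv N par sz rep) :
    numRoots N rep = ((Finset.range N).image rep).card := by
  rw [numRoots]
  congr 1
  ext x
  simp only [Finset.mem_filter, Finset.mem_range, Finset.mem_image]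
  constructor
  · rintro ⟨h1, h2⟩; exact ⟨x, h1, h2⟩
  · rintro ⟨y, h1, rfl⟩; exact ⟨h.rep_lt y h1, h.rep_rep h1⟩

/-- The number of classes of positions, if darts of the same face are united: the `n + 1` positions
that hold no dart remain singletons. -/
theorem numRoots_faces (A : AdjacencyLists G) {par sz rep : ℕ → ℕ}
    (h : UFInv (st (dg A) n) par sz rep)
    (h1 : ∀ d e : G.Dart, rep (pos A d.fst d.snd) = rep (pos A e.fst e.snd) ↔
      Relation.EqvGen (fun d e : G.Dart => A.faceNext d = e) d e)
    (h2 : ∀ p < st (dg A) n, ∀ q < st (dg A) n, own (dg A) p = 0 → rep p = rep q → p = q) :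
    numRoots (st (dg A) n) rep =
      Nat.card (Quot fun d e : G.Dart => A.faceNext d = e) + (n + 1) := by
  classical
  rw [numRoots_eq_card_image h, ← card_own A]
  set N := st (dg A) n with hN
  have h3 : (Finset.range N).image rep =
      ((Finset.range N).filter fun p => ¬ own (dg A) p = 0).image rep ∪
        ((Finset.range N).filter fun p => own (dg A) p = 0).image rep := by
    rw [← Finset.image_union, Finset.union_comm, Finset.filter_union_filter_not_eq]
  rw [h3, Finset.card_union_of_disjoint, Finset.card_image_of_injOn (s := Finset.filter
    (fun p => own (dg A) p = 0) (Finset.range N))]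
  · congr 1
    let F : (Quot fun d e : G.Dart => A.faceNext d = e) → ℕ :=
      Quot.lift (fun d => rep (pos A d.fst d.snd)) fun d e hde => (h1 d e).2 (.rel _ _ hde)
    have hF : F.Injective := by
      rintro ⟨d⟩ ⟨e⟩ hde
      exact quot_mk_eq_iff.2 ((h1 d e).1 hde)
    rw [← Nat.card_range_of_injective hF, Nat.card_coe_set_eq, ← Set.ncard_coe_finset]
    congr 1
    ext x
    simp only [Finset.coe_image, Set.mem_image, Finset.mem_coe, Finset.mem_filter,
      Finset.mem_range, Set.mem_range]
    constructor
    · rintro ⟨p, ⟨hp, hp'⟩, rfl⟩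
      obtain ⟨u, v, huv, rfl⟩ := exists_of_own A hp hp'
      exact ⟨Quot.mk _ ⟨(u, v), huv⟩, rfl⟩
    · rintro ⟨⟨d⟩, rfl⟩
      exact ⟨_, ⟨pos_lt A d.adj, by rw [own_pos A d.adj]; omega⟩, rfl⟩
  · intro p hp q hq hpq
    simp only [Finset.coe_filter, Finset.mem_range, Set.mem_ofPred_eq] at hp hq
    exact h2 p hp.1 q hq.1 hp.2 hpq
  · rw [Finset.disjoint_left]
    intro x hx hx'
    simp only [Finset.mem_image, Finset.mem_filter, Finset.mem_range] at hx hx'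
    obtain ⟨p, ⟨hp, hp'⟩, rfl⟩ := hx
    obtain ⟨q, ⟨hq, hq'⟩, he⟩ := hx'
    rw [h2 q hq p hp hq' he] at hq'
    exact hp' hq'

end Layout

/-! ### Reading the input -/

/-- The operation writes only to registers in `R` and to arrays in `K`, and emits nothing. -/
def Op.within (R K : List ℕ) : Op → Bool
  | .const d _ => d ∈ R
  | .add d _ _ => d ∈ R
  | .sub d _ _ => d ∈ R
  | .mul d _ _ => d ∈ R
  | .rd d _ _ => d ∈ R
  | .wr k _ _ => k ∈ K
  | .emit _ _ => false

theorem Fr.run {R K : List ℕ} {s s' : St} (h : Fr R K s s') (o : Op) (ho : o.within R K) :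
    Fr R K s (o.run s') := by
  cases o <;> simp only [Op.within, decide_eq_true_eq] at ho
  case wr k a b =>
    refine ⟨h.reg, fun k' hk' => ?_, h.out⟩
    simp only [Op.run]
    rw [Function.update_of_ne (fun e => hk' (by rw [e]; exact ho)), h.arr k' hk']
  case emit => simp at ho
  all_goals
    refine ⟨fun r hr => ?_, h.arr, h.out⟩
    simp only [Op.run]
    rw [Function.update_of_ne (fun e => hr (by rw [e]; exact ho)), h.reg r hr]

theorem Fr.runOps {R K : List ℕ} {s s' : St} (h : Fr R K s s') (l : List Op)
    (hl : l.all (Op.within R K)) : Fr R K s (runOps l s') := by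
  induction l generalizing s' with
  | nil => exact h
  | cons o l ih =>
    rw [List.all_cons, Bool.and_eq_true] at hl
    exact ih (h.run o hl.1) hl.2

section Scan

variable {n : ℕ} {G : SimpleGraph (Fin n)}

/-- The arrays after the positions below `p` of the input have been read: the owners (array `12`),
the candidate rotation (array `13`) and the adjacency matrix (array `6`). -/
structure ScanArr (A : AdjacencyLists G) (p : ℕ) (s : St) : Prop where
  input : s.arr 0 = inp A
  owner : ∀ q, s.arr 12 q = if q < p then own (dg A) q else 0
  cand : ∀ q, s.arr 13 q = if q < p ∧ own (dg A) q ≠ 0 then inp A q else 0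
  adj : ∀ i, s.arr 6 i ≠ 0 ↔ ∃ q < p, own (dg A) q ≠ 0 ∧ i = key (dg A) (inp A) n q

theorem ScanArr.skip {A : AdjacencyLists G} {p : ℕ} {s s' : St} (h : ScanArr A p s)
    (hp : own (dg A) p = 0) (h0 : s'.arr 0 = s.arr 0) (h6 : s'.arr 6 = s.arr 6)
    (h12 : s'.arr 12 = s.arr 12) (h13 : s'.arr 13 = s.arr 13) : ScanArr A (p + 1) s' := by
  refine ⟨h0.trans h.input, fun q => ?_, fun q => ?_, fun i => ?_⟩
  · rw [h12, h.owner]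
    rcases Nat.lt_trichotomy q p with h1 | rfl | h1
    · rw [if_pos h1, if_pos (by omega)]
    · simp [hp]
    · rw [if_neg (by omega), if_neg (by omega)]
  · rw [h13, h.cand]
    rcases Nat.lt_trichotomy q p with h1 | rfl | h1
    · simp [h1, show q < p + 1 by omega]
    · simp [hp]
    · rw [if_neg (by omega), if_neg (by omega)]
  · rw [h6, h.adj]
    constructor
    · rintro ⟨q, h1, h2⟩; exact ⟨q, by omega, h2⟩
    · rintro ⟨q, h1, h2⟩
      refine ⟨q, ?_, h2⟩
      rcases Nat.lt_succ_iff_lt_or_eq.1 h1 with h3 | rfl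
      · exact h3
      · exact absurd hp h2.1

theorem inp_lt (A : AdjacencyLists G) {p : ℕ} (hp : p < st (dg A) n) (h : own (dg A) p ≠ 0) :
    inp A p < n := by
  obtain ⟨u, v, huv, rfl⟩ := exists_of_own A hp h
  rw [(holds_inp A).apply_pos huv]; exact v.2

/-- Reads the list of the vertex in register `8`, up to the position in register `12`. -/
def scanListCmd : Cmd :=
  .loop 7 12 (.blk [.wr 12 7 15, .rd 13 0 7, .wr 13 7 13, .add 14 16 13, .wr 6 14 3, .add 7 7 3])

theorem wp_scanList {B U : ℕ} (hU : 16 * B ≤ U) (hB : B = arrLen n) (A : AdjacencyLists G) {s : St}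
    {v : ℕ} (hv : v < n) (h3 : s.reg 3 = 1) (h7 : s.reg 7 = st (dg A) v + 1)
    (h12 : s.reg 12 = st (dg A) (v + 1)) (h15 : s.reg 15 = v + 1) (h16 : s.reg 16 = v * n)
    (hs : ScanArr A (st (dg A) v + 1) s) :
    WP B U scanListCmd s fun t s' => t ≤ dg A v * 20 + 2 ∧ s'.reg 7 = st (dg A) (v + 1) ∧
      ScanArr A (st (dg A) (v + 1)) s' ∧ Fr [7, 13, 14] [6, 12, 13] s s' := by
  have hsucc := st_succ (dg A) v
  have hL : st (dg A) (v + 1) ≤ st (dg A) n := st_mono _ hv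
  have hLB := st_le_arrLen A
  refine (WP.for (st (dg A) (v + 1)) 18 (fun i s' => st (dg A) v + 1 ≤ i ∧
    Fr [7, 13, 14] [6, 12, 13] s s' ∧ ScanArr A i s') ?_ (by omega) h7 h12
    ⟨le_rfl, .refl _ _ _, hs⟩).mono ?_
  · rintro i s' hi hr7 hr12 ⟨h1, hf, ha⟩
    obtain ⟨j, hj, rfl⟩ : ∃ j < dg A v, i = st (dg A) v + 1 + j := ⟨i - st (dg A) v - 1, by omega⟩
    set p := st (dg A) v + 1 + j with hp
    have hown : own (dg A) p = v + 1 := own_dart _ hj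
    have hc : inp A p < n := inp_lt A (by omega) (by omega)
    have e16 : s'.reg 16 = v * n := by rw [hf.reg 16 (by decide), h16]
    have e15 : s'.reg 15 = v + 1 := by rw [hf.reg 15 (by decide), h15]
    have e3 : s'.reg 3 = 1 := by rw [hf.reg 3 (by decide), h3]
    have hkey : key (dg A) (inp A) n p = v * n + inp A p := by rw [key, hown, Nat.add_sub_cancel]
    have hidx := mul_add_lt hv hc
    have hB' : n * n < B := by rw [hB, arrLen]; omega
    refine WP.blk ?_ ⟨by simp [costOps, Op.cost], ?_, ?_, by omega,
      hf.runOps _ (by decide), ⟨?_, fun q => ?_, fun q => ?_, fun i => ?_⟩⟩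
    · simp [okOps, Op.ok, Op.run, hr7, e16, e3, ha.input]
      omega
    · simp [runOps, Op.run, hr7, e3]
    · simp [runOps, Op.run, hr12]
    · simp [runOps, Op.run, ha.input]
    · simp only [runOps, Op.run, Function.update_apply, hr7, e15, e16, ha.input]
      have h6 := ha.owner q
      rcases Nat.lt_trichotomy q p with h5 | h5 | h5
      · simp [h5, h5.ne, show q < p + 1 by omega, h6]
      · simp [h5, hown]
      · simp [h5.ne', show ¬ q < p by omega, show ¬ q < p + 1 by omega, h6]
    · simp only [runOps, Op.run, Function.update_apply, hr7, e15, e16, ha.input]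
      have h6 := ha.cand q
      rcases Nat.lt_trichotomy q p with h5 | h5 | h5
      · simp [h5, h5.ne, show q < p + 1 by omega, h6]
      · simp [h5, hown]
      · simp [h5.ne', show ¬ q < p by omega, show ¬ q < p + 1 by omega, h6]
    · have h5 : (runOps [.wr 12 7 15, .rd 13 0 7, .wr 13 7 13, .add 14 16 13, .wr 6 14 3,
          .add 7 7 3] s').arr 6 i = if i = key (dg A) (inp A) n p then 1 else s'.arr 6 i := by
        simp [runOps, Op.run, Function.update_apply, hr7, e16, e3, ha.input, hkey]
      rw [h5]
      constructor
      · split_ifs with h6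
        · intro _; exact ⟨p, by omega, by omega, h6⟩
        · intro h7
          obtain ⟨q, h8, h9⟩ := (ha.adj i).1 h7
          exact ⟨q, by omega, h9⟩
      · rintro ⟨q, h8, h9, h10⟩
        split_ifs with h6
        · norm_num
        · rcases Nat.lt_succ_iff_lt_or_eq.1 h8 with h11 | rfl
          · exact (ha.adj i).2 ⟨q, h11, h9, h10⟩
          · exact absurd h10 h6
  · rintro t s' ⟨h1, h2, -, -, h5, h6⟩
    refine ⟨h1.trans ?_, h2, h6, h5⟩
    rw [show st (dg A) (v + 1) - (st (dg A) v + 1) = dg A v by omega]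

/-- Reads the input. -/
def scanCmd : Cmd :=
  .blk [.const 3 1, .const 4 0, .rd 2 0 4, .add 7 3 4, .add 8 4 4, .add 9 4 4] ;;
  .loop 8 2 (
    .blk [.wr 11 8 7, .rd 11 0 7, .add 12 7 11, .add 12 12 3, .add 7 7 3, .add 15 8 3,
      .mul 16 8 2] ;;
    .ite 4 11 (.blk []) (.blk [.add 9 9 3]) ;;
    scanListCmd ;;
    .blk [.add 8 8 3]) ;;
  .blk [.add 5 7 4]

/-- The number of isolated vertices below `v`. -/
def isoCount (f : ℕ → ℕ) (v : ℕ) : ℕ := ((Finset.range v).filter fun u => f u = 0).card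

theorem isoCount_succ (f : ℕ → ℕ) (v : ℕ) :
    isoCount f (v + 1) = isoCount f v + if f v = 0 then 1 else 0 := by
  rw [isoCount, isoCount, Finset.range_add_one, Finset.filter_insert]
  split_ifs
  · rw [Finset.card_insert_of_notMem (by simp)]
  · rfl

theorem isoCount_le (f : ℕ → ℕ) (v : ℕ) : isoCount f v ≤ v :=
  (Finset.card_filter_le _ _).trans_eq (Finset.card_range v)

theorem wp_scan {B U : ℕ} (hU : 16 * B ≤ U) (hB : B = arrLen n) (A : AdjacencyLists G) {s : St}
    (h0 : s.arr 0 = inp A) (hz : ∀ k, k ≠ 0 → s.arr k = fun _ => 0) :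
    WP B U scanCmd s fun t s' => t ≤ 50 * st (dg A) n + 50 ∧
      s'.reg 2 = n ∧ s'.reg 3 = 1 ∧ s'.reg 4 = 0 ∧ s'.reg 5 = st (dg A) n ∧
      s'.reg 9 = isoCount (dg A) n ∧ ScanArr A (st (dg A) n) s' ∧
      (∀ v < n, s'.arr 11 v = st (dg A) v) ∧
      (∀ k, k ∉ [0, 6, 11, 12, 13] → s'.arr k = fun _ => 0) ∧ s'.out = s.out := by
  have hLB := st_le_arrLen A
  have hnn : n ≤ n * n := Nat.le_mul_self n
  rw [← hB] at hLB
  have hBn : n * n + n + 1 = B := hB.symm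
  refine WP.seq (WP.blk ?_ ?_)
  · simp [okOps, Op.ok, Op.run, h0]
    omega
  generalize hs₁ : runOps _ s = s₁
  simp only [runOps, Op.run] at hs₁
  have a1 : s₁.arr = s.arr := by subst hs₁; rfl
  have o1 : s₁.out = s.out := by subst hs₁; rfl
  have r2 : s₁.reg 2 = n := by subst hs₁; simp [h0, inp_zero]
  have r3 : s₁.reg 3 = 1 := by subst hs₁; simp
  have r4 : s₁.reg 4 = 0 := by subst hs₁; simp
  have r7 : s₁.reg 7 = 1 := by subst hs₁; simp
  have r8 : s₁.reg 8 = 0 := by subst hs₁; simp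
  have r9 : s₁.reg 9 = 0 := by subst hs₁; simp
  clear hs₁
  refine WP.seq ((WP.loop (fun m s' => ∃ v ≤ n, m = 50 * (st (dg A) n - st (dg A) v) ∧
    s'.reg 8 = v ∧ s'.reg 7 = st (dg A) v ∧ s'.reg 9 = isoCount (dg A) v ∧
    ScanArr A (st (dg A) v) s' ∧ (∀ u < v, s'.arr 11 u = st (dg A) u) ∧
    Fr [7, 8, 9, 11, 12, 13, 14, 15, 16] [6, 11, 12, 13] s₁ s')
    ?_ (m := 50 * (st (dg A) n - 1))
    ⟨0, Nat.zero_le _, by rw [st_zero], r8, by rw [r7, st_zero], r9, ?_, by simp, .refl _ _ _⟩).mono ?_)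
  · rintro m s' ⟨v, hvn, rfl, h8, h7, h9, hsc, h11, hf⟩ hlt
    have e2 : s'.reg 2 = n := by rw [hf.reg 2 (by decide), r2]
    have e3 : s'.reg 3 = 1 := by rw [hf.reg 3 (by decide), r3]
    have e4 : s'.reg 4 = 0 := by rw [hf.reg 4 (by decide), r4]
    rw [h8, e2] at hlt
    have hsucc := st_succ (dg A) v
    have hL : st (dg A) (v + 1) ≤ st (dg A) n := st_mono _ hlt
    have hvv : v * n ≤ n * n := Nat.mul_le_mul_right _ hvn
    have hinp : inp A (st (dg A) v) = dg A v := inp_st A hlt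
    refine WP.seq (WP.blk ?_ ?_)
    · simp [okOps, Op.ok, Op.run, h8, h7, e2, e3, hsc.input, hinp]
      omega
    generalize hs₂ : runOps _ s' = s₂
    have f2 : Fr [7, 8, 9, 11, 12, 13, 14, 15, 16] [6, 11, 12, 13] s₁ s₂ := by
      subst hs₂; exact hf.runOps _ (by decide)
    have g : Fr [7, 11, 12, 15, 16] [11] s' s₂ := by
      subst hs₂; exact (Fr.refl _ _ _).runOps _ (by decide)
    simp only [runOps, Op.run] at hs₂
    have g11 : s₂.reg 11 = dg A v := by subst hs₂; simp [h7, hsc.input, hinp]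
    have g12 : s₂.reg 12 = st (dg A) (v + 1) := by
      subst hs₂; simp [h7, hsc.input, hinp, e3, hsucc]
    have g7 : s₂.reg 7 = st (dg A) v + 1 := by subst hs₂; simp [h7, e3]
    have g15 : s₂.reg 15 = v + 1 := by subst hs₂; simp [h8, e3]
    have g16 : s₂.reg 16 = v * n := by subst hs₂; simp [h8, e2]
    have ga11 : s₂.arr 11 = Function.update (s'.arr 11) v (st (dg A) v) := by
      subst hs₂; simp [h8, h7]
    clear hs₂
    -- the count of isolated vertices
    refine WP.seq (WP.mono (Q := fun t s₃ => t ≤ 3 ∧ s₃.reg 9 = isoCount (dg A) (v + 1) ∧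
      Fr [9] [] s₂ s₃) ?_ ?_)
    · have k4 : s₂.reg 4 = 0 := by rw [f2.reg 4 (by decide), r4]
      have k3 : s₂.reg 3 = 1 := by rw [f2.reg 3 (by decide), r3]
      have k9 : s₂.reg 9 = isoCount (dg A) v := by rw [g.reg 9 (by decide), h9]
      have hle := isoCount_le (dg A) v
      refine WP.ite (fun h => WP.blk trivial ⟨by simp [costOps], ?_, .refl _ _ _⟩)
        (fun h => WP.blk ?_ ⟨by simp [costOps, Op.cost], ?_, (Fr.refl _ _ _).runOps _ (by decide)⟩)
      · rw [k4, g11] at h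
        rw [isoCount_succ, if_neg (by omega)]
        exact k9
      · simp [okOps, Op.ok, k9, k3]
        omega
      · rw [k4, g11] at h
        rw [isoCount_succ, if_pos (by omega)]
        simp [runOps, Op.run, k9, k3]
    rintro t₃ s₃ ⟨ht₃, i9, f3⟩
    have f3' := f2.trans (f3.mono (R' := [7, 8, 9, 11, 12, 13, 14, 15, 16])
      (K' := [6, 11, 12, 13]) (by decide) (by decide))
    have a3 : ∀ k, k ≠ 11 → s₃.arr k = s'.arr k := fun k hk => by
      rw [f3.arr k (by simp), g.arr k (by simpa using hk)]
    refine WP.seq ((wp_scanList hU hB A hlt (by rw [f3'.reg 3 (by decide), r3])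
      (by rw [f3.reg 7 (by decide), g7]) (by rw [f3.reg 12 (by decide), g12])
      (by rw [f3.reg 15 (by decide), g15]) (by rw [f3.reg 16 (by decide), g16])
      (hsc.skip (own_st _ v) (a3 0 (by decide)) (a3 6 (by decide)) (a3 12 (by decide))
        (a3 13 (by decide)))).mono ?_)
    rintro t₄ s₄ ⟨ht₄, j7, hsc', f4⟩
    have f4' := f3'.trans (f4.mono (R' := [7, 8, 9, 11, 12, 13, 14, 15, 16])
      (K' := [6, 11, 12, 13]) (by decide) (by decide))
    have j8 : s₄.reg 8 = v := by
      rw [f4.reg 8 (by decide), f3.reg 8 (by decide), g.reg 8 (by decide), h8]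
    have j3 : s₄.reg 3 = 1 := by rw [f4'.reg 3 (by decide), r3]
    refine WP.blk ?_ ⟨50 * (st (dg A) n - st (dg A) (v + 1)), ?_, v + 1, hlt, rfl, ?_, ?_, ?_, ?_,
      ?_, f4'.runOps _ (by decide)⟩
    · simp [okOps, Op.ok, j8, j3]; omega
    · simp only [costOps, Op.cost]; omega
    · simp [runOps, Op.run, j8, j3]
    · simpa [runOps, Op.run] using j7
    · simp [runOps, Op.run]
      rw [f4.reg 9 (by decide), i9]
    · exact ⟨hsc'.input, hsc'.owner, hsc'.cand, hsc'.adj⟩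
    · intro u hu
      simp only [runOps, Op.run]
      rw [f4.arr 11 (by decide), f3.arr 11 (by decide), ga11, Function.update_apply]
      split_ifs with h5
      · rw [h5]
      · exact h11 u (by omega)
  · refine ⟨by rw [a1, h0], fun q => ?_, fun q => ?_, fun i => ?_⟩
    · rw [a1, hz 12 (by decide)]
      split_ifs with h
      · rw [st_zero] at h
        obtain rfl : q = 0 := by omega
        rw [own_zero]
      · rfl
    · rw [a1, hz 13 (by decide), if_neg]
      rintro ⟨h, h'⟩
      rw [st_zero] at h
      obtain rfl : q = 0 := by omega
      exact h' (own_zero _)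
    · rw [a1, hz 6 (by decide)]
      refine iff_of_false (by simp) ?_
      rintro ⟨q, h, h', -⟩
      rw [st_zero] at h
      obtain rfl : q = 0 := by omega
      exact h' (own_zero _)
  · rintro t s' ⟨h1, ⟨m, -, v, hvn, -, h8, h7, h9, hsc, h11, hf⟩, h5⟩
    have e2 : s'.reg 2 = n := by rw [hf.reg 2 (by decide), r2]
    have e3 : s'.reg 3 = 1 := by rw [hf.reg 3 (by decide), r3]
    have e4 : s'.reg 4 = 0 := by rw [hf.reg 4 (by decide), r4]
    rw [h8, e2] at h5
    obtain rfl : v = n := by omega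
    refine WP.blk ?_ ⟨?_, ?_, ?_, ?_, ?_, ?_, ⟨hsc.input, hsc.owner, hsc.cand, hsc.adj⟩, h11, ?_, ?_⟩
    · simp [okOps, Op.ok, h7, e4]; omega
    · simp only [costOps, Op.cost]; omega
    · simp [runOps, Op.run, e2]
    · simp [runOps, Op.run, e3]
    · simp [runOps, Op.run, e4]
    · simp [runOps, Op.run, h7, e4]
    · simp [runOps, Op.run, h9]
    · intro k hk
      simp only [List.mem_cons, List.not_mem_nil, not_or] at hk
      have := hf.arr k (by simp [hk])
      simp only [runOps, Op.run]
      rw [this, a1, hz k hk.1]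
    · simp only [runOps, Op.run]
      rw [hf.out, o1]

end Scan

/-! ### Uniting along all darts -/

/-- Initializes a union-find forest of singletons, of the size in register `rb`. -/
def initForestCmd (kp ks rb : ℕ) : Cmd :=
  .blk [.add 7 4 4] ;; .loop 7 rb (.blk [.wr kp 7 7, .wr ks 7 3, .add 7 7 3])

theorem wp_initForest {B U N kp ks rb : ℕ} (hU : 16 * B ≤ U) (hN : N ≤ B) (hkp : kp < 16)
    (hks : ks < 16) (hne : kp ≠ ks) (hrb : rb ≠ 7) {s : St} (h3 : s.reg 3 = 1) (h4 : s.reg 4 = 0)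
    (hb : s.reg rb = N) (hB : 0 < B) :
    WP B U (initForestCmd kp ks rb) s fun t s' => t ≤ 11 * N + 3 ∧
      UFInv N (s'.arr kp) (s'.arr ks) id ∧ Fr [7] [kp, ks] s s' := by
  refine WP.seq (WP.blk ?_ ?_)
  · simp [okOps, Op.ok, h4]; omega
  refine (WP.for N 9 (fun i s' => (∀ x < i, s'.arr kp x = x) ∧ (∀ x < i, s'.arr ks x = 1) ∧
    Fr [7] [kp, ks] s s') ?_ (Nat.zero_le N) ?_ ?_ ?_).mono ?_
  · rintro i s' hi h7 hb' ⟨h5, h6, hf⟩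
    have e3 : s'.reg 3 = 1 := by rw [hf.reg 3 (by decide), h3]
    refine WP.blk ?_ ⟨by simp [costOps, Op.cost], ?_, ?_, fun x hx => ?_, fun x hx => ?_,
      hf.runOps _ (by simp [Op.within])⟩
    · simp [okOps, Op.ok, Op.run, h7, e3]; omega
    · simp [runOps, Op.run, h7, e3]
    · simp [runOps, Op.run, hrb, hb']
    · simp only [runOps, Op.run, Function.update_apply, h7, e3, hne, hne.symm, if_true, if_false]
      split_ifs with h
      · exact h.symm
      · exact h5 x (by omega)
    · simp only [runOps, Op.run, Function.update_apply, h7, e3, hne.symm, if_true, if_false]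
      split_ifs with h
      · rfl
      · exact h6 x (by omega)
  · simp [runOps, Op.run, h4]
  · simp [runOps, Op.run, hrb, hb]
  · exact ⟨by simp, by simp, (Fr.refl _ _ _).runOps _ (by simp [Op.within])⟩
  · rintro t s' ⟨h5, -, -, h6, h7, h8⟩
    refine ⟨?_, UFInv.init h6 h7, h8⟩
    simp only [costOps, Op.cost]
    omega

/-- For every position that holds a dart, `prep` loads two numbers into the registers `20` and `25`,
which are united. Register `17` counts the classes. -/
def uniteAllCmd (prep : Cmd) (kp ks : ℕ) : Cmd :=
  .loop 7 5 (
    .blk [.rd 15 12 7] ;;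
    .ite 4 15 (prep ;; unionCmd kp ks ;; .blk [.sub 17 17 29]) (.blk []) ;;
    .blk [.add 7 7 3])

/-- The pairs that are united for the positions below `i`. -/
def UnitedRel (f X Y : ℕ → ℕ) (i a b : ℕ) : Prop := ∃ p < i, own f p ≠ 0 ∧ a = X p ∧ b = Y p

/-- The extension of `rep` by the identity. -/
def extRep (N : ℕ) (rep : ℕ → ℕ) (a : ℕ) : ℕ := if a < N then rep a else a

/-- `Merged` only constrains elements below `N`, while `Relation.EqvGen` lives on all of `ℕ`; extending
by the identity makes the two comparable. -/
theorem Merged.extRep {N : ℕ} {rep rep' : ℕ → ℕ} {x y : ℕ} (h : Merged N rep rep' x y)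
    (hr : ∀ x < N, rep x < N) (hr' : ∀ x < N, rep' x < N) (hx : x < N) (hy : y < N) (a b : ℕ) :
    extRep N rep' a = extRep N rep' b ↔ extRep N rep a = extRep N rep b ∨
      (extRep N rep a = extRep N rep x ∧ extRep N rep b = extRep N rep y) ∨
      (extRep N rep a = extRep N rep y ∧ extRep N rep b = extRep N rep x) := by
  simp only [DecrementalConnectivity.extRep, hx, hy, if_true]
  have h1 := hr x hx
  have h2 := hr y hy
  by_cases ha : a < N <;> by_cases hb : b < N
  · simp only [ha, hb, if_true]; exact h a ha b hb
  · simp only [ha, hb, if_true, if_false]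
    have := hr a ha
    have := hr' a ha
    omega
  · simp only [ha, hb, if_true, if_false]
    have := hr b hb
    have := hr' b hb
    omega
  · simp only [ha, hb, if_false]
    omega

theorem numRoots_id (N : ℕ) : numRoots N id = N := by
  simp [numRoots]

/-- If `prep` puts `X p` and `Y p` into registers `20` and `25` for each dart position `p`, then the loop
computes the equivalence closure of the pairs `(X p, Y p)` and leaves the number of classes in
register `17`. -/
theorem wp_uniteAll {B U N L Kp kp ks : ℕ} {f X Y : ℕ → ℕ} {prep : Cmd} (hU : 16 * B ≤ U)
    (hN : N ≤ B) (hL : L ≤ B) (hkp : kp < 5) (hks : ks < 5) (hne : kp ≠ ks)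
    {s : St} (h3 : s.reg 3 = 1) (h4 : s.reg 4 = 0) (h5 : s.reg 5 = L) (h7 : s.reg 7 = 0)
    (h17 : s.reg 17 = N) (hown : ∀ p < L, s.arr 12 p = own f p)
    (hX : ∀ p < L, own f p ≠ 0 → X p < N) (hY : ∀ p < L, own f p ≠ 0 → Y p < N)
    (h : UFInv N (s.arr kp) (s.arr ks) id)
    (hprep : ∀ p < L, own f p ≠ 0 → ∀ s',
      Fr [7, 13, 14, 15, 16, 17, 20, 21, 22, 23, 24, 25, 26, 27, 28, 29] [kp, ks] s s' →
      s'.reg 7 = p → s'.reg 15 = own f p →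
      WP B U prep s' fun t s'' => t ≤ Kp ∧ s''.reg 20 = X p ∧ s''.reg 25 = Y p ∧
        Fr [13, 14, 16, 20, 25] [] s' s'') :
    WP B U (uniteAllCmd prep kp ks) s fun t s' =>
      t ≤ L * (Kp + 60 * (Nat.log 2 N + 1) + 12) + 2 ∧
      (∃ rep, UFInv N (s'.arr kp) (s'.arr ks) rep ∧ s'.reg 17 = numRoots N rep ∧
        ∀ a < N, ∀ b < N, rep a = rep b ↔ Relation.EqvGen (UnitedRel f X Y L) a b) ∧
      Fr [7, 13, 14, 15, 16, 17, 20, 21, 22, 23, 24, 25, 26, 27, 28, 29] [kp, ks] s s' := by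
  refine (WP.for L (Kp + 60 * (Nat.log 2 N + 1) + 10) (fun i s' =>
    (∃ rep, UFInv N (s'.arr kp) (s'.arr ks) rep ∧ s'.reg 17 = numRoots N rep ∧
        ∀ a b, extRep N rep a = extRep N rep b ↔ Relation.EqvGen (UnitedRel f X Y i) a b) ∧
      Fr [7, 13, 14, 15, 16, 17, 20, 21, 22, 23, 24, 25, 26, 27, 28, 29] [kp, ks] s s')
    ?_ (Nat.zero_le L) h7 h5 ⟨⟨id, h, by rw [h17, numRoots_id], fun a b => ?_⟩,
      .refl _ _ _⟩).mono ?_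
  · rintro p s' hp h7 h5 ⟨⟨rep, huf, h17, hrep⟩, hf⟩
    have e3 : s'.reg 3 = 1 := by rw [hf.reg 3 (by decide), h3]
    have ho : s'.arr 12 p = own f p := by
      rw [hf.arr 12 (by simp; omega), hown p hp]
    refine WP.seq (WP.blk ?_ ?_)
    · simp [okOps, Op.ok, h7]; omega
    generalize hs₁ : runOps _ s' = s₁
    have f1 : Fr [7, 13, 14, 15, 16, 17, 20, 21, 22, 23, 24, 25, 26, 27, 28, 29] [kp, ks] s s₁ := by
      subst hs₁; exact hf.runOps _ (by simp [Op.within])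
    have g1 : Fr [15] [] s' s₁ := by
      subst hs₁; exact (Fr.refl _ _ _).runOps _ (by simp [Op.within])
    have g15 : s₁.reg 15 = own f p := by subst hs₁; simp [runOps, Op.run, h7, ho]
    clear hs₁
    have g7 : s₁.reg 7 = p := by rw [g1.reg 7 (by decide), h7]
    have ga : ∀ k, s₁.arr k = s'.arr k := fun k => g1.arr k (by simp)
    refine WP.seq (WP.mono (Q := fun t s₂ => t ≤ Kp + 60 * (Nat.log 2 N + 1) + 3 ∧
      (∃ rep, UFInv N (s₂.arr kp) (s₂.arr ks) rep ∧ s₂.reg 17 = numRoots N rep ∧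
        ∀ a b, extRep N rep a = extRep N rep b ↔
          Relation.EqvGen (UnitedRel f X Y (p + 1)) a b) ∧
      Fr [13, 14, 15, 16, 17, 20, 21, 22, 23, 24, 25, 26, 27, 28, 29] [kp, ks] s₁ s₂) ?_ ?_)
    · refine WP.ite (fun hlt => ?_) (fun hlt => ?_)
      · rw [f1.reg 4 (by decide), h4, g15] at hlt
        refine WP.seq ((hprep p hp hlt.ne' s₁ f1 g7 g15).mono ?_)
        rintro t₂ s₂ ⟨ht₂, e20, e25, f2⟩
        have ga2 : ∀ k, s₂.arr k = s'.arr k := fun k => by rw [f2.arr k (by simp), ga]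
        refine WP.seq ((wp_union (rep := rep) hU hN (by omega) (by omega) hne (by rw [ga2, ga2]; exact huf)
          (by rw [e20]; exact hX p hp hlt.ne') (by rw [e25]; exact hY p hp hlt.ne')
          (by rw [f2.reg 4 (by decide), f1.reg 4 (by decide), h4])).mono ?_)
        rintro t₃ s₃ ⟨ht₃, ⟨rep', huf', hm, hn⟩, -, f3⟩
        rw [e20, e25] at hm
        have e17 : s₃.reg 17 = numRoots N rep := by
          rw [f3.reg 17 (by decide), f2.reg 17 (by decide), g1.reg 17 (by decide), h17]
        refine WP.blk ⟨trivial, trivial⟩ ⟨?_, ⟨rep', huf', ?_, fun a b => ?_⟩, ?_⟩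
        · simp only [costOps, Op.cost]; omega
        · simp [runOps, Op.run, e17]; omega
        · rw [hm.extRep huf.rep_lt huf'.rep_lt (hX p hp hlt.ne') (hY p hp hlt.ne')]
          refine (eqvGen_insert_iff hrep ?_ ?_ ?_ a b).symm
          · rintro x y ⟨q, hq, h⟩; exact ⟨q, by omega, h⟩
          · exact ⟨p, by omega, hlt.ne', rfl, rfl⟩
          · rintro x y ⟨q, hq, hq', rfl, rfl⟩
            rcases Nat.lt_succ_iff_lt_or_eq.1 hq with h | rfl
            · exact .inl ⟨q, h, hq', rfl, rfl⟩
            · exact .inr (.inl ⟨rfl, rfl⟩)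
        · refine (((f2.mono (by decide) (by simp)).trans (f3.mono ?_ ?_)).runOps _ (by simp [Op.within]))
          · decide
          · simp
      · rw [f1.reg 4 (by decide), h4, g15] at hlt
        refine WP.blk trivial ⟨?_, ⟨rep, ?_, ?_, fun a b => ?_⟩, .refl _ _ _⟩
        · simp only [costOps]; omega
        · simpa only [runOps, ga] using huf
        · simp only [runOps]; rw [g1.reg 17 (by decide), h17]
        · rw [hrep]
          have : UnitedRel f X Y (p + 1) = UnitedRel f X Y p := by
            funext x y
            refine propext ⟨?_, ?_⟩
            · rintro ⟨q, hq, hq', h⟩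
              rcases Nat.lt_succ_iff_lt_or_eq.1 hq with h | rfl
              · exact ⟨q, by assumption, hq', by assumption⟩
              · omega
            · rintro ⟨q, hq, h⟩; exact ⟨q, by omega, h⟩
          rw [this]
    rintro t₂ s₂ ⟨ht₂, ⟨rep', huf', h17', hrep'⟩, f2⟩
    have j7 : s₂.reg 7 = p := by rw [f2.reg 7 (by decide), g7]
    have j5 : s₂.reg 5 = L := by rw [f2.reg 5 (by decide), g1.reg 5 (by decide), h5]
    have j3 : s₂.reg 3 = 1 := by rw [f2.reg 3 (by decide), g1.reg 3 (by decide), e3]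
    refine WP.blk ?_ ⟨?_, ?_, ?_, ⟨rep', huf', ?_, hrep'⟩, ?_⟩
    · simp [okOps, Op.ok, j7, j3]; omega
    · simp only [costOps, Op.cost]; omega
    · simp [runOps, Op.run, j7, j3]
    · simp [runOps, Op.run, j5]
    · simp [runOps, Op.run, h17']
    · exact (f1.trans (f2.mono (by decide) (by simp))).runOps _ (by simp [Op.within])
  · have : extRep N id = id := by funext a; simp [extRep]
    rw [this]
    constructor
    · rintro rfl; exact .refl _
    · intro h
      induction h with
      | rel a b h => obtain ⟨q, hq, -⟩ := h; omega
      | refl => rfl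
      | symm _ _ _ ih => exact ih.symm
      | trans _ _ _ _ _ ih1 ih2 => exact ih1.trans ih2
  · rintro t s' ⟨h1, -, -, ⟨rep, h2, h3, h4⟩, h5⟩
    refine ⟨h1, ⟨rep, h2, h3, fun a ha b hb => ?_⟩, h5⟩
    rw [← h4, extRep, extRep, if_pos ha, if_pos hb]

/-! ### Components of the input graph -/

section Components

variable {n : ℕ} {G : SimpleGraph (Fin n)}

/-- Uniting the two ends of every dart gives the connected components. -/
theorem eqvGen_edges_iff (A : AdjacencyLists G) {X Y : ℕ → ℕ}
    (hX : ∀ u v : Fin n, G.Adj u v → X (pos A u v) = u)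
    (hY : ∀ u v : Fin n, G.Adj u v → Y (pos A u v) = v) (u v : Fin n) :
    Relation.EqvGen (UnitedRel (dg A) X Y (st (dg A) n)) u v ↔ G.Reachable u v := by
  constructor
  · intro h
    have key : ∀ a b, Relation.EqvGen (UnitedRel (dg A) X Y (st (dg A) n)) a b →
        a = b ∨ ∃ u v : Fin n, G.Reachable u v ∧ a = u ∧ b = v := by
      intro a b h
      induction h with
      | rel a b h =>
        obtain ⟨p, hp, hp', rfl, rfl⟩ := h
        obtain ⟨u, v, huv, rfl⟩ := exists_of_own A hp hp'
        exact .inr ⟨u, v, huv.reachable, hX u v huv, hY u v huv⟩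
      | refl => exact .inl rfl
      | symm a b _ ih =>
        rcases ih with rfl | ⟨u, v, h, h1, h2⟩
        · exact .inl rfl
        · exact .inr ⟨v, u, h.symm, h2, h1⟩
      | trans a b c _ _ ih1 ih2 =>
        rcases ih1 with rfl | ⟨u, v, h, h1, h2⟩
        · exact ih2
        · rcases ih2 with rfl | ⟨u', v', h', h1', h2'⟩
          · exact .inr ⟨u, v, h, h1, h2⟩
          · obtain rfl : v = u' := Fin.ext (h2.symm.trans h1')
            exact .inr ⟨u, v', h.trans h', h1, h2'⟩
    rcases key _ _ h with h | ⟨u', v', h1, h2, h3⟩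
    · rw [Fin.ext h]
    · rwa [Fin.ext h2, Fin.ext h3]
  · intro h
    rw [SimpleGraph.reachable_iff_reflTransGen] at h
    induction h with
    | refl => exact .refl _
    | @tail b c _ hbc ih =>
      exact ih.trans _ _ _ (.rel _ _ ⟨pos A b c, pos_lt A hbc, by rw [own_pos A hbc]; omega,
        (hX _ _ hbc).symm, (hY _ _ hbc).symm⟩)

theorem numRoots_components {par sz rep : ℕ → ℕ} (h : UFInv n par sz rep)
    (h1 : ∀ u v : Fin n, rep u = rep v ↔ G.Reachable u v) :
    numRoots n rep = Nat.card G.ConnectedComponent := by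
  rw [numRoots_eq_card_image h]
  let F : G.ConnectedComponent → ℕ :=
    Quot.lift (fun v : Fin n => rep v) fun u v huv => (h1 u v).2 huv
  have hF : F.Injective := by
    rintro ⟨u⟩ ⟨v⟩ huv
    exact Quot.sound ((h1 u v).1 huv)
  rw [← Nat.card_range_of_injective hF, Nat.card_coe_set_eq, ← Set.ncard_coe_finset]
  congr 1
  ext x
  simp only [Finset.coe_image, Set.mem_image, Finset.mem_coe, Finset.mem_range, Set.mem_range]
  constructor
  · rintro ⟨p, hp, rfl⟩; exact ⟨Quot.mk _ ⟨p, hp⟩, rfl⟩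
  · rintro ⟨⟨v⟩, rfl⟩; exact ⟨v, v.2, rfl⟩

/-- Computes the components of the graph, and their number in register `19`. -/
def componentsCmd : Cmd :=
  initForestCmd 1 2 2 ;;
  .blk [.add 7 4 4, .add 17 2 4] ;;
  uniteAllCmd (.blk [.sub 20 15 3, .rd 25 13 7]) 1 2 ;;
  .blk [.add 19 17 4]

theorem wp_components {B U : ℕ} (hU : 16 * B ≤ U) (hB : B = arrLen n) (A : AdjacencyLists G) {s : St}
    (h2 : s.reg 2 = n) (h3 : s.reg 3 = 1) (h4 : s.reg 4 = 0) (h5 : s.reg 5 = st (dg A) n)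
    (hs : ScanArr A (st (dg A) n) s) :
    WP B U componentsCmd s fun t s' => t ≤ 11 * n + st (dg A) n * (60 * (Nat.log 2 n + 1) + 20) + 20 ∧
      s'.reg 19 = Nat.card G.ConnectedComponent ∧
      (∃ rep, UFInv n (s'.arr 1) (s'.arr 2) rep ∧
        ∀ u v : Fin n, rep u = rep v ↔ G.Reachable u v) ∧
      Fr [7, 13, 14, 15, 16, 17, 19, 20, 21, 22, 23, 24, 25, 26, 27, 28, 29] [1, 2] s s' := by
  have hLB := st_le_arrLen A
  rw [← hB] at hLB
  have hBn : n * n + n + 1 = B := hB.symm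
  have hown : ∀ p < st (dg A) n, s.arr 12 p = own (dg A) p := fun p hp => by
    rw [hs.owner, if_pos hp]
  refine WP.seq ((wp_initForest (N := n) hU (by omega) (by norm_num) (by norm_num) (by norm_num)
    (by norm_num) h3 h4 h2 (by omega)).mono ?_)
  rintro t₁ s₁ ⟨ht₁, hu₁, f1⟩
  have e2 : s₁.reg 2 = n := by rw [f1.reg 2 (by decide), h2]
  have e4 : s₁.reg 4 = 0 := by rw [f1.reg 4 (by decide), h4]
  refine WP.seq (WP.blk ?_ ?_)
  · simp [okOps, Op.ok, Op.run, e2, e4]; omega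
  generalize hs₂ : runOps _ s₁ = s₂
  have f2 : Fr [7, 17] [1, 2] s s₂ := by
    subst hs₂; exact (f1.mono (by decide) (by decide)).runOps _ (by decide)
  have g7 : s₂.reg 7 = 0 := by subst hs₂; simp [runOps, Op.run, e4]
  have g17 : s₂.reg 17 = n := by subst hs₂; simp [runOps, Op.run, e4, e2]
  have ga : s₂.arr = s₁.arr := by subst hs₂; rfl
  clear hs₂
  refine WP.seq ((wp_uniteAll (N := n) (L := st (dg A) n) (Kp := 5) (f := dg A)
    (X := fun p => own (dg A) p - 1) (Y := inp A) hU (by omega) hLB (by norm_num) (by norm_num)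
    (by norm_num) (by rw [f2.reg 3 (by decide), h3]) (by rw [f2.reg 4 (by decide), h4])
    (by rw [f2.reg 5 (by decide), h5]) g7 g17
    (fun p hp => by rw [f2.arr 12 (by decide), hown p hp]) ?_ (fun p hp hp' => inp_lt A hp hp')
    (by rw [ga]; exact hu₁) ?_).mono ?_)
  · intro p hp hp'
    obtain ⟨u, v, huv, rfl⟩ := exists_of_own A hp hp'
    rw [own_pos A huv]
    have := u.2
    omega
  · intro p hp hp' s' hf h7 h15
    have k3 : s'.reg 3 = 1 := by rw [hf.reg 3 (by decide), f2.reg 3 (by decide), h3]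
    have k13 : s'.arr 13 p = inp A p := by
      rw [hf.arr 13 (by decide), f2.arr 13 (by decide), hs.cand, if_pos ⟨hp, hp'⟩]
    refine WP.blk ?_ ⟨by simp [costOps, Op.cost], ?_, ?_, (Fr.refl _ _ _).runOps _ (by decide)⟩
    · simp [okOps, Op.ok, Op.run, h7]; omega
    · simp [runOps, Op.run, h15, k3]
    · simp [runOps, Op.run, h7, k13]
  · rintro t₃ s₃ ⟨ht₃, ⟨rep, hu, h17, hrep⟩, f3⟩
    have hrep' : ∀ u v : Fin n, rep u = rep v ↔ G.Reachable u v := fun u v => by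
      rw [hrep u u.2 v v.2]
      refine eqvGen_edges_iff A (fun u v huv => ?_) (fun u v huv => (holds_inp A).apply_pos huv) u v
      rw [own_pos A huv, Nat.add_sub_cancel]
    have k4 : s₃.reg 4 = 0 := by rw [f3.reg 4 (by decide), f2.reg 4 (by decide), h4]
    have hle : numRoots n rep ≤ n := (Finset.card_filter_le _ _).trans_eq (Finset.card_range n)
    refine WP.blk ?_ ⟨?_, ?_, ⟨rep, hu, hrep'⟩, ?_⟩
    · simp [okOps, Op.ok, h17, k4]; omega
    · simp only [costOps, Op.cost]
      have : st (dg A) n * (5 + 60 * (Nat.log 2 n + 1) + 12) ≤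
        st (dg A) n * (60 * (Nat.log 2 n + 1) + 20) := Nat.mul_le_mul_left _ (by omega)
      omega
    · simp [runOps, Op.run, h17, k4, numRoots_components hu hrep']
    · exact ((f2.mono (by decide) (by decide)).trans (f3.mono (by decide) (by decide))).runOps _
        (by decide)

end Components

/-! ### Testing a candidate rotation system -/

section Test

variable {n : ℕ} {G : SimpleGraph (Fin n)}

/-- The data about the input that remain fixed. -/
structure Env (A : AdjacencyLists G) (s : St) : Prop where
  r2 : s.reg 2 = n
  r3 : s.reg 3 = 1
  r4 : s.reg 4 = 0
  r5 : s.reg 5 = st (dg A) n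
  input : s.arr 0 = inp A
  start : ∀ v < n, s.arr 11 v = st (dg A) v
  owner : ∀ p < st (dg A) n, s.arr 12 p = own (dg A) p
  adj : ∀ i, s.arr 6 i ≠ 0 ↔ ∃ q < st (dg A) n, own (dg A) q ≠ 0 ∧ i = key (dg A) (inp A) n q

theorem Env.fr {A : AdjacencyLists G} {s s' : St} (h : Env A s) {R K : List ℕ} (hf : Fr R K s s')
    (hR : 2 ∉ R ∧ 3 ∉ R ∧ 4 ∉ R ∧ 5 ∉ R) (hK : 0 ∉ K ∧ 11 ∉ K ∧ 12 ∉ K ∧ 6 ∉ K) : Env A s' :=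
  ⟨by rw [hf.reg 2 hR.1, h.r2], by rw [hf.reg 3 hR.2.1, h.r3], by rw [hf.reg 4 hR.2.2.1, h.r4],
    by rw [hf.reg 5 hR.2.2.2, h.r5], by rw [hf.arr 0 hK.1, h.input],
    by rw [hf.arr 11 hK.2.1]; exact h.start, by rw [hf.arr 12 hK.2.2.1]; exact h.owner,
    by rw [hf.arr 6 hK.2.2.2]; exact h.adj⟩

theorem Env.adj_iff {A : AdjacencyLists G} {s : St} (h : Env A s) (u v : Fin n) :
    s.arr 6 (u * n + v) ≠ 0 ↔ G.Adj u v := by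
  rw [h.adj]
  constructor
  · rintro ⟨q, hq, hq', he⟩
    obtain ⟨u', v', huv, rfl⟩ := exists_of_own A hq hq'
    rw [(holds_inp A).key_pos huv] at he
    obtain ⟨h1, h2⟩ := mul_add_inj v.2 v'.2 he
    rwa [Fin.ext h1, Fin.ext h2]
  · intro huv
    exact ⟨pos A u v, pos_lt A huv, by rw [own_pos A huv]; omega,
      ((holds_inp A).key_pos huv).symm⟩

/-- Runs through all positions that hold darts, with the owner in register `15`. -/
def forDartsCmd (c : Cmd) : Cmd :=
  .blk [.add 7 4 4] ;;
  .loop 7 5 (.blk [.rd 15 12 7] ;; .ite 4 15 c (.blk []) ;; .blk [.add 7 7 3])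

/-- The rule for a loop over dart positions, with invariant `I i` before position `i`. Positions that
do not hold a dart are skipped (`hskip`); `R` and `Ka` are the registers and arrays that the body
may change. -/
theorem wp_forDarts {B U K : ℕ} {R Ka : List ℕ} {c : Cmd} (hU : 16 * B ≤ U) (hB : B = arrLen n)
    (A : AdjacencyLists G) {s : St} (hs : Env A s) (I : ℕ → St → Prop)
    (hR : 2 ∉ R ∧ 3 ∉ R ∧ 4 ∉ R ∧ 5 ∉ R) (hK : 0 ∉ Ka ∧ 11 ∉ Ka ∧ 12 ∉ Ka ∧ 6 ∉ Ka) (hR7 : 7 ∉ R)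
    (hIfr : ∀ i s s', Fr [7, 15] [] s s' → I i s → I i s')
    (hskip : ∀ i s, i < st (dg A) n → own (dg A) i = 0 → I i s → I (i + 1) s)
    (hI : ∀ p s', p < st (dg A) n → own (dg A) p ≠ 0 → Env A s' → Fr (7 :: 15 :: R) Ka s s' →
      s'.reg 7 = p → s'.reg 15 = own (dg A) p → I p s' →
      WP B U c s' fun t s'' => t ≤ K ∧ I (p + 1) s'' ∧ Fr R Ka s' s'')
    (h0 : I 0 s) :
    WP B U (forDartsCmd c) s fun t s' => t ≤ st (dg A) n * (K + 10) + 3 ∧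
      I (st (dg A) n) s' ∧ Fr (7 :: 15 :: R) Ka s s' := by
  have hLB := st_le_arrLen A
  rw [← hB] at hLB
  have hB0 : 0 < B := by rw [hB, arrLen]; omega
  refine WP.seq (WP.blk ?_ ?_)
  · simp [okOps, Op.ok, hs.r4]; omega
  generalize hs₁ : runOps _ s = s₁
  have g1 : Fr [7, 15] [] s s₁ := by
    subst hs₁; exact (Fr.refl _ _ _).runOps _ (by decide)
  have g7 : s₁.reg 7 = 0 := by subst hs₁; simp [runOps, Op.run, hs.r4]
  clear hs₁
  have f1 : Fr (7 :: 15 :: R) Ka s s₁ := g1.mono (by simp) (by simp)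
  have e1 := hs.fr g1 (by decide) (by decide)
  refine (WP.for (st (dg A) n) (K + 8) (fun i s' => I i s' ∧ Fr (7 :: 15 :: R) Ka s s')
    ?_ (Nat.zero_le _) g7 e1.r5 ⟨hIfr _ _ _ g1 h0, f1⟩).mono ?_
  · rintro p s' hp h7 h5 ⟨hIp, hf⟩
    have e' := hs.fr hf (by simp [hR]) (by simp [hK])
    refine WP.seq (WP.blk ?_ ?_)
    · simp [okOps, Op.ok, h7]; omega
    generalize hs₂ : runOps _ s' = s₂
    have g2 : Fr [7, 15] [] s' s₂ := by
      subst hs₂; exact (Fr.refl _ _ _).runOps _ (by decide)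
    have g15 : s₂.reg 15 = own (dg A) p := by
      subst hs₂; simp [runOps, Op.run, h7, e'.owner p hp]
    have g7' : s₂.reg 7 = p := by subst hs₂; simp [runOps, Op.run, h7]
    clear hs₂
    have f2 : Fr (7 :: 15 :: R) Ka s s₂ := hf.trans (g2.mono (by simp) (by simp))
    have e2 := hs.fr f2 (by simp [hR]) (by simp [hK])
    have hI2 := hIfr _ _ _ g2 hIp
    refine WP.seq (WP.mono (Q := fun t s₃ => t ≤ K + 2 ∧ I (p + 1) s₃ ∧ Fr R Ka s₂ s₃) ?_ ?_)
    · refine WP.ite (fun hlt => ?_) (fun hlt => ?_)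
      · rw [e2.r4, g15] at hlt
        refine (hI p s₂ hp hlt.ne' e2 f2 g7' g15 hI2).mono ?_
        rintro t s₃ ⟨h1, h2, h3⟩
        exact ⟨by omega, h2, h3⟩
      · rw [e2.r4, g15] at hlt
        exact WP.blk trivial ⟨by simp [costOps], hskip p s₂ hp (by omega) hI2, .refl _ _ _⟩
    rintro t₃ s₃ ⟨ht₃, hI3, f3⟩
    have e3 := e2.fr f3 hR hK
    have g7'' : s₃.reg 7 = p := by rw [f3.reg 7 hR7, g7']
    have g4 : Fr [7, 15] [] s₃ (runOps [.add 7 7 3] s₃) := (Fr.refl _ _ _).runOps _ (by decide)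
    refine WP.blk ?_ ⟨?_, ?_, ?_, hIfr _ _ _ g4 hI3,
      f2.trans ((f3.mono (by intro x hx; simp [hx]) (by simp)).trans (g4.mono (by simp) (by simp)))⟩
    · simp [okOps, Op.ok, g7'', e3.r3]; omega
    · simp only [costOps, Op.cost]; omega
    · simp [runOps, Op.run, g7'', e3.r3]
    · simp [runOps, Op.run, e3.r5]
  · rintro t s' ⟨h1, -, -, h2, h3⟩
    refine ⟨?_, h2, h3⟩
    simp only [costOps, Op.cost]
    rw [Nat.sub_zero, show K + 8 + 2 = K + 10 from rfl] at h1
    omega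

/-- Computes the index `key` of the dart at the position in register `7`. -/
def keyOps : List Op := [.sub 16 15 3, .mul 14 16 2, .rd 13 13 7, .add 14 14 13]

theorem keyOps_spec {B U p : ℕ} (hU : 16 * B ≤ U) (hB : B = arrLen n) {A : AdjacencyLists G}
    {s : St} {c : ℕ → ℕ} (hs : Env A s) (hp : p < st (dg A) n) (hown : own (dg A) p ≠ 0)
    (h7 : s.reg 7 = p) (h15 : s.reg 15 = own (dg A) p)
    (hc : s.arr 13 p = c p) (hcn : c p < n) :
    okOps B U keyOps s ∧ (runOps keyOps s).reg 14 = key (dg A) c n p ∧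
      Fr [13, 14, 16] [] s (runOps keyOps s) ∧ key (dg A) c n p < n * n := by
  have hLB := st_le_arrLen A
  rw [← hB] at hLB
  have hBn : n * n + n + 1 = B := hB.symm
  obtain ⟨v, h1, -⟩ := exists_of_own_ne_zero hown
  have hv := lt_of_own h1 hp
  have h2 := mul_add_lt hv hcn
  have h3 : key (dg A) c n p = v * n + c p := by rw [key, h1, Nat.add_sub_cancel]
  refine ⟨?_, ?_, (Fr.refl _ _ _).runOps _ (by decide), by rw [h3]; exact h2⟩
  · simp [okOps, Op.ok, Op.run, keyOps, h7, h15, hs.r3, hs.r2, hc, h1]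
    omega
  · simp [runOps, Op.run, keyOps, h7, h15, hs.r3, hs.r2, hc, h1, h3]

/-- Stores the positions of the darts in the table of array `5`. -/
def fillCmd : Cmd :=
  forDartsCmd (.blk keyOps ;; .blk [.rd 16 6 14] ;; .ite 4 16 (.blk [.wr 5 14 7]) (.blk []))

/-- An entry of the table written several times holds the last position with that key; the statement
only claims that it holds some position with that key. Entries off the adjacency matrix are never
written, so the table is clean for the next candidate. -/
theorem wp_fill {B U : ℕ} (hU : 16 * B ≤ U) (hB : B = arrLen n) (A : AdjacencyLists G) {s : St}
    {c : ℕ → ℕ} (hs : Env A s) (hc : s.arr 13 = c)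
    (hcn : ∀ p < st (dg A) n, own (dg A) p ≠ 0 → c p < n)
    (hT : ∀ i, s.arr 5 i ≠ 0 → s.arr 6 i ≠ 0) :
    WP B U fillCmd s fun t s' => t ≤ st (dg A) n * 30 + 3 ∧
      (∀ i, s'.arr 5 i ≠ 0 → s.arr 6 i ≠ 0) ∧
      (∀ p < st (dg A) n, own (dg A) p ≠ 0 → s.arr 6 (key (dg A) c n p) ≠ 0 →
        ∃ q < st (dg A) n, own (dg A) q ≠ 0 ∧ key (dg A) c n q = key (dg A) c n p ∧
          s'.arr 5 (key (dg A) c n p) = q) ∧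
      Fr [7, 15, 13, 14, 16] [5] s s' := by
  have hBn : n * n + n + 1 = B := hB.symm
  refine (wp_forDarts (R := [13, 14, 16]) (Ka := [5]) (K := 20) hU hB A hs (fun i s' =>
    (∀ i, s'.arr 5 i ≠ 0 → s.arr 6 i ≠ 0) ∧
      (∀ p < i, own (dg A) p ≠ 0 → s.arr 6 (key (dg A) c n p) ≠ 0 →
        ∃ q < st (dg A) n, own (dg A) q ≠ 0 ∧ key (dg A) c n q = key (dg A) c n p ∧
          s'.arr 5 (key (dg A) c n p) = q)) (by decide) (by decide) (by decide) ?_ ?_ ?_ ?_).mono ?_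
  · rintro i s₁ s₂ hf h
    rwa [hf.arr 5 (by decide)]
  · rintro i s₁ hi ho ⟨h1, h2⟩
    refine ⟨h1, fun p hp hp' => h2 p ?_ hp'⟩
    rcases Nat.lt_succ_iff_lt_or_eq.1 hp with h | rfl
    · exact h
    · exact absurd ho hp'
  · rintro p s' hp hown he hf h7 h15 ⟨h1, h2⟩
    have h13 : s'.arr 13 p = c p := by rw [hf.arr 13 (by decide), hc]
    obtain ⟨k1, k2, k3, k4⟩ := keyOps_spec hU hB he hp hown h7 h15 h13 (hcn p hp hown)
    refine WP.seq (WP.blk k1 ?_)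
    generalize hs₁ : runOps keyOps s' = s₁ at *
    have e1 := he.fr k3 (by decide) (by decide)
    have a6 : ∀ i, s₁.arr 6 i = s.arr 6 i := fun i => by
      rw [k3.arr 6 (by decide), hf.arr 6 (by decide)]
    have a5 : s₁.arr 5 = s'.arr 5 := k3.arr 5 (by decide)
    have r7 : s₁.reg 7 = p := by rw [k3.reg 7 (by decide), h7]
    refine WP.seq (WP.blk ?_ (WP.ite (fun hlt => WP.blk ?_ ⟨?_, ⟨?_, ?_⟩, ?_⟩)
      (fun hlt => WP.blk trivial ⟨?_, ⟨?_, ?_⟩, ?_⟩)))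
    · simp [okOps, Op.ok, k2]; omega
    · simp [okOps, runOps, Op.run, Op.ok, k2]; omega
    · simp [costOps, Op.cost, keyOps]
    · simp [runOps, Op.run, k2, a6, r7, a5, e1.r4] at hlt ⊢
      intro i
      rw [Function.update_apply]
      split_ifs with h3
      · intro _; rw [h3]; omega
      · exact h1 i
    · simp [runOps, Op.run, k2, a6, r7, a5, e1.r4] at hlt ⊢
      intro q hq hq' hadj
      rw [Function.update_apply]
      split_ifs with h3
      · exact ⟨hp, hown, h3.symm⟩
      · rcases Nat.lt_or_eq_of_le hq with h | rfl
        · obtain ⟨q', h4, h5, h6, h7⟩ := h2 q h hq' hadj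
          rw [h7]; exact ⟨h4, h5, h6⟩
        · exact absurd rfl h3
    · refine ((k3.mono ?_ ?_).runOps _ ?_).runOps _ ?_ <;> simp [Op.within]
    · simp [costOps, Op.cost, keyOps]
    · simp [runOps, Op.run, a5]
      intro i; exact h1 i
    · simp only [runOps, Op.run, k2, a6] at hlt ⊢
      simp [e1.r4] at hlt
      intro q hq hq' hadj
      rw [a5]
      rcases Nat.lt_succ_iff_lt_or_eq.1 hq with h | rfl
      · exact h2 q h hq' hadj
      · exact absurd hlt hadj
    · refine ((k3.mono ?_ ?_).runOps _ ?_).runOps _ ?_ <;> simp [Op.within]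
  · exact ⟨hT, fun p hp => absurd hp (by omega)⟩
  · rintro t s' ⟨h1, ⟨h2, h3⟩, h4⟩
    exact ⟨h1, h2, h3, h4⟩

/-- Register `30` tells whether some position is not found in the table. -/
def checkCmd : Cmd :=
  .blk [.const 30 0] ;;
  forDartsCmd (.blk keyOps ;; .blk [.rd 16 5 14, .sub 22 16 7, .sub 23 7 16, .add 24 22 23] ;;
    .ite 4 24 (.blk [.const 30 1]) (.blk []))

/-- If each position is found in the table under its own key, then keys of different positions differ.
So register `30` is zero exactly when the candidate lists every dart once. -/
theorem wp_check {B U : ℕ} (hU : 16 * B ≤ U) (hB : B = arrLen n) (A : AdjacencyLists G) {s : St}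
    {c : ℕ → ℕ} (hs : Env A s) (hc : s.arr 13 = c)
    (hcn : ∀ p < st (dg A) n, own (dg A) p ≠ 0 → c p < n)
    (hT : ∀ p < st (dg A) n, own (dg A) p ≠ 0 → s.arr 5 (key (dg A) c n p) < st (dg A) n) :
    WP B U checkCmd s fun t s' => t ≤ st (dg A) n * 30 + 4 ∧
      (s'.reg 30 = 0 ↔ ∀ p < st (dg A) n, own (dg A) p ≠ 0 → s.arr 5 (key (dg A) c n p) = p) ∧
      Fr [7, 15, 13, 14, 16, 22, 23, 24, 30] [] s s' := by
  have hBn : n * n + n + 1 = B := hB.symm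
  have hLB := st_le_arrLen A
  rw [← hB] at hLB
  refine WP.seq (WP.blk (by simp [okOps, Op.ok]) ?_)
  have f0 : Fr [30] [] s (runOps [.const 30 0] s) := (Fr.refl _ _ _).runOps _ (by decide)
  refine (wp_forDarts (R := [13, 14, 16, 22, 23, 24, 30]) (Ka := []) (K := 20) hU hB A
    (hs.fr f0 (by decide) (by decide)) (fun i s' =>
      (s'.reg 30 = 0 ↔ ∀ p < i, own (dg A) p ≠ 0 → s.arr 5 (key (dg A) c n p) = p))
    (by decide) (by decide) (by decide) ?_ ?_ ?_ ?_).mono ?_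
  · rintro i s₁ s₂ hf h
    rwa [hf.reg 30 (by decide)]
  · rintro i s₁ hi ho h1
    rw [h1]
    constructor
    · intro h2 p hp hp'
      rcases Nat.lt_succ_iff_lt_or_eq.1 hp with h | rfl
      · exact h2 p h hp'
      · exact absurd ho hp'
    · intro h2 p hp hp'; exact h2 p (by omega) hp'
  · rintro p s' hp hown he hf h7 h15 h1
    have hf := (f0.mono (R' := [7, 15, 13, 14, 16, 22, 23, 24, 30]) (by decide) (by decide)).trans hf
    have h13 : s'.arr 13 p = c p := by rw [hf.arr 13 (by decide), hc]
    obtain ⟨k1, k2, k3, k4⟩ := keyOps_spec hU hB he hp hown h7 h15 h13 (hcn p hp hown)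
    refine WP.seq (WP.blk k1 ?_)
    generalize hs₁ : runOps keyOps s' = s₁ at *
    have e1 := he.fr k3 (by decide) (by decide)
    have a5 : s₁.arr 5 = s.arr 5 := by rw [k3.arr 5 (by decide), hf.arr 5 (by decide)]
    have r7 : s₁.reg 7 = p := by rw [k3.reg 7 (by decide), h7]
    have r30 : s₁.reg 30 = s'.reg 30 := k3.reg 30 (by decide)
    have hT' := hT p hp hown
    have hiff : (∀ q < p + 1, own (dg A) q ≠ 0 → s.arr 5 (key (dg A) c n q) = q) ↔
        s'.reg 30 = 0 ∧ s.arr 5 (key (dg A) c n p) = p := by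
      rw [h1]
      constructor
      · intro h; exact ⟨fun q hq => h q (by omega), h p (by omega) hown⟩
      · rintro ⟨h2, h3⟩ q hq hq'
        rcases Nat.lt_succ_iff_lt_or_eq.1 hq with h | rfl
        · exact h2 q h hq'
        · exact h3
    refine WP.seq (WP.blk ?_ (WP.ite (fun hlt => WP.blk ?_ ⟨?_, ?_, ?_⟩)
      (fun hlt => WP.blk trivial ⟨?_, ?_, ?_⟩)))
    · simp [okOps, Op.ok, Op.run, k2, a5, r7]
      omega
    · simp [okOps, Op.ok]
    · simp [costOps, Op.cost, keyOps]
    · simp [runOps, Op.run, k2, r7, a5, e1.r4] at hlt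
      rw [hiff]
      simp [runOps, Op.run]
      omega
    · refine ((k3.mono ?_ ?_).runOps _ ?_).runOps _ ?_ <;> simp [Op.within]
    · simp [costOps, Op.cost, keyOps]
    · simp [runOps, Op.run, k2, r7, a5, e1.r4] at hlt
      rw [hiff]
      simp [runOps, Op.run, r30]
      omega
    · refine ((k3.mono ?_ ?_).runOps _ ?_).runOps _ ?_ <;> simp [Op.within]
  · simp [runOps, Op.run]
  · rintro t s' ⟨h1, h2, h3⟩
    refine ⟨?_, h2, (f0.mono (by decide) (by decide)).trans h3⟩
    simp only [costOps, Op.cost]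
    omega

end Test

/-! ### Counting faces -/

section Faces

variable {n : ℕ} {G : SimpleGraph (Fin n)}

/-- The table in array `5` holds the positions of the darts of the graph `H`, and `0` for all other
pairs of vertices. -/
def Table (A : AdjacencyLists G) (H : SimpleGraph (Fin n)) (T : ℕ → ℕ) : Prop :=
  ∀ u v : Fin n, (H.Adj u v → T (u * n + v) = pos A u v) ∧ (¬ H.Adj u v → T (u * n + v) = 0)

/-- The position that follows `p` on its face, in terms of the table `T` of positions. -/
noncomputable def nextPos (f c T : ℕ → ℕ) (n p : ℕ) : ℕ :=
  if T (c p * n + (own f p - 1)) < st f (c p) + f (c p) then T (c p * n + (own f p - 1)) + 1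
  else st f (c p) + 1

/-- Read off the arrays, the position after the dart `vu` in the list of `v`, cyclically, is the
position of the face successor of the dart `uv`. -/
theorem nextPos_pos {A : AdjacencyLists G} {c T : ℕ → ℕ} (hc : Holds A c) (hT : Table A G T)
    (d : G.Dart) : nextPos (dg A) c T n (pos A d.fst d.snd) =
      pos A (A.faceNext d).fst (A.faceNext d).snd := by
  rw [pos_faceNext, nextPos, hc.apply_pos d.adj, own_pos A d.adj, Nat.add_sub_cancel,
    (hT d.snd d.fst).1 d.adj.symm]

/-- Computes `nextPos` of the position in register `7`. -/
def nextPosCmd : Cmd :=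
  .blk [.sub 16 15 3, .rd 13 13 7, .mul 14 13 2, .add 14 14 16, .rd 14 5 14, .rd 16 0 7,
    .rd 13 11 13, .rd 16 0 13, .add 16 13 16, .add 20 7 4] ;;
  .ite 14 16 (.blk [.add 25 14 3]) (.blk [.add 25 13 3])

theorem wp_nextPos {B U p : ℕ} (hU : 16 * B ≤ U) (hB : B = arrLen n) {A : AdjacencyLists G}
    {s : St} {c T : ℕ → ℕ} (hs : Env A s) (hp : p < st (dg A) n) (hown : own (dg A) p ≠ 0)
    (h7 : s.reg 7 = p) (h15 : s.reg 15 = own (dg A) p) (h13 : s.arr 13 = c) (hcn : c p < n)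
    (h5 : s.arr 5 = T) (hT : T (c p * n + (own (dg A) p - 1)) < st (dg A) n) :
    WP B U nextPosCmd s fun t s' => t ≤ 40 ∧ s'.reg 20 = p ∧
      s'.reg 25 = nextPos (dg A) c T n p ∧ Fr [13, 14, 16, 20, 25] [] s s' := by
  have hLB := st_le_arrLen A
  rw [← hB] at hLB
  have hBn : n * n + n + 1 = B := hB.symm
  obtain ⟨v, h1, -⟩ := exists_of_own_ne_zero hown
  have hv := lt_of_own h1 hp
  have h2 := mul_add_lt hcn hv
  have hst := hs.start _ hcn
  have hin : inp A (st (dg A) (c p)) = dg A (c p) := inp_st A hcn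
  have hlt : st (dg A) (c p) + dg A (c p) < st (dg A) n := st_lt _ hcn le_rfl
  rw [h1, Nat.add_sub_cancel] at hT
  have hok : okOps B U [.sub 16 15 3, .rd 13 13 7, .mul 14 13 2, .add 14 14 16, .rd 14 5 14,
      .rd 16 0 7, .rd 13 11 13, .rd 16 0 13, .add 16 13 16, .add 20 7 4] s := by
    simp [okOps, Op.ok, Op.run, h7, h15, hs.r3, hs.r2, hs.r4, h13, h5, h1, hs.input, hst, hin]
    omega
  refine WP.seq (WP.blk hok ?_)
  generalize hs₁ : runOps _ s = s₁
  have f1 : Fr [13, 14, 16, 20, 25] [] s s₁ := by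
    subst hs₁; exact (Fr.refl _ _ _).runOps _ (by decide)
  have g14 : s₁.reg 14 = T (c p * n + v) := by
    subst hs₁; simp [runOps, Op.run, h7, h15, hs.r3, hs.r2, h13, h5, h1]
  have g13 : s₁.reg 13 = st (dg A) (c p) := by
    subst hs₁; simp [runOps, Op.run, h7, h13, hst]
  have g16 : s₁.reg 16 = st (dg A) (c p) + dg A (c p) := by
    subst hs₁; simp [runOps, Op.run, h7, h13, hst, hs.input, hin]
  have g20 : s₁.reg 20 = p := by subst hs₁; simp [runOps, Op.run, h7, hs.r4]
  have g3 : s₁.reg 3 = 1 := by rw [f1.reg 3 (by decide), hs.r3]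
  clear hs₁ hok
  refine WP.ite (fun hl => WP.blk ?_ ⟨by simp [costOps, Op.cost], ?_, ?_, f1.runOps _ (by decide)⟩)
    (fun hl => WP.blk ?_ ⟨by simp [costOps, Op.cost], ?_, ?_, f1.runOps _ (by decide)⟩)
  · simp [okOps, Op.ok, g14, g3]; omega
  · simp [runOps, Op.run, g20]
  · rw [g14, g16] at hl
    simp [runOps, Op.run, g14, g3, nextPos, h1, hl]
  · simp [okOps, Op.ok, g13, g3]; omega
  · simp [runOps, Op.run, g20]
  · rw [g14, g16] at hl
    simp [runOps, Op.run, g13, g3, nextPos, h1, hl]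

/-- The union-find forest in the arrays `3` and `4` represents the faces of the current graph `H`,
in terms of the positions of the darts of `G`. -/
def Faces (A : AdjacencyLists G) (H : SimpleGraph (Fin n)) (par sz : ℕ → ℕ) : Prop :=
  ∃ rep, UFInv (st (dg A) n) par sz rep ∧ ∀ d e : G.Dart,
    rep (pos A d.fst d.snd) = rep (pos A e.fst e.snd) ↔ Relation.EqvGen (dualStep A H) d e

/-- Unites the darts of every face and counts the classes in register `17`. -/
def facesCmd : Cmd :=
  initForestCmd 3 4 5 ;; .blk [.add 7 4 4, .add 17 5 4] ;; uniteAllCmd nextPosCmd 3 4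

theorem nextPos_spec (A : AdjacencyLists G) {A' : AdjacencyLists G} {c T : ℕ → ℕ}
    (hc : Holds A' c) (hT : Table A' G T) {p : ℕ} (hp : p < st (dg A) n)
    (hp' : own (dg A) p ≠ 0) :
    ∃ d : G.Dart, p = pos A' d.fst d.snd ∧
      nextPos (dg A) c T n p = pos A' (A'.faceNext d).fst (A'.faceNext d).snd := by
  rw [← dg_eq A A'] at hp hp' ⊢
  obtain ⟨u, v, huv, h⟩ := exists_of_own A' hp hp'
  refine ⟨⟨(u, v), huv⟩, h, ?_⟩
  rw [h]
  exact nextPos_pos hc hT ⟨(u, v), huv⟩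

/-- The relation by which `facesCmd` unites positions is face tracing. -/
theorem unitedRel_faces (A : AdjacencyLists G) {A' : AdjacencyLists G} {c T : ℕ → ℕ}
    (hc : Holds A' c) (hT : Table A' G T) (a b : ℕ) :
    UnitedRel (dg A) (fun p => p) (nextPos (dg A) c T n) (st (dg A) n) a b ↔
      ∃ d e : G.Dart, A'.faceNext d = e ∧ a = pos A' d.fst d.snd ∧ b = pos A' e.fst e.snd := by
  constructor
  · rintro ⟨p, hp, hp', rfl, rfl⟩
    obtain ⟨d, h1, h2⟩ := nextPos_spec A hc hT hp hp'
    exact ⟨d, _, rfl, h1, h2⟩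
  · rintro ⟨d, e, rfl, rfl, rfl⟩
    rw [← dg_eq A A']
    exact ⟨_, pos_lt A' d.adj, by rw [own_pos A' d.adj]; omega, rfl, (nextPos_pos hc hT d).symm⟩

theorem eq_of_eqvGen_unitedRel (A : AdjacencyLists G) {A' : AdjacencyLists G} {c T : ℕ → ℕ}
    (hc : Holds A' c) (hT : Table A' G T) {p q : ℕ} (h0 : own (dg A) p = 0)
    (h : Relation.EqvGen
      (UnitedRel (dg A) (fun p => p) (nextPos (dg A) c T n) (st (dg A) n)) p q) : p = q := by
  have key : ∀ a b, Relation.EqvGen (UnitedRel (dg A) (fun p => p)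
      (nextPos (dg A) c T n) (st (dg A) n)) a b →
      a = b ∨ own (dg A) a ≠ 0 ∧ own (dg A) b ≠ 0 := by
    intro a b h
    induction h with
    | rel a b h =>
      obtain ⟨d, e, -, rfl, rfl⟩ := (unitedRel_faces A hc hT a b).1 h
      rw [← dg_eq A A', own_pos A' d.adj, own_pos A' e.adj]
      exact .inr ⟨by omega, by omega⟩
    | refl => exact .inl rfl
    | symm _ _ _ ih => exact ih.imp Eq.symm And.symm
    | trans _ _ _ _ _ ih1 ih2 =>
      rcases ih1 with rfl | h1
      · exact ih2
      · rcases ih2 with rfl | h2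
        · exact .inr h1
        · exact .inr ⟨h1.1, h2.2⟩
  exact (key p q h).resolve_right fun h => h.1 h0

theorem wp_faces {B U : ℕ} (hU : 16 * B ≤ U) (hB : B = arrLen n) {A A' : AdjacencyLists G}
    {s : St} {c : ℕ → ℕ} (hs : Env A s) (h13 : s.arr 13 = c) (hc : Holds A' c)
    (hT : Table A' G (s.arr 5)) :
    WP B U facesCmd s fun t s' =>
      t ≤ 11 * st (dg A) n + st (dg A) n * (60 * (Nat.log 2 (st (dg A) n) + 1) + 60) + 10 ∧
      s'.reg 17 = Nat.card (Quot fun d e : G.Dart => A'.faceNext d = e) + (n + 1) ∧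
      s'.reg 17 ≤ st (dg A) n ∧ Faces A' G (s'.arr 3) (s'.arr 4) ∧
      Fr [7, 13, 14, 15, 16, 17, 20, 21, 22, 23, 24, 25, 26, 27, 28, 29] [3, 4] s s' := by
  have hLB := st_le_arrLen A
  rw [← hB] at hLB
  have hBn : n * n + n + 1 = B := hB.symm
  have hd := dg_eq A A'
  refine WP.seq ((wp_initForest (N := st (dg A) n) hU hLB (by norm_num) (by norm_num) (by norm_num)
    (by norm_num) hs.r3 hs.r4 hs.r5 (by omega)).mono ?_)
  rintro t₁ s₁ ⟨ht₁, hu₁, f1⟩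
  have e1 := hs.fr f1 (by decide) (by decide)
  refine WP.seq (WP.blk ?_ ?_)
  · simp [okOps, Op.ok, Op.run, e1.r4, e1.r5]; omega
  generalize hs₂ : runOps _ s₁ = s₂
  have f2 : Fr [7, 17] [3, 4] s s₂ := by
    subst hs₂; exact (f1.mono (by decide) (by decide)).runOps _ (by decide)
  have e2 := hs.fr f2 (by decide) (by decide)
  have g7 : s₂.reg 7 = 0 := by subst hs₂; simp [runOps, Op.run, e1.r4]
  have g17 : s₂.reg 17 = st (dg A) n := by subst hs₂; simp [runOps, Op.run, e1.r4, e1.r5]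
  have ga : s₂.arr = s₁.arr := by subst hs₂; rfl
  clear hs₂
  refine (wp_uniteAll (N := st (dg A) n) (L := st (dg A) n) (Kp := 40) (f := dg A)
    (X := fun p => p) (Y := nextPos (dg A) c (s.arr 5) n) hU hLB hLB (by norm_num) (by norm_num)
    (by norm_num) e2.r3 e2.r4 e2.r5 g7 g17 e2.owner (fun p hp _ => hp) ?_
    (by rw [ga]; exact hu₁) ?_).mono ?_
  · intro p hp hp'
    obtain ⟨d, -, h2⟩ := nextPos_spec A hc hT hp hp'
    rw [h2, ← hd]
    exact pos_lt A' (A'.faceNext d).adj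
  · intro p hp hp' s' hf h7 h15
    have hcp : c p < n ∧ s.arr 5 (c p * n + (own (dg A) p - 1)) < st (dg A) n := by
      rw [← hd] at hp hp' ⊢
      obtain ⟨u, v, huv, rfl⟩ := exists_of_own A' hp hp'
      rw [hc.apply_pos huv, own_pos A' huv, Nat.add_sub_cancel, (hT v u).1 huv.symm]
      exact ⟨v.2, pos_lt A' huv.symm⟩
    exact wp_nextPos hU hB (e2.fr hf (by decide) (by decide)) hp hp' h7 h15
      (by rw [hf.arr 13 (by decide), f2.arr 13 (by decide), h13])
      hcp.1 (by rw [hf.arr 5 (by decide), f2.arr 5 (by decide)]) hcp.2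
  · rintro t₃ s₃ ⟨ht₃, ⟨rep, hu, h17, hrep⟩, f3⟩
    have hrep' : ∀ d e : G.Dart, rep (pos A' d.fst d.snd) = rep (pos A' e.fst e.snd) ↔
        Relation.EqvGen (fun d e : G.Dart => A'.faceNext d = e) d e := fun d e => by
      rw [hrep _ (by rw [← hd]; exact pos_lt A' d.adj) _ (by rw [← hd]; exact pos_lt A' e.adj),
        eqvGen_pos_iff A' (unitedRel_faces A hc hT)]
    have hst : (fun d e : G.Dart => A'.faceNext d = e) = dualStep A' G := by
      funext d e; simp [dualStep, d.adj]
    have hroots := numRoots_faces A' (hd ▸ hu) hrep' (fun p hp q hq h0 h => by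
      rw [hd] at hp hq h0
      rw [hrep p hp q hq] at h
      exact eq_of_eqvGen_unitedRel A hc hT h0 h)
    rw [hd] at hroots
    refine ⟨?_, by rw [h17, hroots], ?_, ⟨rep, hd ▸ hu, fun d e => ?_⟩,
      (f2.mono (by decide) (by decide)).trans (f3.mono (by decide) (by decide))⟩
    · simp only [costOps, Op.cost]
      have : st (dg A) n * (40 + 60 * (Nat.log 2 (st (dg A) n) + 1) + 12) ≤
        st (dg A) n * (60 * (Nat.log 2 (st (dg A) n) + 1) + 60) :=
        Nat.mul_le_mul_left _ (by omega)
      omega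
    · rw [h17]
      exact (Finset.card_filter_le _ _).trans_eq (Finset.card_range _)
    · rw [hrep', hst]

theorem Holds.unique {A A' : AdjacencyLists G} {c : ℕ → ℕ} (h : Holds A c) (h' : Holds A' c) :
    A' = A := by
  have key : A'.nbrs = A.nbrs := by
    funext v
    refine List.ext_getElem (length_nbrs_eq A A' v) fun j h1 h2 => Fin.ext ?_
    rw [← h v j h2, ← h' v j h1, dg_eq A A']
  cases A; cases A'; simp only at key; subst key; rfl

theorem card_isolated (A : AdjacencyLists G) :
    Nat.card {v : Fin n // ∀ u, ¬ G.Adj v u} = isoCount (dg A) n := by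
  classical
  rw [isoCount, Nat.card_eq_fintype_card, Fintype.card_subtype]
  refine Finset.card_bij (fun v _ => (v : ℕ)) (fun v hv => ?_) (fun _ _ _ _ h => Fin.ext h)
    fun v hv => ?_
  · rw [Finset.mem_filter] at hv ⊢
    refine ⟨Finset.mem_range.2 v.2, ?_⟩
    rw [dg_val, List.length_eq_zero_iff, List.eq_nil_iff_forall_not_mem]
    intro u hu
    exact hv.2 u ((A.mem_nbrs _ _).1 hu)
  · rw [Finset.mem_filter, Finset.mem_range] at hv
    refine ⟨⟨v, hv.1⟩, ?_, rfl⟩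
    rw [Finset.mem_filter]
    refine ⟨Finset.mem_univ _, fun u hu => ?_⟩
    have h1 := (A.mem_nbrs _ _).2 hu
    have h2 := hv.2
    rw [dg, dif_pos hv.1, List.length_eq_zero_iff] at h2
    rw [h2] at h1
    simp at h1

/-- Euler's formula, in terms of the numbers that the program has at hand. -/
theorem isPlanarEmbedding_iff (A : AdjacencyLists G) :
    A.IsPlanarEmbedding ↔
      2 * (Nat.card (Quot fun d e : G.Dart => A.faceNext d = e) + (n + 1)) +
        2 * isoCount (dg A) n + n = 4 * Nat.card G.ConnectedComponent + st (dg A) n + 1 := by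
  rw [AdjacencyLists.IsPlanarEmbedding, AdjacencyLists.numFaces, card_isolated A, st_eq]
  omega

/-- Sets register `18` if the candidate in array `13` is a planar embedding. If `R` is the number of
classes of positions after all faces are united (register `17`), `I` the number of isolated vertices
(register `9`), `c` the number of components (register `19`) and `L` the length of the input
(register `5`), then Euler's formula reads `2 * R + 2 * I + n = 4 * c + L + 1`: here `L` counts `n`,
the degrees and the darts, and `n + 1` of the classes are positions that do not hold a dart. -/
def testCmd : Cmd :=
  fillCmd ;; checkCmd ;;
  .ite 30 3 (facesCmd ;;
    .blk [.add 22 17 17, .add 23 9 9, .add 22 22 23, .add 22 22 2, .add 23 19 19, .add 23 23 23,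
      .add 23 23 5, .add 23 23 3, .sub 24 22 23, .sub 25 23 22, .add 24 24 25] ;;
    .ite 4 24 (.blk []) (.blk [.const 18 1])) (.blk [])

/-- Register `18` is set exactly when the candidate is a planar embedding. In that case the arrays
`3`, `4` and `5` hold the faces and the positions of the darts, as the deletions need them. -/
theorem wp_test {B U : ℕ} (hU : 16 * B ≤ U) (hB : B = arrLen n) (A : AdjacencyLists G) {s : St}
    {c : ℕ → ℕ} (hs : Env A s) (hc : s.arr 13 = c)
    (hcn : ∀ p < st (dg A) n, own (dg A) p ≠ 0 → c p < n)
    (hT : ∀ i, s.arr 5 i ≠ 0 → s.arr 6 i ≠ 0) (h9 : s.reg 9 = isoCount (dg A) n)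
    (h19 : s.reg 19 = Nat.card G.ConnectedComponent) (h18 : s.reg 18 = 0) :
    WP B U testCmd s fun t s' =>
      t ≤ st (dg A) n * (60 * (Nat.log 2 (st (dg A) n) + 1) + 140) + 50 ∧
      (∀ i, s'.arr 5 i ≠ 0 → s.arr 6 i ≠ 0) ∧
      (s'.reg 18 = 1 ∧ (∃ A' : AdjacencyLists G, Holds A' c ∧ A'.IsPlanarEmbedding ∧
          Table A' G (s'.arr 5) ∧ Faces A' G (s'.arr 3) (s'.arr 4)) ∨
        s'.reg 18 = 0 ∧ ∀ A' : AdjacencyLists G, Holds A' c → ¬ A'.IsPlanarEmbedding) ∧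
      Fr [7, 13, 14, 15, 16, 17, 18, 20, 21, 22, 23, 24, 25, 26, 27, 28, 29, 30] [3, 4, 5] s s' := by
  have hLB := st_le_arrLen A
  rw [← hB] at hLB
  have hBn : n * n + n + 1 = B := hB.symm
  have hnn : n ≤ n * n := Nat.le_mul_self n
  refine WP.seq ((wp_fill hU hB A hs hc hcn hT).mono ?_)
  rintro t₁ s₁ ⟨ht₁, hT₁, hT₁', f1⟩
  have e1 := hs.fr f1 (by decide) (by decide)
  have c1 : s₁.arr 13 = c := by rw [f1.arr 13 (by decide), hc]
  have hTlt : ∀ p < st (dg A) n, own (dg A) p ≠ 0 →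
      s₁.arr 5 (key (dg A) c n p) < st (dg A) n := by
    intro p hp hp'
    by_cases h : s₁.arr 5 (key (dg A) c n p) = 0
    · rw [h]; omega
    · obtain ⟨q, hq, -, -, h4⟩ := hT₁' p hp hp' (hT₁ _ h)
      rwa [h4]
  refine WP.seq ((wp_check hU hB A e1 c1 hcn hTlt).mono ?_)
  rintro t₂ s₂ ⟨ht₂, h30, f2⟩
  have e2 := e1.fr f2 (by decide) (by decide)
  have c2 : s₂.arr 13 = c := by rw [f2.arr 13 (by decide), c1]
  have t2 : s₂.arr 5 = s₁.arr 5 := f2.arr 5 (by decide)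
  have f2' : Fr [7, 13, 14, 15, 16, 17, 18, 20, 21, 22, 23, 24, 25, 26, 27, 28, 29, 30] [3, 4, 5]
      s s₂ := (f1.mono (by decide) (by decide)).trans (f2.mono (by decide) (by decide))
  have hflag : s₂.reg 18 = 0 := by rw [f2.reg 18 (by decide), f1.reg 18 (by decide), h18]
  -- the check succeeds exactly if the candidate is a rotation system of the graph
  have hvalid : s₂.reg 30 = 0 ↔ ∃ A' : AdjacencyLists G, Holds A' c := by
    rw [h30]
    constructor
    · intro h
      refine exists_holds A hcn (fun p hp hp' => ?_) (fun p hp q hq hp' hq' hpq => ?_)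
      · have h1 := hT₁ (key (dg A) c n p) (by
          rw [h p hp hp']
          intro h0
          rw [h0, own_zero] at hp'
          exact hp' rfl)
        obtain ⟨q, hq, hq', h2⟩ := (hs.adj _).1 h1
        obtain ⟨u, v, huv, rfl⟩ := exists_of_own A hq hq'
        exact ⟨u, v, huv, by rw [h2, (holds_inp A).key_pos huv]⟩
      · rw [← h p hp hp', ← h q hq hq', hpq]
    · rintro ⟨A', hA'⟩ p hp hp'
      have hd := dg_eq A A'
      rw [← hd] at hp hp'
      obtain ⟨u, v, huv, rfl⟩ := exists_of_own A' hp hp'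
      rw [hd] at hp hp'
      have hk := hA'.key_pos huv
      rw [hd] at hk
      obtain ⟨q, hq, hq', h1, h2⟩ := hT₁' _ hp hp' (by rw [hk]; exact (hs.adj_iff u v).2 huv)
      rw [h2]
      rw [← hd] at hq hq' h1
      obtain ⟨u', v', huv', rfl⟩ := exists_of_own A' hq hq'
      rw [hA'.key_pos huv, hA'.key_pos huv'] at h1
      obtain ⟨h3, h4⟩ := mul_add_inj v'.2 v.2 h1
      rw [Fin.ext h3, Fin.ext h4]
  refine WP.ite (fun hlt => ?_) (fun hlt => ?_)
  · rw [e2.r3] at hlt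
    have hlt : s₂.reg 30 = 0 := by omega
    obtain ⟨A', hA'⟩ := hvalid.1 hlt
    have hd := dg_eq A A'
    have hTab : Table A' G (s₂.arr 5) := by
      intro u v
      rw [t2]
      constructor
      · intro huv
        have h1 := h30.1 hlt (pos A' u v) (by rw [← hd]; exact pos_lt A' huv)
          (by rw [← hd, own_pos A' huv]; omega)
        have hk := hA'.key_pos huv
        rw [hd] at hk
        rwa [hk] at h1
      · intro huv
        by_contra h
        exact huv ((hs.adj_iff u v).1 (hT₁ _ h))
    refine WP.seq ((wp_faces hU hB e2 c2 hA' hTab).mono ?_)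
    rintro t₃ s₃ ⟨ht₃, h17, r17, hF, f3⟩
    have e3 := e2.fr f3 (by decide) (by decide)
    have f3' : Fr [7, 13, 14, 15, 16, 17, 18, 20, 21, 22, 23, 24, 25, 26, 27, 28, 29, 30] [3, 4, 5]
      s s₃ := f2'.trans (f3.mono (by decide) (by decide))
    have r9 : s₃.reg 9 = isoCount (dg A) n := by rw [f3'.reg 9 (by decide), h9]
    have r19 : s₃.reg 19 = Nat.card G.ConnectedComponent := by rw [f3'.reg 19 (by decide), h19]
    have r18 : s₃.reg 18 = 0 := by rw [f3.reg 18 (by decide), hflag]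
    have hcc : Nat.card G.ConnectedComponent ≤ n := by
      classical
      have := Fintype.card_le_of_surjective G.connectedComponentMk Quot.mk_surjective
      rwa [Fintype.card_fin, ← Nat.card_eq_fintype_card] at this
    have hiso := isoCount_le (dg A) n
    have hEuler := isPlanarEmbedding_iff A'
    rw [hd, ← h17] at hEuler
    refine WP.seq (WP.blk ?_ ?_)
    · simp [okOps, Op.ok, Op.run, r9, r19, e3.r2, e3.r3, e3.r5, -Nat.card_eq_fintype_card]
      omega
    generalize hs₄ : runOps _ s₃ = s₄
    have f4 : Fr [22, 23, 24, 25] [] s₃ s₄ := by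
      subst hs₄; exact (Fr.refl _ _ _).runOps _ (by decide)
    have g24 : s₄.reg 24 = 0 ↔ A'.IsPlanarEmbedding := by
      rw [hEuler]
      subst hs₄
      simp [runOps, Op.run, r9, r19, e3.r2, e3.r3, e3.r5, -Nat.card_eq_fintype_card]
      omega
    clear hs₄
    have f4' : Fr [7, 13, 14, 15, 16, 17, 18, 20, 21, 22, 23, 24, 25, 26, 27, 28, 29, 30] [3, 4, 5]
      s s₄ := f3'.trans (f4.mono (by decide) (by decide))
    have a4 : ∀ k, s₄.arr k = s₃.arr k := fun k => f4.arr k (by simp)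
    have a5 : s₄.arr 5 = s₁.arr 5 := by rw [a4, f3.arr 5 (by decide), t2]
    have r4 : s₄.reg 4 = 0 := by rw [f4.reg 4 (by decide), e3.r4]
    have htime : st (dg A) n * 30 + 3 + (st (dg A) n * 30 + 4 + (11 * st (dg A) n +
        st (dg A) n * (60 * (Nat.log 2 (st (dg A) n) + 1) + 60) + 10)) ≤
        st (dg A) n * (60 * (Nat.log 2 (st (dg A) n) + 1) + 140) + 17 := by
      have e : ∀ a b : ℕ, a * (b + 140) = a * (b + 60) + a * 80 := fun a b => by ring
      rw [e]
      omega
    refine WP.ite (fun hl => WP.blk trivial ⟨?_, ?_, .inr ⟨?_, ?_⟩, f4'⟩)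
      (fun hl => WP.blk (by simp [okOps, Op.ok]) ⟨?_, ?_, .inl ⟨?_, A', hA', ?_, ?_, ?_⟩,
        f4'.runOps _ (by decide)⟩)
    · simp only [costOps, Op.cost]; omega
    · simpa only [runOps, a5] using hT₁
    · simp only [runOps]; rw [f4.reg 18 (by decide), r18]
    · intro A'' hA'' hpl
      rw [hA'.unique hA'', ← g24] at hpl
      omega
    · simp only [costOps, Op.cost]; omega
    · simpa only [runOps, Op.run, a5] using hT₁
    · simp [runOps, Op.run]
    · rw [← g24]; omega
    · simp only [runOps, Op.run, a5]
      rwa [t2] at hTab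
    · simpa only [runOps, Op.run, a4] using hF
  · rw [e2.r3] at hlt
    refine WP.blk trivial ⟨?_, ?_, .inr ⟨hflag, fun A' hA' _ => ?_⟩, f2'⟩
    · simp only [costOps]
      have e : ∀ a b : ℕ, a * (b + 140) = a * (b + 60) + a * 80 := fun a b => by ring
      rw [e]
      omega
    · simpa only [runOps, t2] using hT₁
    · have := hvalid.2 ⟨A', hA'⟩
      omega

end Faces

/-! ### The search for a planar embedding -/

section Odometer

/-- The number with the `L` digits `c` to base `b`, the lowest one first. -/
def digitVal (b L : ℕ) (c : ℕ → ℕ) : ℕ := ∑ p ∈ Finset.range L, c p * b ^ p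

theorem digitVal_succ (b L : ℕ) (c : ℕ → ℕ) :
    digitVal b (L + 1) c = digitVal b L c + c L * b ^ L := Finset.sum_range_succ _ _

theorem digitVal_lt {b L : ℕ} {c : ℕ → ℕ} (h : ∀ p < L, c p < b) : digitVal b L c < b ^ L := by
  induction L with
  | zero => simp [digitVal]
  | succ L ih =>
    have h1 := ih fun p hp => h p (by omega)
    have h2 : (c L + 1) * b ^ L ≤ b * b ^ L := Nat.mul_le_mul_right _ (h L (by omega))
    rw [digitVal_succ, pow_succ, Nat.mul_comm _ b]
    rw [Nat.add_mul] at h2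
    omega

theorem digitVal_inj {b L : ℕ} {c d : ℕ → ℕ} (hc : ∀ p < L, c p < b) (hd : ∀ p < L, d p < b)
    (h : digitVal b L c = digitVal b L d) : ∀ p < L, c p = d p := by
  induction L with
  | zero => intro p hp; omega
  | succ L ih =>
    have h1 := digitVal_lt fun p (hp : p < L) => hc p (by omega)
    have h2 := digitVal_lt fun p (hp : p < L) => hd p (by omega)
    rw [digitVal_succ, digitVal_succ] at h
    have h3 : digitVal b L c = digitVal b L d := by
      have := congrArg (· % b ^ L) h
      simpa [Nat.add_mul_mod_self_right, Nat.mod_eq_of_lt h1, Nat.mod_eq_of_lt h2] using this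
    have h4 : c L = d L := by
      rw [h3] at h
      exact Nat.eq_of_mul_eq_mul_right (by omega) (Nat.add_left_cancel h)
    intro p hp
    rcases Nat.lt_succ_iff_lt_or_eq.1 hp with hp | rfl
    · exact ih (fun p hp => hc p (by omega)) (fun p hp => hd p (by omega)) h3 p hp
    · exact h4

/-- A carry over the `k` lowest digits. -/
theorem digitVal_carry {b k : ℕ} {c : ℕ → ℕ} (h : ∀ p < k, c p + 1 = b) :
    digitVal b k c + 1 = b ^ k := by
  induction k with
  | zero => simp [digitVal]
  | succ k ih =>
    rw [digitVal_succ, Nat.add_right_comm, ih fun p hp => h p (by omega), pow_succ,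
      Nat.mul_comm _ b, ← h k (by omega), Nat.add_mul]
    omega

theorem digitVal_eq_zero {b k : ℕ} {c : ℕ → ℕ} (h : ∀ p < k, c p = 0) : digitVal b k c = 0 :=
  Finset.sum_eq_zero fun p hp => by rw [h p (Finset.mem_range.1 hp), Nat.zero_mul]

/-- An odometer step: full digits are reset and the carry goes to digit `k`. -/
theorem digitVal_incr {b L k : ℕ} {c d : ℕ → ℕ} (hk : k < L) (h1 : ∀ p < k, c p + 1 = b)
    (h2 : ∀ p < k, d p = 0) (h3 : d k = c k + 1) (h4 : ∀ p, k < p → d p = c p) :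
    digitVal b L d = digitVal b L c + 1 := by
  induction L with
  | zero => omega
  | succ L ih =>
    rw [digitVal_succ, digitVal_succ]
    rcases Nat.lt_succ_iff_lt_or_eq.1 hk with hk | rfl
    · rw [ih hk, h4 L hk]; omega
    · rw [digitVal_eq_zero h2, h3, Nat.add_mul, ← digitVal_carry h1]; omega

/-- The number of increments, modulo `M`, that lead from `v` to `d`. -/
def cyclicDist (M v d : ℕ) : ℕ := if v ≤ d then d - v else d + M - v

/-- Adds one to the number whose digits to base `R[2]` are in array `13`, with wraparound. -/
def incCmd : Cmd :=
  .blk [.add 7 4 4] ;;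
  .loop 7 5 (.blk [.rd 13 13 7, .add 13 13 3] ;;
    .ite 13 2 (.blk [.wr 13 7 13, .add 7 5 4]) (.blk [.wr 13 7 4, .add 7 7 3]))

/-- The odometer advances by one, or wraps around to zero after the last candidate. -/
theorem wp_inc {B U n L : ℕ} (hU : 16 * B ≤ U) (hL : L ≤ B) (hn : n < B) {s : St} {c : ℕ → ℕ}
    (h2 : s.reg 2 = n) (h3 : s.reg 3 = 1) (h4 : s.reg 4 = 0) (h5 : s.reg 5 = L)
    (hc : s.arr 13 = c) (hcn : ∀ p < L, c p < n) :
    WP B U incCmd s fun t s' => t ≤ L * 20 + 10 ∧ (∀ p < L, s'.arr 13 p < n) ∧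
      (digitVal n L (s'.arr 13) = digitVal n L c + 1 ∨
        digitVal n L c + 1 = n ^ L ∧ digitVal n L (s'.arr 13) = 0) ∧
      Fr [7, 13] [13] s s' := by
  refine WP.seq (WP.blk ?_ ?_)
  · simp [okOps, Op.ok, h4]; omega
  generalize hs₁ : runOps _ s = s₁
  have f1 : Fr [7, 13] [13] s s₁ := by
    subst hs₁; exact (Fr.refl _ _ _).runOps _ (by decide)
  have g7 : s₁.reg 7 = 0 := by subst hs₁; simp [runOps, Op.run, h4]
  have ga : s₁.arr 13 = c := by subst hs₁; simp [runOps, Op.run, hc]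
  clear hs₁
  refine (WP.loop (fun m s' => Fr [7, 13] [13] s s' ∧ m = (L - s'.reg 7) * 20 ∧
    ((s'.reg 7 ≤ L ∧ (∀ p < s'.reg 7, c p + 1 = n ∧ s'.arr 13 p = 0) ∧
      ∀ p, s'.reg 7 ≤ p → s'.arr 13 p = c p) ∨
    (s'.reg 7 = L ∧ (∀ p < L, s'.arr 13 p < n) ∧
      digitVal n L (s'.arr 13) = digitVal n L c + 1))) ?_ (m := L * 20) (s := s₁)
    ⟨f1, by rw [g7, Nat.sub_zero], .inl ⟨by omega, by rw [g7]; intro p hp; omega,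
      fun p _ => by rw [ga]⟩⟩).mono ?_
  · rintro m s' ⟨f, rfl, hI⟩ hlt
    have r5 : s'.reg 5 = L := by rw [f.reg 5 (by decide), h5]
    have r2 : s'.reg 2 = n := by rw [f.reg 2 (by decide), h2]
    have r3 : s'.reg 3 = 1 := by rw [f.reg 3 (by decide), h3]
    have r4 : s'.reg 4 = 0 := by rw [f.reg 4 (by decide), h4]
    rw [r5] at hlt
    rcases hI with ⟨-, hz, hs⟩ | ⟨h, -⟩
    swap
    · omega
    set i := s'.reg 7 with hi
    have hci := hcn i hlt
    have ai := hs i le_rfl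
    refine WP.seq (WP.blk ?_ ?_)
    · simp [okOps, Op.ok, Op.run, ← hi, ai, r3]; omega
    generalize hs₂ : runOps _ s' = s₂
    have f2 : Fr [13] [] s' s₂ := by
      subst hs₂; exact (Fr.refl _ _ _).runOps _ (by decide)
    have q13 : s₂.reg 13 = c i + 1 := by
      subst hs₂; simp [runOps, Op.run, r3, ← hi, ai]
    have q7 : s₂.reg 7 = i := f2.reg 7 (by decide)
    have qa : s₂.arr 13 = s'.arr 13 := f2.arr 13 (by decide)
    have q2 : s₂.reg 2 = n := by rw [f2.reg 2 (by decide), r2]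
    have q3 : s₂.reg 3 = 1 := by rw [f2.reg 3 (by decide), r3]
    have q4 : s₂.reg 4 = 0 := by rw [f2.reg 4 (by decide), r4]
    have q5 : s₂.reg 5 = L := by rw [f2.reg 5 (by decide), r5]
    have f2' : Fr [7, 13] [13] s s₂ := f.trans (f2.mono (by decide) (by decide))
    clear hs₂
    refine WP.ite (fun hl => WP.blk ?_ ?_) (fun hl => WP.blk ?_ ?_)
    · simp [okOps, Op.ok, Op.run, q7, q5, q4]; omega
    · rw [q13, q2] at hl
      refine ⟨0, ?_, f2'.runOps _ (by decide), ?_, .inr ⟨?_, fun p hp => ?_, ?_⟩⟩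
      · simp [costOps, Op.cost]; omega
      · simp [runOps, Op.run, q5, q4]
      · simp [runOps, Op.run, q5, q4]
      · simp only [runOps, Op.run, Function.update_self, q7, q13, qa]
        rw [Function.update_apply]
        split_ifs with he
        · exact hl
        · by_cases h : p < i
          · rw [(hz p h).2]; omega
          · rw [hs p (by omega)]; exact hcn p hp
      · refine digitVal_incr hlt (fun p hp => (hz p hp).1) (fun p hp => ?_) ?_ (fun p hp => ?_)
        · simp [runOps, Op.run, q7, qa, Function.update_of_ne (show p ≠ i by omega), (hz p hp).2]
        · simp [runOps, Op.run, q7, q13]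
        · simp [runOps, Op.run, q7, qa, Function.update_of_ne (show p ≠ i by omega),
            hs p hp.le]
    · simp [okOps, Op.ok, Op.run, q7, q3]; omega
    · rw [q13, q2] at hl
      refine ⟨(L - (i + 1)) * 20, ?_, f2'.runOps _ (by decide), ?_, .inl ⟨?_, ?_, ?_⟩⟩
      · simp [costOps, Op.cost]; omega
      · simp [runOps, Op.run, q7, q3]
      · simp [runOps, Op.run, q7, q3]; omega
      · intro p hp
        simp [runOps, Op.run, q7, q3] at hp
        rcases Nat.lt_or_eq_of_le hp with hp | rfl
        · simp [runOps, Op.run, q7, qa, Function.update_of_ne (show p ≠ i by omega), (hz p hp).2,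
            (hz p hp).1]
        · simp [runOps, Op.run, q7, q4]; omega
      · intro p hp
        simp [runOps, Op.run, q7, q3] at hp
        simp [runOps, Op.run, q7, qa, Function.update_of_ne (show p ≠ i by omega),
            hs p (by omega)]
  · rintro t s' ⟨ht, ⟨m, -, f, -, hI⟩, hge⟩
    have r5 : s'.reg 5 = L := by rw [f.reg 5 (by decide), h5]
    rw [r5] at hge
    refine ⟨by simp [costOps, Op.cost]; omega, ?_, ?_, f⟩
    · rcases hI with ⟨h1, h2, -⟩ | ⟨-, h, -⟩
      · intro p hp
        have := h2 p (by omega)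
        omega
      · exact h
    · rcases hI with ⟨h1, h2, -⟩ | ⟨-, -, h⟩
      · exact .inr ⟨digitVal_carry fun p hp => (h2 p (by omega)).1,
          digitVal_eq_zero fun p hp => (h2 p (by omega)).2⟩
      · exact .inl h

end Odometer

section Search

variable {n : ℕ} {G : SimpleGraph (Fin n)}

/-- Tests the candidates in array `13` one after another, until a planar embedding is found. -/
def searchCmd : Cmd :=
  .blk [.const 18 0] ;; .loop 18 3 (testCmd ;; .ite 18 3 incCmd (.blk []))

/-- The registers and arrays that `searchCmd` may change. -/
abbrev searchRegs : List ℕ :=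
  [7, 13, 14, 15, 16, 17, 18, 20, 21, 22, 23, 24, 25, 26, 27, 28, 29, 30]

theorem Holds.congr {A : AdjacencyLists G} {c d : ℕ → ℕ} (h : Holds A c)
    (hcd : 0 < n → ∀ p < st (dg A) n, c p = d p) : Holds A d := fun v j hj => by
  rw [← h v j hj, hcd v.pos _ ?_]
  rw [Nat.add_assoc]
  exact st_lt _ v.2 (by rw [dg_val]; omega)

/-- The search ends when it reaches the digits `d` of a planar embedding `A'` at the latest. -/
theorem wp_search {B U : ℕ} (hU : 16 * B ≤ U) (hB : B = arrLen n) (A : AdjacencyLists G) {s : St}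
    (hs : Env A s) (hcn : 0 < n → ∀ p < st (dg A) n, s.arr 13 p < n)
    (hT : ∀ i, s.arr 5 i = 0) (h9 : s.reg 9 = isoCount (dg A) n)
    (h19 : s.reg 19 = Nat.card G.ConnectedComponent)
    {A' : AdjacencyLists G} (hA' : A'.IsPlanarEmbedding) {d : ℕ → ℕ} (hd : Holds A' d)
    (hdn : 0 < n → ∀ p < st (dg A) n, d p < n) :
    WP B U searchCmd s fun t s' =>
      t ≤ (cyclicDist (n ^ st (dg A) n) (digitVal n (st (dg A) n) (s.arr 13))
          (digitVal n (st (dg A) n) d) + 1) *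
        (st (dg A) n * (60 * (Nat.log 2 (st (dg A) n) + 1) + 160) + 70) + 10 ∧
      (∃ A'' : AdjacencyLists G, A''.IsPlanarEmbedding ∧ Holds A'' (s'.arr 13) ∧
        Table A'' G (s'.arr 5) ∧ Faces A'' G (s'.arr 3) (s'.arr 4)) ∧
      Fr searchRegs [3, 4, 5, 13] s s' := by
  have hLB := st_le_arrLen A
  rw [← hB] at hLB
  have hBn : n * n + n + 1 = B := hB.symm
  set L := st (dg A) n with hL
  set K := L * (60 * (Nat.log 2 L + 1) + 160) + 70 with hK
  set v := digitVal n L d with hv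
  refine WP.seq (WP.blk (by simp [okOps, Op.ok]) ?_)
  generalize hs₁ : runOps _ s = s₁
  have f1 : Fr searchRegs [3, 4, 5, 13] s s₁ := by
    subst hs₁; exact (Fr.refl _ _ _).runOps _ (by decide)
  have g18 : s₁.reg 18 = 0 := by subst hs₁; simp [runOps, Op.run]
  have ga : s₁.arr = s.arr := by subst hs₁; rfl
  clear hs₁
  -- The variant is the number of odometer steps left before the digits `d`, each of cost `K`.
  refine (WP.loop (fun m s' => Fr searchRegs [3, 4, 5, 13] s s' ∧
    ((s'.reg 18 = 1 ∧ ∃ A'' : AdjacencyLists G, A''.IsPlanarEmbedding ∧ Holds A'' (s'.arr 13) ∧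
        Table A'' G (s'.arr 5) ∧ Faces A'' G (s'.arr 3) (s'.arr 4)) ∨
      s'.reg 18 = 0 ∧ (∀ i, s'.arr 5 i ≠ 0 → s'.arr 6 i ≠ 0) ∧
      (0 < n → ∀ p < L, s'.arr 13 p < n) ∧
      m = (cyclicDist (n ^ L) (digitVal n L (s'.arr 13)) v + 1) * K)) ?_
    (m := (cyclicDist (n ^ L) (digitVal n L (s.arr 13)) v + 1) * K) (s := s₁)
    ⟨f1, .inr ⟨g18, fun i hi => absurd (by rw [ga]; exact hT i) hi, by rw [ga]; exact hcn,
      by rw [ga]⟩⟩).mono ?_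
  · rintro m s' ⟨f, hI⟩ hlt
    have e := hs.fr f (by decide) (by decide)
    rw [e.r3] at hlt
    rcases hI with ⟨h, -⟩ | ⟨h18, hT', hc', rfl⟩
    · omega
    have hn : ∀ p < L, own (dg A) p ≠ 0 → s'.arr 13 p < n := fun p hp hp' => by
      obtain ⟨x, hx, -⟩ := exists_of_own_ne_zero hp'
      exact hc' (by have := lt_of_own hx hp; omega) p hp
    refine WP.seq ((wp_test hU hB A e rfl hn hT' (by rw [f.reg 9 (by decide), h9])
      (by rw [f.reg 19 (by decide), h19]) h18).mono ?_)
    rintro t₁ s₂ ⟨ht₁, hT₂, hres, f2⟩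
    have f2' : Fr searchRegs [3, 4, 5, 13] s s₂ := f.trans (f2.mono (by decide) (by decide))
    have e2 := hs.fr f2' (by decide) (by decide)
    have c2 : s₂.arr 13 = s'.arr 13 := f2.arr 13 (by decide)
    rw [← hL] at ht₁
    have hKt : t₁ + (L * 20 + 20) ≤ K := by
      rw [hK, show L * (60 * (Nat.log 2 L + 1) + 160) =
        L * (60 * (Nat.log 2 L + 1) + 140) + L * 20 by ring]
      omega
    refine WP.ite (fun hl => ?_) (fun hl => ?_)
    · rw [e2.r3] at hl
      rcases hres with ⟨h, -⟩ | ⟨h, hfail⟩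
      · omega
      have hnpos : 0 < n := by
        by_contra h0
        exact hfail A' (hd.congr fun h => absurd h h0) hA'
      have hne : digitVal n L (s'.arr 13) ≠ v := fun hv' =>
        hfail A' (hd.congr fun _ p hp => (digitVal_inj (hc' hnpos) (hdn hnpos) hv' p
          (by rw [dg_eq A A'] at hp; exact hp)).symm) hA'
      refine (wp_inc (n := n) (L := L) hU hLB (by omega) e2.r2 e2.r3 e2.r4 e2.r5 c2
        (hc' hnpos)).mono ?_
      rintro t₃ s₃ ⟨ht₃, hn₃, hval, f3⟩
      have hlt₁ := digitVal_lt (hc' hnpos)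
      have hlt₂ := digitVal_lt (hdn hnpos)
      have hdist : cyclicDist (n ^ L) (digitVal n L (s₃.arr 13)) v + 1 ≤
          cyclicDist (n ^ L) (digitVal n L (s'.arr 13)) v := by
        unfold cyclicDist
        split_ifs <;> omega
      refine ⟨(cyclicDist (n ^ L) (digitVal n L (s₃.arr 13)) v + 1) * K, ?_,
        f2'.trans (f3.mono (by decide) (by decide)), .inr ⟨?_, ?_, fun _ => hn₃, rfl⟩⟩
      · have := Nat.mul_le_mul_right K hdist
        rw [Nat.add_mul (cyclicDist _ (digitVal n L (s'.arr 13)) v) 1 K]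
        omega
      · rw [f3.reg 18 (by decide), h]
      · rw [f3.arr 5 (by decide), f3.arr 6 (by decide), f2.arr 6 (by decide)]
        exact hT₂
    · rw [e2.r3] at hl
      rcases hres with ⟨h, A'', h1, h2, h3, h4⟩ | ⟨h, -⟩
      · refine WP.blk trivial ⟨0, ?_, f2', .inl ⟨h, A'', h2, by simp only [runOps]; rwa [c2], h3, h4⟩⟩
        have : 1 * K ≤ (cyclicDist (n ^ L) (digitVal n L (s'.arr 13)) v + 1) * K :=
          Nat.mul_le_mul_right K (by omega)
        simp only [costOps]
        omega
      · omega
  · rintro t s' ⟨ht, ⟨m, hm, f, hI⟩, hge⟩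
    have e := hs.fr f (by decide) (by decide)
    rw [e.r3] at hge
    refine ⟨by simp only [costOps, Op.cost]; omega, ?_, f⟩
    rcases hI with ⟨-, h⟩ | ⟨h, -⟩
    · exact h
    · omega

end Search

/-! ### Splitting a component -/

section Split

variable {n : ℕ} {G H : SimpleGraph (Fin n)}

theorem componentSize_congr {H H' : SimpleGraph (Fin n)} {x x' : Fin n}
    (h : ∀ y, H.Reachable x y ↔ H'.Reachable x' y) : componentSize H x = componentSize H' x' :=
  congrArg Set.ncard (Set.ext h)

theorem componentSize_eq_of_reachable {x y : Fin n} (h : H.Reachable x y) :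
    componentSize H x = componentSize H y :=
  componentSize_congr fun _ => ⟨h.symm.trans, h.trans⟩

theorem componentSize_pos (H : SimpleGraph (Fin n)) (x : Fin n) : 0 < componentSize H x :=
  (Set.ncard_pos (Set.toFinite _)).2 ⟨x, SimpleGraph.Reachable.refl x⟩

theorem componentSize_mono {H' : SimpleGraph (Fin n)} (h : H' ≤ H) (x : Fin n) :
    componentSize H' x ≤ componentSize H x :=
  Set.ncard_le_ncard (fun _ hy => SimpleGraph.Reachable.mono h hy) (Set.toFinite _)

theorem componentSize_le (H : SimpleGraph (Fin n)) (x : Fin n) : componentSize H x ≤ n := by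
  have := Set.ncard_le_card {u : Fin n | H.Reachable x u}
  rwa [Nat.card_eq_fintype_card, Fintype.card_fin] at this

theorem componentSize_eq_length {x : Fin n} {Q : List (Fin n)} (hQ : Q.Nodup)
    (h : ∀ y, y ∈ Q ↔ H.Reachable x y) : componentSize H x = Q.length := by
  classical
  rw [← List.toFinset_card_of_nodup hQ, ← Set.ncard_coe_finset]
  refine congrArg Set.ncard (Set.ext fun y => ?_)
  simp [h]

theorem reachable_deleteEdges_iff {u v : Fin n}
    (h : (H.deleteEdges {s(u, v)}).Reachable u v) (x y : Fin n) :
    (H.deleteEdges {s(u, v)}).Reachable x y ↔ H.Reachable x y := by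
  refine ⟨SimpleGraph.Reachable.mono (SimpleGraph.deleteEdges_le _), fun hxy => ?_⟩
  rcases reachable_deleteEdges (u := u) (v := v) hxy with h1 | ⟨h1, h2⟩ | ⟨h1, h2⟩
  · exact h1
  · exact (h1.trans h).trans h2.symm
  · exact (h1.trans h.symm).trans h2.symm

theorem reachable_or_of_deleteEdges {u v : Fin n} (huv : H.Adj u v) (x : Fin n) :
    H.Reachable u x ↔ (H.deleteEdges {s(u, v)}).Reachable u x ∨
      (H.deleteEdges {s(u, v)}).Reachable v x := by
  have hle : H.deleteEdges {s(u, v)} ≤ H := SimpleGraph.deleteEdges_le _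
  constructor
  · intro h
    rcases reachable_deleteEdges (u := u) (v := v) h with h1 | ⟨h1, h2⟩ | ⟨h1, h2⟩
    · exact .inl h1
    · exact .inr h2.symm
    · exact .inl h2.symm
  · rintro (h | h)
    · exact h.mono hle
    · exact huv.reachable.trans (h.mono hle)

theorem reachable_deleteEdges_iff_of_not_reachable {u v x : Fin n} (huv : H.Adj u v)
    (hx : ¬ H.Reachable u x) (y : Fin n) :
    (H.deleteEdges {s(u, v)}).Reachable x y ↔ H.Reachable x y := by
  have hle : H.deleteEdges {s(u, v)} ≤ H := SimpleGraph.deleteEdges_le _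
  refine ⟨SimpleGraph.Reachable.mono hle, fun hxy => ?_⟩
  rcases reachable_deleteEdges (u := u) (v := v) hxy with h1 | ⟨h1, h2⟩ | ⟨h1, h2⟩
  · exact h1
  · exact absurd (h1.mono hle).symm hx
  · exact absurd (huv.reachable.trans (h1.mono hle).symm) hx

/-- Deleting a bridge splits its component into the sides of the two ends. Hence one of the sides has
at most half of the vertices. -/
theorem componentSize_split {u v : Fin n} (huv : H.Adj u v)
    (h : ¬ (H.deleteEdges {s(u, v)}).Reachable u v) :
    componentSize H u = componentSize (H.deleteEdges {s(u, v)}) u +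
      componentSize (H.deleteEdges {s(u, v)}) v := by
  unfold componentSize
  rw [← Set.ncard_union_eq _ (Set.toFinite _) (Set.toFinite _)]
  · exact congrArg Set.ncard (Set.ext (reachable_or_of_deleteEdges huv))
  · rw [Set.disjoint_left]
    intro x hx hx'
    exact h (SimpleGraph.Reachable.trans hx (SimpleGraph.Reachable.symm hx'))

open Classical in
/-- The sum of the weights `deg + 1` over the component of `r`. The degrees are those of the
graph `G` before all deletions. -/
noncomputable def compWeight (A : AdjacencyLists G) (H : SimpleGraph (Fin n)) (r : Fin n) : ℕ :=
  ∑ x ∈ Finset.univ.filter fun x => H.Reachable r x, (dg A x + 1)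

/-- Every vertex pays its weight whenever the size of its component is halved; this is the amount
that it can still pay in total. -/
noncomputable def potential (A : AdjacencyLists G) (H : SimpleGraph (Fin n)) : ℕ :=
  ∑ x : Fin n, (dg A x + 1) * Nat.log 2 (componentSize H x)

theorem potential_mono (A : AdjacencyLists G) {H' : SimpleGraph (Fin n)} (h : H' ≤ H) :
    potential A H' ≤ potential A H :=
  Finset.sum_le_sum fun x _ => Nat.mul_le_mul_left _ (Nat.log_mono_right (componentSize_mono h x))

/-- On a side with at most half of the vertices each logarithm drops by at least one, which pays for
the `deg + 1` of each of its vertices. -/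
theorem potential_add_compWeight_le (A : AdjacencyLists G) {H' : SimpleGraph (Fin n)} (h : H' ≤ H)
    {r : Fin n} (hr : 2 * componentSize H' r ≤ componentSize H r) :
    potential A H' + compWeight A H' r ≤ potential A H := by
  classical
  rw [compWeight, Finset.sum_filter, potential, ← Finset.sum_add_distrib]
  refine Finset.sum_le_sum fun x _ => ?_
  split_ifs with hx
  · rw [← Nat.mul_succ]
    refine Nat.mul_le_mul_left _ ?_
    rw [← componentSize_eq_of_reachable hx, ← componentSize_eq_of_reachable (hx.mono h),
      Nat.succ_eq_add_one, ← Nat.log_mul_base (by norm_num) (componentSize_pos H' r).ne', Nat.mul_comm]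
    exact Nat.log_mono_right hr
  · exact Nat.mul_le_mul_left _ (Nat.log_mono_right (componentSize_mono h x))

theorem potential_le (A : AdjacencyLists G) (H : SimpleGraph (Fin n)) :
    potential A H ≤ st (dg A) n * Nat.log 2 n := by
  have h1 : ∑ x : Fin n, (dg A x + 1) = n + 2 * G.edgeSet.ncard := by
    rw [Fin.sum_univ_eq_sum_range (fun x => dg A x + 1), Finset.sum_add_distrib, sum_dg]
    simp [Nat.add_comm]
  calc potential A H ≤ ∑ x : Fin n, (dg A x + 1) * Nat.log 2 n :=
        Finset.sum_le_sum fun x _ =>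
          Nat.mul_le_mul_left _ (Nat.log_mono_right (componentSize_le H x))
    _ ≤ st (dg A) n * Nat.log 2 n := by
        rw [← Finset.sum_mul, h1, st_eq]
        exact Nat.mul_le_mul_right _ (by omega)

theorem sum_weight_le_compWeight (A : AdjacencyLists G) {r : Fin n} {Q : List (Fin n)}
    (hQ : Q.Nodup) (h : ∀ x ∈ Q, H.Reachable r x) :
    (Q.map fun x : Fin n => dg A x + 1).sum ≤ compWeight A H r := by
  classical
  rw [← List.sum_toFinset _ hQ, compWeight]
  refine Finset.sum_le_sum_of_subset fun x hx => ?_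
  rw [Finset.mem_filter]
  exact ⟨Finset.mem_univ _, h x (List.mem_toFinset.1 hx)⟩

theorem length_le_sum_weight (A : AdjacencyLists G) (Q : List (Fin n)) :
    Q.length ≤ (Q.map fun x : Fin n => dg A x + 1).sum := by
  induction Q with
  | nil => simp
  | cons x Q ih => simp only [List.length_cons, List.map_cons, List.sum_cons]; omega

end Split

/-! ### Searching one side of a deleted edge -/

section Side

variable {n : ℕ} {G H : SimpleGraph (Fin n)}

/-- A search of the component of `r` in `H`, with the queue `Q`, which starts at position `o` of the
array `q`. The vertices before position `h` have been processed; of the vertex at position `h`, the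
first `j` neighbours have been processed. Found vertices `x` have `mark x = stamp`. -/
structure Side (A : AdjacencyLists G) (H : SimpleGraph (Fin n)) (stamp : ℕ) (r : Fin n)
    (q mark : ℕ → ℕ) (o h j : ℕ) (Q : List (Fin n)) : Prop where
  nodup : Q.Nodup
  root : r ∈ Q
  reach : ∀ x ∈ Q, H.Reachable r x
  queue : ∀ i (hi : i < Q.length), q (o + i) = Q[i]
  mark_mem : ∀ x ∈ Q, mark x = stamp
  mem_mark : ∀ x, H.Reachable r x → mark x = stamp → x ∈ Q
  head_le : h ≤ Q.length
  idx : h = Q.length → j = 0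
  done : ∀ i (hi : i < Q.length), i < h → ∀ y, H.Adj Q[i] y → y ∈ Q
  idx_le : ∀ hh : h < Q.length, j ≤ dg A Q[h]
  part : ∀ (hh : h < Q.length) k (hk : k < (A.nbrs Q[h]).length), k < j →
    H.Adj Q[h] (A.nbrs Q[h])[k] → (A.nbrs Q[h])[k] ∈ Q

/-- The number of steps that a search has made. -/
noncomputable def progress (A : AdjacencyLists G) (h j : ℕ) (Q : List (Fin n)) : ℕ :=
  ((Q.take h).map fun x : Fin n => dg A x + 1).sum + j

theorem progress_succ_head (A : AdjacencyLists G) {h : ℕ} {Q : List (Fin n)} (hh : h < Q.length) :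
    progress A (h + 1) 0 Q = progress A h (dg A Q[h]) Q + 1 := by
  rw [progress, progress, List.take_add_one, List.getElem?_eq_getElem hh]
  rw [List.map_append, List.sum_append]
  simp only [Option.toList_some, List.map_cons, List.map_nil, List.sum_singleton]
  omega

theorem progress_append (A : AdjacencyLists G) {h j : ℕ} {Q : List (Fin n)} (hh : h ≤ Q.length)
    (y : Fin n) : progress A h j (Q ++ [y]) = progress A h j Q := by
  rw [progress, progress, List.take_append_of_le_length hh]

variable {A : AdjacencyLists G} {stamp : ℕ} {r : Fin n} {q mark : ℕ → ℕ} {o h j : ℕ}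
  {Q : List (Fin n)}

theorem Side.congr (hS : Side A H stamp r q mark o h j Q) {q' mark' : ℕ → ℕ}
    (hq : ∀ i < n, q' (o + i) = q (o + i))
    (hm : ∀ x : Fin n, H.Reachable r x → mark' x = mark x) :
    Side A H stamp r q' mark' o h j Q :=
  { hS with
    queue := fun i hi => by
      rw [hq i (hi.trans_le (hS.nodup.length_le_card.trans_eq (Fintype.card_fin n)))]
      exact hS.queue i hi
    mark_mem := fun x hx => by rw [hm x (hS.reach x hx)]; exact hS.mark_mem x hx
    mem_mark := fun x hx h => hS.mem_mark x hx (by rw [← hm x hx]; exact h) }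

theorem Side.init (hr : ∀ x : Fin n, H.Reachable r x → (mark x = stamp ↔ x = r)) (hq : q o = r) :
    Side A H stamp r q mark o 0 0 [r] where
  nodup := List.nodup_singleton r
  root := List.mem_singleton_self r
  reach x hx := by rw [List.mem_singleton.1 hx]
  queue i hi := by
    obtain rfl : i = 0 := by simpa using hi
    simpa using hq
  mark_mem x hx := by
    rw [List.mem_singleton.1 hx]
    exact (hr r (.refl r)).2 rfl
  mem_mark x hx h := List.mem_singleton.2 ((hr x hx).1 h)
  head_le := Nat.zero_le _
  idx _ := rfl
  done i _ hi := by omega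
  idx_le _ := Nat.zero_le _
  part _ k _ hk := by omega

/-- When the queue is exhausted, it lists the whole component of the root. -/
theorem Side.mem_iff (hS : Side A H stamp r q mark o h j Q) (hh : h = Q.length) (x : Fin n) :
    x ∈ Q ↔ H.Reachable r x := by
  refine ⟨hS.reach x, fun hx => ?_⟩
  rw [SimpleGraph.reachable_iff_reflTransGen] at hx
  induction hx with
  | refl => exact hS.root
  | tail _ hyz ih =>
    obtain ⟨i, hi, rfl⟩ := List.getElem_of_mem ih
    exact hS.done i hi (by omega) _ hyz

/-- The work done on a side is bounded by its weight. This limits the number of steps of its search. -/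
theorem Side.progress_lt (hS : Side A H stamp r q mark o h j Q) (hh : h < Q.length) :
    progress A h j Q < compWeight A H r := by
  have h1 := progress_succ_head A hh
  have h2 : progress A h j Q ≤ progress A h (dg A Q[h]) Q := Nat.add_le_add_left (hS.idx_le hh) _
  have h3 : progress A (h + 1) 0 Q ≤ (Q.map fun x : Fin n => dg A x + 1).sum := by
    rw [progress, Nat.add_zero, List.map_take]
    exact List.Sublist.sum_le_sum (List.take_sublist _ _) fun _ _ => Nat.zero_le _
  have h4 := sum_weight_le_compWeight A hS.nodup hS.reach
  omega

/-- The head of the queue has no further neighbours. -/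
theorem Side.next (hH : H ≤ G) (hS : Side A H stamp r q mark o h j Q) (hh : h < Q.length)
    (hj : dg A Q[h] ≤ j) : Side A H stamp r q mark o (h + 1) 0 Q :=
  { hS with
    head_le := hh
    idx := fun _ => rfl
    done := fun i hi hih y hy => by
      rcases Nat.lt_succ_iff_lt_or_eq.1 hih with hih | rfl
      · exact hS.done i hi hih y hy
      · obtain ⟨k, hk, rfl⟩ := List.getElem_of_mem ((A.mem_nbrs _ _).2 (hH hy) : y ∈ A.nbrs Q[i])
        exact hS.part hh k hk (by rw [dg_val] at hj; omega) hy
    idx_le := fun _ => Nat.zero_le _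
    part := fun _ k _ hk => by omega }

/-- The next neighbour of the head is not adjacent to it any more, or known already. -/
theorem Side.skip (hS : Side A H stamp r q mark o h j Q) (hh : h < Q.length)
    (hj : j < (A.nbrs Q[h]).length) (hy : H.Adj Q[h] (A.nbrs Q[h])[j] → (A.nbrs Q[h])[j] ∈ Q) :
    Side A H stamp r q mark o h (j + 1) Q :=
  { hS with
    idx := fun h' => by omega
    idx_le := fun _ => by rw [dg_val]; omega
    part := fun hh' k hk hkj => by
      rcases Nat.lt_succ_iff_lt_or_eq.1 hkj with hkj | rfl
      · exact hS.part hh k hk hkj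
      · exact hy }

/-- The next neighbour of the head is new. -/
theorem Side.enqueue (hS : Side A H stamp r q mark o h j Q) (hh : h < Q.length)
    (hj : j < (A.nbrs Q[h]).length) {y : Fin n} (hy : y = (A.nbrs Q[h])[j])
    (hadj : H.Adj Q[h] y) (hyQ : y ∉ Q) :
    Side A H stamp r (Function.update q (o + Q.length) y) (Function.update mark y stamp) o h (j + 1)
      (Q ++ [y]) := by
  have hget : (Q ++ [y])[h]'(by simp; omega) = Q[h] := List.getElem_append_left hh
  refine ⟨?_, ?_, ?_, ?_, ?_, ?_, ?_, ?_, ?_, ?_, ?_⟩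
  · exact List.nodup_append.2 ⟨hS.nodup, List.nodup_singleton y, by
      rintro a ha b hb rfl
      exact hyQ (by rwa [List.mem_singleton.1 hb] at ha)⟩
  · exact List.mem_append_left _ hS.root
  · intro x hx
    rcases List.mem_append.1 hx with hx | hx
    · exact hS.reach x hx
    · rw [List.mem_singleton.1 hx]
      exact (hS.reach _ (List.getElem_mem hh)).trans hadj.reachable
  · intro i hi
    rw [Function.update_apply]
    split_ifs with he
    · obtain rfl : i = Q.length := by omega
      simp
    · simp only [List.length_append, List.length_singleton] at hi
      have hi' : i < Q.length := by omega
      rw [List.getElem_append_left hi']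
      exact hS.queue i hi'
  · intro x hx
    rw [Function.update_apply]
    split_ifs with he
    · rfl
    · rcases List.mem_append.1 hx with hx | hx
      · exact hS.mark_mem x hx
      · exact absurd (by rw [List.mem_singleton.1 hx]) he
  · intro x hx hm
    rw [Function.update_apply] at hm
    split_ifs at hm with he
    · exact List.mem_append_right _ (List.mem_singleton.2 (Fin.ext he))
    · exact List.mem_append_left _ (hS.mem_mark x hx hm)
  · simp; omega
  · intro h'; simp at h'; omega
  · intro i hi hih z hz
    rw [List.getElem_append_left (by omega)] at hz
    exact List.mem_append_left _ (hS.done i (by omega) hih z hz)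
  · intro hh'
    rw [hget, dg_val]
    omega
  · intro hh' k hk hkj hz
    simp only [hget] at hk hz ⊢
    rcases Nat.lt_succ_iff_lt_or_eq.1 hkj with hkj | rfl
    · exact List.mem_append_left _ (hS.part hh k hk hkj hz)
    · rw [← hy]
      exact List.mem_append_right _ (List.mem_singleton_self y)

end Side

section Step

variable {n : ℕ} {G H : SimpleGraph (Fin n)}

/-- The registers and arrays that deletions only read: constants, degrees, and the embedding `A`. -/
structure Static (A : AdjacencyLists G) (s : St) : Prop where
  r2 : s.reg 2 = n
  r3 : s.reg 3 = 1
  r4 : s.reg 4 = 0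
  deg : ∀ v < n, s.arr 0 (st (dg A) v) = dg A v
  start : ∀ v < n, s.arr 11 v = st (dg A) v
  cand : Holds A (s.arr 13)

theorem Static.fr {A : AdjacencyLists G} {s s' : St} (h : Static A s) {R K : List ℕ}
    (hf : Fr R K s s') (hR : 2 ∉ R ∧ 3 ∉ R ∧ 4 ∉ R) (hK : 0 ∉ K ∧ 11 ∉ K ∧ 13 ∉ K) :
    Static A s' :=
  ⟨by rw [hf.reg 2 hR.1, h.r2], by rw [hf.reg 3 hR.2.1, h.r3], by rw [hf.reg 4 hR.2.2, h.r4],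
    by rw [hf.arr 0 hK.1]; exact h.deg, by rw [hf.arr 11 hK.2.1]; exact h.start,
    by rw [hf.arr 13 hK.2.2]; exact h.cand⟩

/-- One step of the search whose offset, head, tail and index are in the registers `7` to `10`. The
neighbours of the head are read from the full adjacency list in array `13`; those whose edge is
deleted have entry `0` in array `5` and are skipped, as are those marked with the current stamp. -/
def stepCmd : Cmd :=
  .ite 8 9 (.blk [.add 18 7 8, .rd 18 10 18, .rd 19 11 18, .rd 20 0 19] ;;
    .ite 10 20
      (.blk [.add 21 19 10, .add 21 21 3, .rd 21 13 21, .add 10 10 3, .mul 22 18 2,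
          .add 22 22 21, .rd 22 5 22, .rd 23 9 21] ;;
        .ite 4 22 (.ite 23 6 (.blk [.wr 9 21 6, .add 24 7 9, .wr 10 24 21, .add 9 9 3]) (.blk []))
          (.blk []))
      (.blk [.add 8 8 3, .add 10 4 4]))
    (.blk [])

/-- The registers of a search hold its parameters. -/
structure SideRegs (s : St) (o h j t : ℕ) : Prop where
  offset : s.reg 7 = o
  head : s.reg 8 = h
  tail : s.reg 9 = t
  idx : s.reg 10 = j

/-- The result of `stepCmd`. -/
def StepPost (A : AdjacencyLists G) (H : SimpleGraph (Fin n)) (stamp : ℕ) (r : Fin n) (o h j : ℕ)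
    (Q : List (Fin n)) (s s' : St) : Prop :=
  (∃ h' j' Q', Side A H stamp r (s'.arr 10) (s'.arr 9) o h' j' Q' ∧
    SideRegs s' o h' j' Q'.length ∧ (h = Q.length → h' = Q'.length) ∧
    (h < Q.length → progress A h' j' Q' = progress A h j Q + 1)) ∧
  (∀ i, i < o ∨ o + n ≤ i → s'.arr 10 i = s.arr 10 i) ∧
  (∀ y : Fin n, ¬ H.Reachable r y → s'.arr 9 y = s.arr 9 y) ∧
  (∀ y : Fin n, s'.arr 9 y ≤ stamp) ∧
  Fr [8, 9, 10, 18, 19, 20, 21, 22, 23, 24] [9, 10] s s'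

/-- One step of a search takes constant time: it inspects one neighbour of the head of the queue, or
advances the head. -/
theorem wp_step {B U : ℕ} (hU : 16 * B ≤ U) (hB : B = arrLen n) {A : AdjacencyLists G}
    (hH : H ≤ G) {s : St} {stamp : ℕ} {r : Fin n} {o h j : ℕ} {Q : List (Fin n)}
    (hs : Static A s) (hT : Table A H (s.arr 5)) (h6 : s.reg 6 = stamp)
    (ho : o ≤ n)
    (hS : Side A H stamp r (s.arr 10) (s.arr 9) o h j Q) (hr : SideRegs s o h j Q.length)
    (hm : ∀ y : Fin n, s.arr 9 y ≤ stamp) :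
    WP B U stepCmd s fun t s' => t ≤ 60 ∧ StepPost A H stamp r o h j Q s s' := by
  have hLB := st_le_arrLen A
  rw [← hB] at hLB
  have hBn : n * n + n + 1 = B := hB.symm
  have hnn : n ≤ n * n := Nat.le_mul_self n
  have hQn : Q.length ≤ n := hS.nodup.length_le_card.trans_eq (Fintype.card_fin n)
  have hfr : ∀ {s' : St}, Fr [8, 9, 10, 18, 19, 20, 21, 22, 23, 24] [] s s' →
      (∀ i, i < o ∨ o + n ≤ i → s'.arr 10 i = s.arr 10 i) ∧
      (∀ y : Fin n, ¬ H.Reachable r y → s'.arr 9 y = s.arr 9 y) ∧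
      (∀ y : Fin n, s'.arr 9 y ≤ stamp) ∧
      Fr [8, 9, 10, 18, 19, 20, 21, 22, 23, 24] [9, 10] s s' := fun {s'} f =>
    ⟨fun i _ => by rw [f.arr 10 (by decide)], fun i _ => by rw [f.arr 9 (by decide)],
      fun y => by rw [f.arr 9 (by decide)]; exact hm y, f.mono (by decide) (by decide)⟩
  refine WP.ite (fun hl => ?_) (fun hl => ?_)
  swap
  · rw [hr.head, hr.tail] at hl
    exact WP.blk trivial ⟨by simp [costOps], ⟨h, j, Q, hS, hr, id, fun h' => absurd h' hl⟩,
      hfr (.refl _ _ _)⟩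
  rw [hr.head, hr.tail] at hl
  have hqh := hS.queue h hl
  set x := Q[h] with hx
  have hst := hs.start x x.2
  have hdg := hs.deg x x.2
  have hltx : st (dg A) x + dg A x < st (dg A) n := st_lt _ x.2 le_rfl
  refine WP.seq (WP.blk ?_ ?_)
  · simp [okOps, Op.ok, Op.run, hr.offset, hr.head, hqh, hst]
    have := x.2
    omega
  generalize hs₁ : runOps _ s = s₁
  have f1 : Fr [8, 9, 10, 18, 19, 20, 21, 22, 23, 24] [] s s₁ := by
    subst hs₁; exact (Fr.refl _ _ _).runOps _ (by decide)
  have g18 : s₁.reg 18 = x := by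
    subst hs₁; simp [runOps, Op.run, hr.offset, hr.head, hqh]
  have g19 : s₁.reg 19 = st (dg A) x := by
    subst hs₁; simp [runOps, Op.run, hr.offset, hr.head, hqh, hst]
  have g20 : s₁.reg 20 = dg A x := by
    subst hs₁; simp [runOps, Op.run, hr.offset, hr.head, hqh, hst, hdg]
  have hr₁ : SideRegs s₁ o h j Q.length := by
    subst hs₁
    exact ⟨by simp [runOps, Op.run, hr.offset], by simp [runOps, Op.run, hr.head],
      by simp [runOps, Op.run, hr.tail], by simp [runOps, Op.run, hr.idx]⟩
  have e1 := hs.fr f1 (by decide) (by decide)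
  have a1 : s₁.arr = s.arr := by subst hs₁; rfl
  clear hs₁
  refine WP.ite (fun hj => ?_) (fun hj => ?_)
  swap
  · -- all neighbours of the head have been processed
    rw [hr₁.idx, g20] at hj
    have hje := hS.idx_le hl
    rw [← hx] at hje
    have hje' : j = dg A x := by omega
    refine WP.blk ?_ ⟨by simp [costOps, Op.cost], ⟨h + 1, 0, Q, ?_, ?_, fun h' => by omega,
      fun _ => ?_⟩, hfr (f1.runOps _ (by decide))⟩
    · simp [okOps, Op.ok, Op.run, hr₁.head, e1.r3, e1.r4]; omega
    · simp only [runOps, Op.run, a1]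
      exact hS.next hH hl (by rw [← hx]; omega)
    · exact ⟨by simp [runOps, Op.run, hr₁.offset], by simp [runOps, Op.run, hr₁.head, e1.r3],
        by simp [runOps, Op.run, hr₁.tail], by simp [runOps, Op.run, e1.r4]⟩
    · rw [progress_succ_head A hl, hje']
  rw [hr₁.idx, g20] at hj
  have hj' : j < (A.nbrs x).length := by rwa [dg_val] at hj
  obtain ⟨y, hy⟩ : ∃ y, y = (A.nbrs x)[j] := ⟨_, rfl⟩
  have hcand := e1.cand x j hj'
  rw [← hy, Nat.add_right_comm, a1] at hcand
  have hxy := mul_add_lt x.2 y.2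
  refine WP.seq (WP.blk ?_ ?_)
  · simp [okOps, Op.ok, Op.run, g18, g19, hr₁.idx, e1.r3, e1.r2, a1, hcand]
    have := x.2
    have := y.2
    omega
  generalize hs₂ : runOps _ s₁ = s₂
  have f2 : Fr [8, 9, 10, 18, 19, 20, 21, 22, 23, 24] [] s s₂ := by
    subst hs₂; exact f1.runOps _ (by decide)
  have q21 : s₂.reg 21 = y := by
    subst hs₂; simp [runOps, Op.run, g19, hr₁.idx, e1.r3, a1, hcand]
  have q22 : s₂.reg 22 = s.arr 5 (x * n + y) := by
    subst hs₂; simp [runOps, Op.run, g18, g19, hr₁.idx, e1.r3, e1.r2, a1, hcand]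
  have q23 : s₂.reg 23 = s.arr 9 y := by
    subst hs₂; simp [runOps, Op.run, g18, g19, hr₁.idx, e1.r3, e1.r2, a1, hcand]
  have hr₂ : SideRegs s₂ o h (j + 1) Q.length := by
    subst hs₂
    exact ⟨by simp [runOps, Op.run, hr₁.offset], by simp [runOps, Op.run, hr₁.head],
      by simp [runOps, Op.run, hr₁.tail], by simp [runOps, Op.run, hr₁.idx, e1.r3]⟩
  have e2 := hs.fr f2 (by decide) (by decide)
  have q6 : s₂.reg 6 = stamp := by rw [f2.reg 6 (by decide), h6]
  have a2 : s₂.arr = s.arr := by subst hs₂; rw [← a1]; rfl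
  clear hs₂
  have hprog : ∀ Q' : List (Fin n), progress A h j Q' + 1 = progress A h (j + 1) Q' := fun _ => rfl
  have hskip : (H.Adj x y → y ∈ Q) → StepPost A H stamp r o h j Q s s₂ := fun hq =>
    ⟨⟨h, j + 1, Q, by rw [a2]; exact hS.skip hl hj' (by rw [← hy]; exact hq), hr₂,
      fun h' => by omega, fun _ => rfl⟩, hfr f2⟩
  refine WP.ite (fun hTy => ?_) (fun hTy => ?_)
  · have hadj : H.Adj x y := by
      by_contra hc
      rw [q22, (hT x y).2 hc, e2.r4] at hTy
      omega
    refine WP.ite (fun hmy => ?_) (fun hmy => ?_)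
    · have hyQ : y ∉ Q := fun hc => by
        rw [q23, q6, hS.mark_mem y hc] at hmy
        omega
      have hlen : Q.length < n := by
        have := (hS.enqueue hl hj' hy hadj hyQ).nodup.length_le_card
        simpa using this
      have hreach : H.Reachable r y := (hS.reach _ (List.getElem_mem hl)).trans hadj.reachable
      refine WP.blk ?_ ⟨by simp [costOps, Op.cost], ⟨h, j + 1, Q ++ [y], ?_, ?_,
        fun h' => by omega, fun _ => ?_⟩, fun i hi => ?_, fun z hz => ?_, fun z => ?_,
        (f2.mono (by decide) (by decide)).runOps _ (by decide)⟩
      · simp [okOps, Op.ok, Op.run, q21, hr₂.offset, hr₂.tail, e2.r3]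
        have := y.2
        omega
      · have := hS.enqueue hl hj' hy hadj hyQ
        simpa [runOps, Op.run, q21, hr₂.offset, hr₂.tail, q6, a2] using this
      · exact ⟨by simp [runOps, Op.run, hr₂.offset], by simp [runOps, Op.run, hr₂.head],
          by simp [runOps, Op.run, hr₂.tail, e2.r3], by simp [runOps, Op.run, hr₂.idx]⟩
      · rw [progress_append A hl.le]; rfl
      · simp [runOps, Op.run, q21, hr₂.offset, hr₂.tail, a2,
          Function.update_of_ne (show i ≠ o + Q.length by omega)]
      · have hzy : (z : ℕ) ≠ y := fun hc => hz (by rw [Fin.ext hc]; exact hreach)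
        simp [runOps, Op.run, q21, a2, Function.update_of_ne hzy]
      · simp only [runOps, Op.run, q21, q6, a2]
        simp [Function.update_apply]
        split_ifs
        · exact le_rfl
        · exact hm z
    · rw [q23, q6] at hmy
      have hmy' := hm y
      have hreach : H.Reachable r y := (hS.reach _ (List.getElem_mem hl)).trans hadj.reachable
      exact WP.blk trivial ⟨by simp [costOps, Op.cost],
        hskip fun _ => hS.mem_mark y hreach (by omega)⟩
  · refine WP.blk trivial ⟨by simp [costOps, Op.cost], hskip fun hadj => absurd ?_ hTy⟩
    rw [q22, e2.r4, (hT x y).1 hadj]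
    have := pos_lower A x y
    omega

end Step

/-! ### The race between the two searches -/

section Duel

variable {n : ℕ} {G H : SimpleGraph (Fin n)}

/-- Exchanges the two searches. -/
def swapOps : List Op :=
  [.add 25 7 4, .add 7 11 4, .add 11 25 4, .add 25 8 4, .add 8 12 4, .add 12 25 4,
    .add 25 9 4, .add 9 13 4, .add 13 25 4, .add 25 10 4, .add 10 14 4, .add 14 25 4]

/-- The registers of the search that is waiting hold its parameters. -/
structure OtherRegs (s : St) (o h j t : ℕ) : Prop where
  offset : s.reg 11 = o
  head : s.reg 12 = h
  tail : s.reg 13 = t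
  idx : s.reg 14 = j

/-- The two searches take turns until the one that has just made a step is complete and has found
at most half of the `R[15]` vertices. -/
def duelCmd : Cmd :=
  .loop 17 3 (stepCmd ;; .blk [.add 24 9 9] ;;
    .ite 8 9 (.blk swapOps) (.ite 15 24 (.blk swapOps) (.blk [.const 17 1])))

theorem swapOps_spec {B U : ℕ} {s : St} {o h j t o' h' j' t' : ℕ} (h4 : s.reg 4 = 0)
    (hr : SideRegs s o h j t) (hr' : OtherRegs s o' h' j' t')
    (hU : o < U ∧ h < U ∧ j < U ∧ t < U ∧ o' < U ∧ h' < U ∧ j' < U ∧ t' < U) :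
    okOps B U swapOps s ∧ SideRegs (runOps swapOps s) o' h' j' t' ∧
      OtherRegs (runOps swapOps s) o h j t := by
  obtain ⟨a1, a2, a3, a4⟩ := hr
  obtain ⟨b1, b2, b3, b4⟩ := hr'
  refine ⟨?_, ⟨?_, ?_, ?_, ?_⟩, ⟨?_, ?_, ?_, ?_⟩⟩
  · simp [swapOps, okOps, Op.ok, Op.run, h4, a1, a2, a3, a4, b1, b2, b3, b4]
    omega
  all_goals simp [swapOps, runOps, Op.run, h4, a1, a2, a3, a4, b1, b2, b3, b4]

/-- The registers that `duelCmd` may change. -/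
abbrev duelRegs : List ℕ := [7, 8, 9, 10, 11, 12, 13, 14, 17, 18, 19, 20, 21, 22, 23, 24, 25]

/-- Two searches in disjoint components, the first of which makes the next step. -/
structure Duel (A : AdjacencyLists G) (H : SimpleGraph (Fin n)) (stamp : ℕ) (s : St)
    (r₁ r₂ : Fin n) (o₁ o₂ h₁ j₁ h₂ j₂ : ℕ) (Q₁ Q₂ : List (Fin n)) : Prop where
  side₁ : Side A H stamp r₁ (s.arr 10) (s.arr 9) o₁ h₁ j₁ Q₁
  side₂ : Side A H stamp r₂ (s.arr 10) (s.arr 9) o₂ h₂ j₂ Q₂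
  regs₁ : SideRegs s o₁ h₁ j₁ Q₁.length
  regs₂ : OtherRegs s o₂ h₂ j₂ Q₂.length
  offsets : o₁ = 0 ∧ o₂ = n ∨ o₁ = n ∧ o₂ = 0
  sep : ¬ H.Reachable r₁ r₂

theorem Duel.bounds {A : AdjacencyLists G} {stamp : ℕ} {s : St}
    {r₁ r₂ : Fin n} {o₁ o₂ h₁ j₁ h₂ j₂ : ℕ} {Q₁ Q₂ : List (Fin n)}
    (hD : Duel A H stamp s r₁ r₂ o₁ o₂ h₁ j₁ h₂ j₂ Q₁ Q₂) :
    o₁ ≤ n ∧ o₂ ≤ n ∧ h₁ ≤ n ∧ h₂ ≤ n ∧ Q₁.length ≤ n ∧ Q₂.length ≤ n ∧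
      j₁ ≤ st (dg A) n ∧ j₂ ≤ st (dg A) n := by
  have h1 : Q₁.length ≤ n := hD.side₁.nodup.length_le_card.trans_eq (Fintype.card_fin n)
  have h2 : Q₂.length ≤ n := hD.side₂.nodup.length_le_card.trans_eq (Fintype.card_fin n)
  have hj : ∀ {stamp r q mark o h j Q}, Side A H stamp r q mark o h j Q → j ≤ st (dg A) n := by
    intro _ _ _ _ _ h j Q hS
    rcases Nat.lt_or_eq_of_le hS.head_le with hh | hh
    · have h3 := hS.idx_le hh
      have h4 : st (dg A) Q[h] + dg A Q[h] < st (dg A) n := st_lt _ Q[h].2 le_rfl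
      omega
    · rw [hS.idx hh]; omega
  have h3 := hD.side₁.head_le
  have h4 := hD.side₂.head_le
  have := hj hD.side₁
  have := hj hD.side₂
  rcases hD.offsets with ⟨rfl, rfl⟩ | ⟨rfl, rfl⟩ <;> omega

/-- The loop invariant of `duelCmd`. The budget `m` is determined by the progress of the search in
the component of `rs`, which is a smaller one: that search makes a step in every second round. -/
def DuelInv (A : AdjacencyLists G) (H : SimpleGraph (Fin n)) (stamp csz : ℕ) (u v rs : Fin n)
    (m : ℕ) (s : St) : Prop :=
  (∀ y : Fin n, s.arr 9 y ≤ stamp) ∧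
    ∃ r₁ r₂ o₁ o₂ h₁ j₁ h₂ j₂ Q₁ Q₂, (r₁ = u ∧ r₂ = v ∨ r₁ = v ∧ r₂ = u) ∧
      Duel A H stamp s r₁ r₂ o₁ o₂ h₁ j₁ h₂ j₂ Q₁ Q₂ ∧
      (s.reg 17 = 0 ∧
          (rs = r₁ ∧ m = 100 * (2 * (compWeight A H rs - progress A h₁ j₁ Q₁) + 1) ∨
          rs = r₂ ∧ m = 100 * (2 * (compWeight A H rs - progress A h₂ j₂ Q₂) + 2)) ∨
        s.reg 17 = 1 ∧ h₁ = Q₁.length ∧ 2 * Q₁.length ≤ csz)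

/-- The time is bounded by the weight of any side `rs` with at most half of the old component: since
the searches alternate, the race is over once the search of `rs` is complete. -/
theorem wp_duel {B U : ℕ} (hU : 16 * B ≤ U) (hB : B = arrLen n) {A : AdjacencyLists G}
    (hH : H ≤ G) {s : St} {stamp csz : ℕ} {u v : Fin n} (hs : Static A s)
    (hT : Table A H (s.arr 5)) (h6 : s.reg 6 = stamp) (h15 : s.reg 15 = csz) (h17 : s.reg 17 = 0)
    (hm : ∀ y : Fin n, s.arr 9 y ≤ stamp)
    {o₁ o₂ h₁ j₁ h₂ j₂ : ℕ} {Q₁ Q₂ : List (Fin n)}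
    (hD : Duel A H stamp s u v o₁ o₂ h₁ j₁ h₂ j₂ Q₁ Q₂)
    {rs : Fin n} (hrs : rs = u ∨ rs = v) (hsm : 2 * componentSize H rs ≤ csz) :
    WP B U duelCmd s fun t s' => t ≤ 100 * (2 * compWeight A H rs + 2) + 2 ∧
      (∃ r, (r = u ∨ r = v) ∧ ∃ (o : ℕ) (Q : List (Fin n)), o ≤ n ∧ Q.Nodup ∧
        (∀ x, x ∈ Q ↔ H.Reachable r x) ∧
        2 * Q.length ≤ csz ∧ s'.reg 7 = o ∧ s'.reg 9 = Q.length ∧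
        ∀ i (hi : i < Q.length), s'.arr 10 (o + i) = Q[i]) ∧
      (∀ y : Fin n, s'.arr 9 y ≤ stamp) ∧ Fr duelRegs [9, 10] s s' := by
  have hLB := st_le_arrLen A
  rw [← hB] at hLB
  have hBn : n * n + n + 1 = B := hB.symm
  -- The variant counts the remaining work of the search of `rs`, which moves in every other round;
  -- the additional round accounts for the case that the other search moves next.
  refine (WP.loop (fun m s' => Fr duelRegs [9, 10] s s' ∧ DuelInv A H stamp csz u v rs m s') ?_
    (m := if rs = u then 100 * (2 * (compWeight A H rs - progress A h₁ j₁ Q₁) + 1) else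
      100 * (2 * (compWeight A H rs - progress A h₂ j₂ Q₂) + 2)) (s := s)
    ⟨.refl _ _ _, hm, u, v, o₁, o₂, h₁, j₁, h₂, j₂, Q₁, Q₂, .inl ⟨rfl, rfl⟩, hD,
      .inl ⟨h17, ?_⟩⟩).mono ?_
  · rintro m s₀ ⟨f, hm, r₁, r₂, o₁, o₂, h₁, j₁, h₂, j₂, Q₁, Q₂, hr, hD, hcase⟩ hlt
    have e := hs.fr f (by decide) (by decide)
    rw [e.r3] at hlt
    rcases hcase with ⟨-, hm₀⟩ | ⟨h, -⟩
    swap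
    · omega
    have hb := hD.bounds
    refine WP.seq ((wp_step hU hB hH e (by rw [f.arr 5 (by decide)]; exact hT)
      (by rw [f.reg 6 (by decide), h6]) hb.1 hD.side₁ hD.regs₁ hm).mono ?_)
    rintro t₁ s₁ ⟨ht₁, ⟨h', j', Q', hS', hr', hfin, hprog⟩, hq, hmk, hm', f1⟩
    have e1 := e.fr f1 (by decide) (by decide)
    have f1' : Fr duelRegs [9, 10] s s₁ := f.trans (f1.mono (by decide) (by decide))
    have hD₁ : Duel A H stamp s₁ r₁ r₂ o₁ o₂ h' j' h₂ j₂ Q' Q₂ := by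
      refine ⟨hS', hD.side₂.congr (fun i hi => hq _ ?_) (fun x hx => hmk x fun hc => hD.sep
        (hc.trans hx.symm)), hr', ?_, hD.offsets, hD.sep⟩
      · rcases hD.offsets with ⟨rfl, rfl⟩ | ⟨rfl, rfl⟩ <;> omega
      · exact ⟨by rw [f1.reg 11 (by decide), hD.regs₂.offset],
          by rw [f1.reg 12 (by decide), hD.regs₂.head],
          by rw [f1.reg 13 (by decide), hD.regs₂.tail],
          by rw [f1.reg 14 (by decide), hD.regs₂.idx]⟩
    have hb' := hD₁.bounds
    refine WP.seq (WP.blk ?_ ?_)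
    · simp [okOps, Op.ok, hr'.tail]; omega
    generalize hs₂ : runOps _ s₁ = s₂
    have f2 : Fr [24] [] s₁ s₂ := by
      subst hs₂; exact (Fr.refl _ _ _).runOps _ (by decide)
    have g24 : s₂.reg 24 = 2 * Q'.length := by
      subst hs₂; simp [runOps, Op.run, hr'.tail]; omega
    clear hs₂
    have f2' : Fr duelRegs [9, 10] s s₂ := f1'.trans (f2.mono (by decide) (by decide))
    have e2 := hs.fr f2' (by decide) (by decide)
    have a2 : ∀ k, s₂.arr k = s₁.arr k := fun k => f2.arr k (by simp)
    have g15 : s₂.reg 15 = csz := by rw [f2'.reg 15 (by decide), h15]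
    have hD₂ : Duel A H stamp s₂ r₁ r₂ o₁ o₂ h' j' h₂ j₂ Q' Q₂ := by
      refine ⟨by rw [a2, a2]; exact hD₁.side₁, by rw [a2, a2]; exact hD₁.side₂,
        ⟨?_, ?_, ?_, ?_⟩, ⟨?_, ?_, ?_, ?_⟩, hD.offsets, hD.sep⟩
      · rw [f2.reg 7 (by decide), hr'.offset]
      · rw [f2.reg 8 (by decide), hr'.head]
      · rw [f2.reg 9 (by decide), hr'.tail]
      · rw [f2.reg 10 (by decide), hr'.idx]
      · rw [f2.reg 11 (by decide), hD₁.regs₂.offset]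
      · rw [f2.reg 12 (by decide), hD₁.regs₂.head]
      · rw [f2.reg 13 (by decide), hD₁.regs₂.tail]
      · rw [f2.reg 14 (by decide), hD₁.regs₂.idx]
    have hm₂ : ∀ y : Fin n, s₂.arr 9 y ≤ stamp := by rw [a2]; exact hm'
    -- the search in the smaller component has made a step, or it is its turn now
    have hswap : ∀ c : ℕ, c ≤ 5 → (rs = r₁ → h' < Q'.length) →
        WP B U (.blk swapOps) s₂ fun t s' => ∃ m',
          t₁ + (costOps [Op.add 24 9 9] + (t + c)) + 2 + m' ≤ m ∧
          Fr duelRegs [9, 10] s s' ∧ DuelInv A H stamp csz u v rs m' s' := by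
      intro c hc hne
      obtain ⟨hok, hr₁', hr₂'⟩ := swapOps_spec (B := B) (U := U) e2.r4 hD₂.regs₁ hD₂.regs₂
        (by have := hD₁.side₁.head_le; omega)
      have f3 : Fr [7, 8, 9, 10, 11, 12, 13, 14, 25] [] s₂ (runOps swapOps s₂) :=
        (Fr.refl _ _ _).runOps _ (by decide)
      have hD₃ : Duel A H stamp (runOps swapOps s₂) r₂ r₁ o₂ o₁ h₂ j₂ h' j' Q₂ Q' :=
        ⟨by rw [f3.arr 9 (by decide), f3.arr 10 (by decide)]; exact hD₂.side₂,
          by rw [f3.arr 9 (by decide), f3.arr 10 (by decide)]; exact hD₂.side₁,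
          hr₁', hr₂', hD.offsets.symm.imp And.symm And.symm, fun h => hD.sep h.symm⟩
      have r17 : (runOps swapOps s₂).reg 17 = 0 := by
        rw [f3.reg 17 (by decide), f2.reg 17 (by decide), f1.reg 17 (by decide)]; omega
      have hcost : costOps swapOps = 12 := rfl
      refine WP.blk hok ?_
      rw [hcost]
      simp only [costOps, Op.cost]
      rcases hm₀ with ⟨hrs, rfl⟩ | ⟨hrs, rfl⟩
      · refine ⟨100 * (2 * (compWeight A H rs - progress A h' j' Q') + 2), ?_,
          f2'.trans (f3.mono (by decide) (by decide)), by rw [f3.arr 9 (by decide)]; exact hm₂,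
          _, _, _, _, _, _, _, _, _, _, hr.symm.imp And.symm And.symm, hD₃, .inl ⟨r17, .inr ⟨hrs, rfl⟩⟩⟩
        have hlt' := hne hrs
        have hh : h₁ < Q₁.length := by
          rcases Nat.lt_or_eq_of_le hD.side₁.head_le with hh | hh
          · exact hh
          · have := hfin hh; omega
        have h1 := hprog hh
        have h2 := hD.side₁.progress_lt hh
        rw [← hrs] at h2
        omega
      · refine ⟨100 * (2 * (compWeight A H rs - progress A h₂ j₂ Q₂) + 1), ?_,
          f2'.trans (f3.mono (by decide) (by decide)), by rw [f3.arr 9 (by decide)]; exact hm₂,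
          _, _, _, _, _, _, _, _, _, _, hr.symm.imp And.symm And.symm, hD₃, .inl ⟨r17, .inl ⟨hrs, rfl⟩⟩⟩
        omega
    refine WP.ite (fun hl => ?_) (fun hl => ?_)
    · rw [hD₂.regs₁.head, hD₂.regs₁.tail] at hl
      exact hswap 1 (by norm_num) fun _ => hl
    rw [hD₂.regs₁.head, hD₂.regs₁.tail] at hl
    have hfull : h' = Q'.length := by have := hS'.head_le; omega
    refine WP.ite (fun hl₂ => ?_) (fun hl₂ => ?_)
    · rw [g15, g24] at hl₂
      refine (hswap 3 (by norm_num) fun hrs => ?_).mono fun t s' ⟨m', h1, h2⟩ => ⟨m', by omega, h2⟩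
      have := componentSize_eq_length hS'.nodup (hS'.mem_iff hfull)
      rw [← hrs] at this
      omega
    · rw [g15, g24] at hl₂
      have f3 : Fr [17] [] s₂ (runOps [.const 17 1] s₂) := (Fr.refl _ _ _).runOps _ (by decide)
      refine WP.blk (by simp [okOps, Op.ok]) ⟨0, ?_, f2'.trans (f3.mono (by decide) (by decide)),
        by rw [f3.arr 9 (by decide)]; exact hm₂, r₁, r₂, o₁, o₂, h', j', h₂, j₂, Q', Q₂, hr,
        ⟨hD₂.side₁, hD₂.side₂, ⟨?_, ?_, ?_, ?_⟩, ⟨?_, ?_, ?_, ?_⟩, hD.offsets, hD.sep⟩,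
        .inr ⟨by simp [runOps, Op.run], hfull, by omega⟩⟩
      · simp only [costOps, Op.cost]
        rcases hm₀ with ⟨-, rfl⟩ | ⟨-, rfl⟩ <;> omega
      · rw [f3.reg 7 (by decide), hD₂.regs₁.offset]
      · rw [f3.reg 8 (by decide), hD₂.regs₁.head]
      · rw [f3.reg 9 (by decide), hD₂.regs₁.tail]
      · rw [f3.reg 10 (by decide), hD₂.regs₁.idx]
      · rw [f3.reg 11 (by decide), hD₂.regs₂.offset]
      · rw [f3.reg 12 (by decide), hD₂.regs₂.head]
      · rw [f3.reg 13 (by decide), hD₂.regs₂.tail]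
      · rw [f3.reg 14 (by decide), hD₂.regs₂.idx]
  · split_ifs with h
    · exact .inl ⟨h, rfl⟩
    · exact .inr ⟨hrs.resolve_left h, rfl⟩
  · rintro t s' ⟨ht, ⟨m, -, f, hm', r₁, r₂, o₁', o₂', h₁', j₁', h₂', j₂', Q₁', Q₂', hr, hD', hcase⟩,
      hge⟩
    have e := hs.fr f (by decide) (by decide)
    rw [e.r3] at hge
    refine ⟨?_, ?_, hm', f⟩
    · split_ifs at ht <;> omega
    · rcases hcase with ⟨h, -⟩ | ⟨-, hfull, hhalf⟩
      · omega
      · exact ⟨r₁, hr.imp And.left And.left, o₁', Q₁', hD'.bounds.1, hD'.side₁.nodup,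
          hD'.side₁.mem_iff hfull, hhalf, hD'.regs₁.offset, hD'.regs₁.tail, hD'.side₁.queue⟩

end Duel

/-! ### Handling a deletion -/

section Delete

variable {n : ℕ} {G H : SimpleGraph (Fin n)}

/-- Gives the new label `R[6]` to the `R[9]` vertices in the queue at offset `R[7]`, and updates the
component sizes in array `8`; the old label is in register `16` and its component size in register
`15`. -/
def relabelCmd : Cmd :=
  .blk [.add 8 4 4] ;;
  .loop 8 9 (.blk [.add 18 7 8, .rd 18 10 18, .wr 7 18 6, .emit 18 6, .add 8 8 3]) ;;
  .blk [.sub 15 15 9, .wr 8 16 15, .wr 8 6 9]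

theorem wp_relabel {B U : ℕ} (hU : 16 * B ≤ U) {s : St} {stamp old csz o : ℕ}
    {Q : List (Fin n)} (hQn : Q.length ≤ n) (ho : o + n ≤ B) (hn : n < B) (hst : stamp < B)
    (hold : old < B)
    (h3 : s.reg 3 = 1) (h4 : s.reg 4 = 0) (h6 : s.reg 6 = stamp)
    (h7 : s.reg 7 = o) (h9 : s.reg 9 = Q.length) (h15 : s.reg 15 = csz) (h16 : s.reg 16 = old)
    (hq : ∀ i (hi : i < Q.length), s.arr 10 (o + i) = Q[i]) (hout : s.out = []) :
    WP B U relabelCmd s fun t s' => t ≤ 20 * Q.length + 20 ∧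
      (∀ x : Fin n, s'.arr 7 x = if x ∈ Q then stamp else s.arr 7 x) ∧
      s'.arr 8 = Function.update (Function.update (s.arr 8) old (csz - Q.length)) stamp Q.length ∧
      s'.out = (Q.map fun x : Fin n => ((x : ℕ), stamp)) ∧
      (∀ k, k ∉ [7, 8] → s'.arr k = s.arr k) ∧ ∀ r, r ∉ [8, 15, 18] → s'.reg r = s.reg r := by
  refine WP.seq (WP.blk ?_ ?_)
  · simp [okOps, Op.ok, h4]; omega
  refine WP.seq ((WP.for Q.length 18 (fun i s' =>
    (∀ x : Fin n, s'.arr 7 x = if x ∈ Q.take i then stamp else s.arr 7 x) ∧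
    s'.out = ((Q.take i).map fun x : Fin n => ((x : ℕ), stamp)) ∧
    (∀ k, k ≠ 7 → s'.arr k = s.arr k) ∧ ∀ r, r ∉ [8, 18] → s'.reg r = s.reg r) ?_
    (i := 0) (by omega) ?_ ?_ ?_).mono ?_)
  · rintro i s₁ hi r8 r9 ⟨h7a, ho₁, ha, hr⟩
    have r3 : s₁.reg 3 = 1 := by rw [hr 3 (by decide), h3]
    have r6 : s₁.reg 6 = stamp := by rw [hr 6 (by decide), h6]
    have r7 : s₁.reg 7 = o := by rw [hr 7 (by decide), h7]
    have hqi : s₁.arr 10 (o + i) = Q[i] := by rw [ha 10 (by decide), hq i hi]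
    have hlt := Q[i].2
    have htake : Q.take (i + 1) = Q.take i ++ [Q[i]] := by
      rw [List.take_add_one, List.getElem?_eq_getElem hi]; rfl
    refine WP.blk ?_ ⟨by simp [costOps, Op.cost], ?_, ?_, fun x => ?_, ?_, fun k hk => ?_,
      fun r hr' => ?_⟩
    · simp [okOps, Op.ok, Op.run, r7, r8, hqi, r3]; omega
    · simp [runOps, Op.run, r8, r3]
    · simp [runOps, Op.run, r9]
    · simp only [runOps, Op.run, r7, r8, hqi, r6, Function.update_self, Function.update_apply]
      rw [htake]
      simp [h7a]
      grind
    · rw [htake, List.map_append, ← ho₁]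
      simp [runOps, Op.run, r7, r8, hqi, r6]
    · simp [runOps, Op.run, Function.update_of_ne hk, ha k hk]
    · simp only [List.mem_cons, List.not_mem_nil, or_false, not_or] at hr'
      simp [runOps, Op.run, Function.update_of_ne hr'.1, Function.update_of_ne hr'.2,
        hr r (by simp; omega)]
  · simp [runOps, Op.run, h4]
  · simp [runOps, Op.run, h9]
  · refine ⟨fun x => by simp [runOps, Op.run], by simp [runOps, Op.run, hout],
      fun k _ => by simp [runOps, Op.run], fun r hr => ?_⟩
    simp only [List.mem_cons, List.not_mem_nil, or_false, not_or] at hr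
    simp [runOps, Op.run, Function.update_of_ne hr.1]
  · rintro t s₁ ⟨ht, -, r9, h7a, ho₁, ha, hr⟩
    have r6 : s₁.reg 6 = stamp := by rw [hr 6 (by decide), h6]
    have r15 : s₁.reg 15 = csz := by rw [hr 15 (by decide), h15]
    have r16 : s₁.reg 16 = old := by rw [hr 16 (by decide), h16]
    rw [List.take_length] at h7a ho₁
    refine WP.blk ?_ ⟨?_, fun x => ?_, ?_, ?_, fun k hk => ?_, fun r hr' => ?_⟩
    · simp [okOps, Op.ok, Op.run, r6, r16]; omega
    · simp only [costOps, Op.cost]; omega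
    · simp [runOps, Op.run, h7a]
    · simp [runOps, Op.run, r15, r9, r16, r6, ha 8 (by decide)]
    · simpa [runOps, Op.run] using ho₁
    · simp only [List.mem_cons, List.not_mem_nil, or_false, not_or] at hk
      simp [runOps, Op.run, Function.update_of_ne hk.2, ha k hk.1]
    · simp only [List.mem_cons, List.not_mem_nil, or_false, not_or] at hr'
      simp [runOps, Op.run, Function.update_of_ne hr'.2.1, hr r (by simp; omega)]

/-- Searches the two components into which a component has been split, and gives a new label to one
of them. -/
def splitCmd : Cmd :=
  .blk [.wr 9 0 6, .wr 9 1 6, .wr 10 4 0, .wr 10 2 1, .add 7 4 4, .add 8 4 4, .add 9 3 4,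
    .add 10 4 4, .add 11 2 4, .add 12 4 4, .add 13 3 4, .add 14 4 4, .rd 16 7 0, .rd 15 8 16,
    .const 17 0] ;;
  duelCmd ;; relabelCmd

/-- The component of `u` or of `v` that wins the race is relabelled, at a cost proportional to the
weight of a side `rs` with at most half of the old component. -/
theorem wp_split {B U : ℕ} (hU : 16 * B ≤ U) (hB : B = arrLen n) {A : AdjacencyLists G}
    (hH : H ≤ G) {s : St} {stamp old csz : ℕ} {u v : Fin n} (hs : Static A s)
    (hT : Table A H (s.arr 5)) (hr0 : s.reg 0 = u) (hr1 : s.reg 1 = v) (h6 : s.reg 6 = stamp)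
    (hst : stamp < B) (hold : old < B) (hlab : s.arr 7 u = old) (hsz : s.arr 8 old = csz)
    (hm : ∀ y : Fin n, s.arr 9 y < stamp) (hsep : ¬ H.Reachable u v)
    (hout : s.out = [])
    {rs : Fin n} (hrs : rs = u ∨ rs = v) (hsm : 2 * componentSize H rs ≤ csz) :
    WP B U splitCmd s fun t s' => ∃ r, (r = u ∨ r = v) ∧ ∃ Q : List (Fin n), Q.Nodup ∧
      (∀ x, x ∈ Q ↔ H.Reachable r x) ∧ 2 * Q.length ≤ csz ∧
      t ≤ 200 * compWeight A H rs + 20 * Q.length + 300 ∧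
      (∀ x : Fin n, s'.arr 7 x = if x ∈ Q then stamp else s.arr 7 x) ∧
      s'.arr 8 = Function.update (Function.update (s.arr 8) old (csz - Q.length)) stamp Q.length ∧
      s'.out = (Q.map fun x : Fin n => ((x : ℕ), stamp)) ∧ (∀ y : Fin n, s'.arr 9 y ≤ stamp) ∧
      (∀ k, k ∉ [7, 8, 9, 10] → s'.arr k = s.arr k) ∧
      ∀ r, r ∉ 15 :: 16 :: duelRegs → s'.reg r = s.reg r := by
  have hLB := st_le_arrLen A
  rw [← hB] at hLB
  have hBn : n * n + n + 1 = B := hB.symm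
  have hnn : n ≤ n * n := Nat.le_mul_self n
  have hun := u.2
  have hvn := v.2
  have huv : (u : ℕ) ≠ v := fun h => hsep (by rw [Fin.ext h])
  refine WP.seq (WP.blk ?_ ?_)
  · simp [okOps, Op.ok, Op.run, hr0, hr1, h6, hs.r2, hs.r3, hs.r4, hlab]
    omega
  generalize hs₁ : runOps _ s = s₁
  have f1 : Fr (15 :: 16 :: duelRegs) [9, 10] s s₁ := by
    subst hs₁; exact (Fr.refl _ _ _).runOps _ (by decide)
  have e1 := hs.fr f1 (by decide) (by decide)
  have a9 : s₁.arr 9 = Function.update (Function.update (s.arr 9) u stamp) v stamp := by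
    subst hs₁; simp [runOps, Op.run, hr0, hr1, h6]
  have a10 : s₁.arr 10 = Function.update (Function.update (s.arr 10) 0 u) n v := by
    subst hs₁; simp [runOps, Op.run, hr0, hr1, hs.r4, hs.r2]
  have r15 : s₁.reg 15 = csz := by
    subst hs₁; simp [runOps, Op.run, hr0, hr1, hs.r4, hs.r2, hlab, hsz]
  have r16 : s₁.reg 16 = old := by
    subst hs₁; simp [runOps, Op.run, hr0, hr1, hs.r4, hs.r2, hlab]
  have r17 : s₁.reg 17 = 0 := by subst hs₁; simp [runOps, Op.run]
  have r6 : s₁.reg 6 = stamp := by rw [f1.reg 6 (by decide), h6]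
  have hmark : ∀ y : Fin n, s₁.arr 9 y = stamp ↔ y = u ∨ y = v := by
    intro y
    have h := hm y
    rw [a9, Function.update_apply, Function.update_apply]
    simp only [Fin.ext_iff]
    split_ifs with h1 h2 <;> simp [*]
    omega
  have hmark' : ∀ y : Fin n, s₁.arr 9 y ≤ stamp := by
    intro y
    have h := hm y
    rw [a9, Function.update_apply, Function.update_apply]
    split_ifs <;> omega
  have hD : Duel A H stamp s₁ u v 0 n 0 0 0 0 [u] [v] := by
    refine ⟨Side.init (fun x hx => ?_) ?_, Side.init (fun x hx => ?_) ?_, ?_, ?_,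
      .inl ⟨rfl, rfl⟩, hsep⟩
    · rw [hmark]
      exact or_iff_left fun h => hsep (h ▸ hx)
    · rw [a10, Function.update_of_ne (by omega), Function.update_self]
    · rw [hmark]
      exact or_iff_right fun h => hsep (h ▸ hx.symm)
    · rw [a10, Function.update_self]
    · subst hs₁
      exact ⟨by simp [runOps, Op.run, hs.r4], by simp [runOps, Op.run, hs.r4],
        by simp [runOps, Op.run, hs.r4, hs.r3], by simp [runOps, Op.run, hs.r4]⟩
    · subst hs₁
      exact ⟨by simp [runOps, Op.run, hs.r4, hs.r2], by simp [runOps, Op.run, hs.r4],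
        by simp [runOps, Op.run, hs.r4, hs.r3], by simp [runOps, Op.run, hs.r4]⟩
  clear hs₁
  refine WP.seq ((wp_duel hU hB hH e1 (by rw [f1.arr 5 (by decide)]; exact hT) r6 r15 r17 hmark'
    hD hrs hsm).mono ?_)
  rintro t₂ s₂ ⟨ht₂, ⟨r, hr, o, Q, ho, hQ, hQr, hQh, g7, g9, hq⟩, hm₂, f2⟩
  have f2' : Fr (15 :: 16 :: duelRegs) [9, 10] s s₂ :=
    f1.trans (f2.mono (by decide) (by decide))
  have e2 := hs.fr f2' (by decide) (by decide)
  have hQn : Q.length ≤ n := hQ.length_le_card.trans_eq (Fintype.card_fin n)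
  refine (wp_relabel (n := n) hU hQn (by omega) (by omega) hst hold e2.r3 e2.r4
    (by rw [f2'.reg 6 (by decide), h6]) g7 g9 (by rw [f2.reg 15 (by decide), r15])
    (by rw [f2.reg 16 (by decide), r16]) hq (by rw [f2'.out, hout])).mono ?_
  rintro t₃ s₃ ⟨ht₃, h7, h8, hout₃, ha, hreg⟩
  refine ⟨r, hr, Q, hQ, hQr, hQh, ?_, fun x => ?_, ?_, hout₃, fun y => ?_, fun k hk => ?_,
    fun q hq => ?_⟩
  · simp only [costOps, Op.cost]; omega
  · rw [h7, f2'.arr 7 (by decide)]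
  · rw [h8, f2'.arr 8 (by decide)]
  · rw [ha 9 (by decide)]; exact hm₂ y
  · simp only [List.mem_cons, List.not_mem_nil, or_false, not_or] at hk
    rw [ha k (by simp; omega), f2'.arr k (by simp; omega)]
  · rw [hreg q (fun h => hq ?_), f2'.reg q hq]
    revert h
    simp
    omega

/-- The invariant between two deletions: the current graph is `H`, and its cc-identifiers are
`ident`. Array `7` holds the identifiers, array `8` the sizes of the components with given
identifiers, and register `6` the largest identifier that has been used. -/
structure Inv (A : AdjacencyLists G) (H : SimpleGraph (Fin n)) (ident : Fin n → ℕ) (s : St) :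
    Prop where
  static : Static A s
  table : Table A H (s.arr 5)
  faces : Faces A H (s.arr 3) (s.arr 4)
  label : ∀ x : Fin n, s.arr 7 x = ident x
  size : ∀ x : Fin n, s.arr 8 (ident x) = componentSize H x
  ident_le : ∀ x, ident x ≤ s.reg 6
  ident_iff : ∀ x y, ident x = ident y ↔ H.Reachable x y
  mark_le : ∀ x : Fin n, s.arr 9 x ≤ s.reg 6
  stamp_le : s.reg 6 + H.edgeSet.ncard ≤ n + G.edgeSet.ncard
  le : H ≤ G

/-- Handles the deletion of the edge with the end points in the registers `0` and `1`: looks up the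
positions of its two darts, removes them from the table, and unites the faces to which they belong;
the component is split if they belong to the same face. -/
def deleteCmd : Cmd :=
  .blk [.mul 20 0 2, .add 20 20 1, .rd 30 5 20, .wr 5 20 4, .mul 21 1 2, .add 21 21 0, .rd 25 5 21,
    .wr 5 21 4, .add 20 30 4, .add 6 6 3] ;;
  unionCmd 3 4 ;;
  .ite 29 3 splitCmd (.blk [])

theorem Table.delete {A : AdjacencyLists G} {T : ℕ → ℕ} (hT : Table A H T) (u v : Fin n) :
    Table A (H.deleteEdges {s(u, v)})
      (Function.update (Function.update T (u * n + v) 0) (v * n + u) 0) := by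
  have key : ∀ x y x' y' : Fin n, (x : ℕ) * n + y = x' * n + y' ↔ x = x' ∧ y = y' :=
    fun x y x' y' => ⟨fun h => by
      obtain ⟨h1, h2⟩ := mul_add_inj y.2 y'.2 h
      exact ⟨Fin.ext h1, Fin.ext h2⟩, by rintro ⟨rfl, rfl⟩; rfl⟩
  intro x y
  rw [Function.update_apply, Function.update_apply]
  simp only [key, SimpleGraph.deleteEdges_adj, Set.mem_singleton_iff, Sym2.eq_iff]
  have h1 := (hT x y).1
  have h2 := (hT x y).2
  split_ifs with h3 h4
  · exact ⟨fun h => absurd (.inr h3) h.2, fun _ => rfl⟩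
  · exact ⟨fun h => absurd (.inl h4) h.2, fun _ => rfl⟩
  · exact ⟨fun h => h1 h.1, fun h => h2 fun hxy => h ⟨hxy, fun hc => hc.elim h4 h3⟩⟩

/-- A deletion unites the classes of the two darts of the edge. -/
theorem Faces.delete {A : AdjacencyLists G} {u v : Fin n} (huv : G.Adj u v)
    {rep rep' : ℕ → ℕ} {par sz : ℕ → ℕ}
    (hrep : ∀ d e : G.Dart, rep (pos A d.fst d.snd) = rep (pos A e.fst e.snd) ↔
      Relation.EqvGen (dualStep A H) d e)
    (hu : UFInv (st (dg A) n) par sz rep')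
    (hm : Merged (st (dg A) n) rep rep' (pos A u v) (pos A v u)) :
    Faces A (H.deleteEdges {s(u, v)}) par sz := by
  refine ⟨rep', hu, fun d e => ?_⟩
  rw [hm _ (pos_lt A d.adj) _ (pos_lt A e.adj)]
  exact (eqvGen_dualStep_deleteEdges A huv d e
    (f := fun d : G.Dart => rep (pos A d.fst d.snd)) hrep).symm

/-- The components after a split, for the end points `r` and `r'` of the edge in a suitable order,
when the vertices in `Q`, which is the component of `r`, get a fresh label. -/
theorem relabel_spec {u v r r' : Fin n} (huv : H.Adj u v)
    (hr : r = u ∧ r' = v ∨ r = v ∧ r' = u)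
    (hsep : ¬ (H.deleteEdges {s(u, v)}).Reachable u v) {Q : List (Fin n)} (hQ : Q.Nodup)
    (hQr : ∀ x, x ∈ Q ↔ (H.deleteEdges {s(u, v)}).Reachable r x) {ident : Fin n → ℕ} {stamp : ℕ}
    (hid : ∀ x y, ident x = ident y ↔ H.Reachable x y) (hlt : ∀ x, ident x < stamp)
    {sz : ℕ → ℕ} (hsz : ∀ x, sz (ident x) = componentSize H x) :
    (∀ x y, (if x ∈ Q then stamp else ident x) = (if y ∈ Q then stamp else ident y) ↔
      (H.deleteEdges {s(u, v)}).Reachable x y) ∧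
    (∀ x, Function.update (Function.update sz (ident u) (componentSize H u - Q.length)) stamp
      Q.length (if x ∈ Q then stamp else ident x) =
        componentSize (H.deleteEdges {s(u, v)}) x) ∧
    ∀ x ∈ Q, componentSize (H.deleteEdges {s(u, v)}) x = Q.length ∧
      componentSize H x = componentSize H u := by
  have hor : ∀ x, H.Reachable u x ↔ x ∈ Q ∨ (H.deleteEdges {s(u, v)}).Reachable r' x := by
    intro x
    rw [reachable_or_of_deleteEdges huv, hQr]
    rcases hr with ⟨rfl, rfl⟩ | ⟨rfl, rfl⟩
    · rfl
    · exact or_comm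
  have hlen : componentSize (H.deleteEdges {s(u, v)}) r = Q.length := componentSize_eq_length hQ hQr
  have hsum : componentSize H u = Q.length + componentSize (H.deleteEdges {s(u, v)}) r' := by
    rw [componentSize_split huv hsep, ← hlen]
    rcases hr with ⟨rfl, rfl⟩ | ⟨rfl, rfl⟩
    · rfl
    · exact Nat.add_comm _ _
  have hle : H.deleteEdges {s(u, v)} ≤ H := SimpleGraph.deleteEdges_le _
  have hmem : ∀ x ∈ Q, componentSize (H.deleteEdges {s(u, v)}) x = Q.length ∧
      componentSize H x = componentSize H u := fun x hx =>
    ⟨by rw [← componentSize_eq_of_reachable ((hQr x).1 hx), hlen],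
      (componentSize_eq_of_reachable ((hor x).2 (.inl hx))).symm⟩
  refine ⟨fun x y => ?_, fun x => ?_, hmem⟩
  · split_ifs with hx hy hy
    · exact iff_of_true rfl (((hQr x).1 hx).symm.trans ((hQr y).1 hy))
    · exact iff_of_false (hlt y).ne' fun h => hy ((hQr y).2 (((hQr x).1 hx).trans h))
    · exact iff_of_false (hlt x).ne fun h => hx ((hQr x).2 (((hQr y).1 hy).trans h.symm))
    · rw [hid]
      refine ⟨fun h => ?_, SimpleGraph.Reachable.mono hle⟩
      by_cases hux : H.Reachable u x
      · exact (((hor x).1 hux).resolve_left hx).symm.trans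
          (((hor y).1 (hux.trans h)).resolve_left hy)
      · exact (reachable_deleteEdges_iff_of_not_reachable huv hux y).2 h
  · split_ifs with hx
    · rw [Function.update_self, (hmem x hx).1]
    · rw [Function.update_of_ne (hlt x).ne, Function.update_apply]
      split_ifs with hxu
      · have h := ((hor x).1 ((hid u x).1 hxu.symm)).resolve_left hx
        rw [← componentSize_eq_of_reachable h, hsum, Nat.add_sub_cancel_left]
      · rw [hsz]
        exact (componentSize_congr fun y => reachable_deleteEdges_iff_of_not_reachable huv
          (fun h => hxu ((hid u x).2 h).symm) y).symm

/-- The answer to a deletion, and the cost: an amount of time proportional to the drop of the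
potential, and a logarithmic amount. -/
def DeletePost (A : AdjacencyLists G) (H : SimpleGraph (Fin n)) (ident : Fin n → ℕ) (u v : Fin n)
    (t : ℕ) (s' : St) : Prop :=
  ∃ ident', Inv A (H.deleteEdges {s(u, v)}) ident' s' ∧
    ListsIdentifiers s'.out {x | ident' x ≠ ident x} ident' ∧
    (∀ x, ident' x ≠ ident x →
      2 * componentSize (H.deleteEdges {s(u, v)}) x ≤ componentSize H x) ∧
    t + 220 * potential A (H.deleteEdges {s(u, v)}) ≤
      220 * potential A H + 60 * (Nat.log 2 (st (dg A) n) + 1) + 400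

/-- If the two faces at the deleted edge are already united, then the edge is a bridge and the
component is split; otherwise the faces are united and no identifier changes. -/
theorem wp_delete {B U : ℕ} (hU : 16 * B ≤ U) (hB : B = arrLen n) {A : AdjacencyLists G}
    (hA : A.IsPlanarEmbedding) {s : St} {ident : Fin n → ℕ} (hI : Inv A H ident s) {u v : Fin n}
    (huv : H.Adj u v) (hr0 : s.reg 0 = u) (hr1 : s.reg 1 = v) (hout : s.out = []) :
    WP B U deleteCmd s (DeletePost A H ident u v) := by
  have hLB := st_le_arrLen A
  rw [← hB] at hLB
  have hBn : n * n + n + 1 = B := hB.symm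
  have hnn : n ≤ n * n := Nat.le_mul_self n
  have hun := u.2
  have hvn := v.2
  have hG := hI.le huv
  have hs := hI.static
  have hstL := st_eq A
  have hst := hI.stamp_le
  have hcard := ncard_edgeSet_deleteEdges huv
  have hk1 := mul_add_lt u.2 v.2
  have hk2 := mul_add_lt v.2 u.2
  have hne : (v : ℕ) * n + u ≠ u * n + v := fun h =>
    huv.ne (Fin.ext (mul_add_inj u.2 v.2 h).2)
  have ht1 := (hI.table u v).1 huv
  have ht2 := (hI.table v u).1 huv.symm
  have hp1 := pos_lt A hG
  have hp2 := pos_lt A hG.symm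
  obtain ⟨rep, hu, hrep⟩ := hI.faces
  refine WP.seq (WP.blk ?_ ?_)
  · simp [okOps, Op.ok, Op.run, hr0, hr1, hs.r2, hs.r3, hs.r4, ht1, ht2,
      Function.update_of_ne hne]
    omega
  generalize hs₁ : runOps _ s = s₁
  have f1 : Fr [6, 20, 21, 25, 30] [5] s s₁ := by
    subst hs₁; exact (Fr.refl _ _ _).runOps _ (by decide)
  have e1 := hs.fr f1 (by decide) (by decide)
  have g6 : s₁.reg 6 = s.reg 6 + 1 := by subst hs₁; simp [runOps, Op.run, hs.r3]
  have g20 : s₁.reg 20 = pos A u v := by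
    subst hs₁; simp [runOps, Op.run, hr0, hr1, hs.r2, hs.r4, ht1]
  have g25 : s₁.reg 25 = pos A v u := by
    subst hs₁; simp [runOps, Op.run, hr0, hr1, hs.r2, hs.r4, ht2, Function.update_of_ne hne]
  have a5 : s₁.arr 5 = Function.update (Function.update (s.arr 5) (u * n + v) 0) (v * n + u) 0 := by
    subst hs₁; simp [runOps, Op.run, hr0, hr1, hs.r2, hs.r4]
  clear hs₁
  have hT' : Table A (H.deleteEdges {s(u, v)}) (s₁.arr 5) := by rw [a5]; exact hI.table.delete u v
  refine WP.seq ((wp_union (N := st (dg A) n) (rep := rep) hU hLB (by norm_num) (by norm_num)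
    (by norm_num) (by rw [f1.arr 3 (by decide), f1.arr 4 (by decide)]; exact hu)
    (by rw [g20]; exact hp1) (by rw [g25]; exact hp2) e1.r4).mono ?_)
  rintro t₂ s₂ ⟨ht₂, ⟨rep', hu', hm, -⟩, g29, f2⟩
  rw [g20, g25] at hm g29
  have hF' : Faces A (H.deleteEdges {s(u, v)}) (s₂.arr 3) (s₂.arr 4) :=
    Faces.delete hG hrep hu' hm
  have hcut : rep (pos A u v) = rep (pos A v u) ↔
      ¬ (H.deleteEdges {s(u, v)}).Reachable u v := by
    rw [hA.not_reachable_iff hI.le huv]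
    exact hrep ⟨(u, v), hG⟩ ⟨(v, u), hG.symm⟩
  have f2' : Fr [6, 20, 21, 22, 23, 24, 25, 26, 27, 28, 29, 30] [3, 4, 5] s s₂ :=
    (f1.mono (by decide) (by decide)).trans (f2.mono (by decide) (by decide))
  have e2 := hs.fr f2' (by decide) (by decide)
  have q6 : s₂.reg 6 = s.reg 6 + 1 := by rw [f2.reg 6 (by decide), g6]
  have hT₂ : Table A (H.deleteEdges {s(u, v)}) (s₂.arr 5) := by
    rw [f2.arr 5 (by decide)]; exact hT'
  have hle : H.deleteEdges {s(u, v)} ≤ H := SimpleGraph.deleteEdges_le _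
  refine WP.ite (fun hl => ?_) (fun hl => ?_)
  · rw [e2.r3, g29] at hl
    have hsep := hcut.1 (by by_contra h; rw [if_neg h] at hl; omega)
    obtain ⟨rs, hrs, hsm⟩ : ∃ rs, (rs = u ∨ rs = v) ∧
        2 * componentSize (H.deleteEdges {s(u, v)}) rs ≤ componentSize H u := by
      rw [componentSize_split huv hsep]
      rcases le_total (componentSize (H.deleteEdges {s(u, v)}) u)
        (componentSize (H.deleteEdges {s(u, v)}) v) with h | h
      · exact ⟨u, .inl rfl, by omega⟩
      · exact ⟨v, .inr rfl, by omega⟩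
    have hcsz : ∀ r, (r = u ∨ r = v) → componentSize H r = componentSize H u := by
      rintro r (rfl | rfl)
      · rfl
      · exact (componentSize_eq_of_reachable huv.reachable).symm
    have hidu := hI.ident_le u
    refine (wp_split (stamp := s.reg 6 + 1) (old := ident u) (csz := componentSize H u) hU hB (hle.trans hI.le) e2 hT₂
      (by rw [f2'.reg 0 (by decide), hr0]) (by rw [f2'.reg 1 (by decide), hr1]) q6 (by omega)
      (by omega) (by rw [f2'.arr 7 (by decide), hI.label])
      (by rw [f2'.arr 8 (by decide), hI.size u])
      (fun y => by rw [f2'.arr 9 (by decide)]; have := hI.mark_le y; omega) hsep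
      (by rw [f2'.out, hout]) hrs hsm).mono ?_
    rintro t₃ s₃ ⟨r, hr, Q, hQ, hQr, hQh, ht₃, h7, h8, hout₃, hm₃, ha, hreg⟩
    have hlt : ∀ x, ident x < s.reg 6 + 1 := fun x => by have := hI.ident_le x; omega
    obtain ⟨r', hr'⟩ : ∃ r', r = u ∧ r' = v ∨ r = v ∧ r' = u := by
      rcases hr with rfl | rfl
      · exact ⟨v, .inl ⟨rfl, rfl⟩⟩
      · exact ⟨u, .inr ⟨rfl, rfl⟩⟩
    obtain ⟨hs1, hs2, hs3⟩ := relabel_spec huv hr' hsep hQ hQr hI.ident_iff hlt hI.size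
    have hchange : ∀ x, (if x ∈ Q then s.reg 6 + 1 else ident x) ≠ ident x ↔ x ∈ Q := by
      intro x
      split_ifs with hx
      · exact iff_of_true (hlt x).ne' hx
      · exact iff_of_false (fun h => h rfl) hx
    have q6' : s₃.reg 6 = s.reg 6 + 1 := by rw [hreg 6 (by decide), q6]
    refine ⟨fun x => if x ∈ Q then s.reg 6 + 1 else ident x, ⟨⟨?_, ?_, ?_, ?_, ?_, ?_⟩, ?_, ?_, ?_,
      ?_, ?_, hs1, ?_, ?_, hle.trans hI.le⟩, ⟨Q, hQ, fun x => (hchange x).symm, ?_⟩,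
      fun x hx => ?_, ?_⟩
    · rw [hreg 2 (by decide), e2.r2]
    · rw [hreg 3 (by decide), e2.r3]
    · rw [hreg 4 (by decide), e2.r4]
    · rw [ha 0 (by decide)]; exact e2.deg
    · rw [ha 11 (by decide)]; exact e2.start
    · rw [ha 13 (by decide)]; exact e2.cand
    · rw [ha 5 (by decide)]; exact hT₂
    · rw [ha 3 (by decide), ha 4 (by decide)]; exact hF'
    · intro x; rw [h7, f2'.arr 7 (by decide), hI.label]
    · intro x
      rw [h8, f2'.arr 8 (by decide)]
      exact hs2 x
    · intro x
      rw [q6']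
      split_ifs
      · exact le_rfl
      · exact (hlt x).le
    · rw [q6']; exact hm₃
    · rw [q6']; omega
    · rw [hout₃]
      exact List.map_congr_left fun x hx => by simp only [if_pos hx]
    · have hx := (hchange x).1 hx
      rw [(hs3 x hx).1, (hs3 x hx).2]
      exact hQh
    · have hp1 := potential_add_compWeight_le A hle (r := rs) (by rw [hcsz rs hrs]; exact hsm)
      have hp2 := potential_add_compWeight_le A hle (r := r)
        (by rw [hcsz r hr, componentSize_eq_length hQ hQr]; exact hQh)
      have hp3 := sum_weight_le_compWeight A hQ fun x hx => (hQr x).1 hx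
      have hp4 := length_le_sum_weight A Q
      simp only [costOps, Op.cost]
      omega
  · rw [e2.r3, g29] at hl
    have hcon : (H.deleteEdges {s(u, v)}).Reachable u v := by
      by_contra h
      rw [if_pos (hcut.2 h)] at hl
      omega
    have hreach := reachable_deleteEdges_iff hcon
    refine WP.blk trivial ⟨ident, ⟨e2, hT₂, hF', ?_, ?_, ?_, ?_, ?_, ?_, hle.trans hI.le⟩,
      ⟨[], List.nodup_nil, fun x => by simp, by simp only [runOps]; rw [f2'.out, hout]; rfl⟩,
      fun x hx => absurd rfl hx, ?_⟩
    · intro x; simp only [runOps]; rw [f2'.arr 7 (by decide), hI.label]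
    · intro x
      simp only [runOps]
      rw [f2'.arr 8 (by decide), hI.size]
      exact componentSize_congr fun y => (hreach x y).symm
    · intro x
      have := hI.ident_le x
      simp only [runOps]
      omega
    · intro x y; rw [hI.ident_iff, hreach]
    · intro x
      have := hI.mark_le x
      simp only [runOps]
      rw [f2'.arr 9 (by decide)]
      omega
    · simp only [runOps]; omega
    · have := potential_mono A hle
      simp only [costOps, Op.cost]
      omega

end Delete

/-! ### Preprocessing -/

section Init

variable {n : ℕ} {G : SimpleGraph (Fin n)}

/-- Emits every vertex with its root as identifier, and fills the arrays `7` and `8`. -/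
def outputCmd : Cmd :=
  .blk [.add 8 4 4] ;;
  .loop 8 2 (.blk [.add 20 8 4] ;; findCmd 1 ;;
    .blk [.wr 7 8 20, .emit 8 20, .rd 16 2 20, .wr 8 20 16, .add 8 8 3]) ;;
  .blk [.add 6 2 4]

theorem wp_output {B U : ℕ} (hU : 16 * B ≤ U) (hn : n < B) {s : St} {rep : ℕ → ℕ}
    (hu : UFInv n (s.arr 1) (s.arr 2) rep) (h2 : s.reg 2 = n) (h3 : s.reg 3 = 1)
    (h4 : s.reg 4 = 0) :
    WP B U outputCmd s fun t s' => t ≤ n * (10 * (Nat.log 2 n + 1) + 25) + 10 ∧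
      (∀ v < n, s'.arr 7 v = rep v ∧ s'.arr 8 (rep v) = s.arr 2 (rep v)) ∧
      s'.out = s.out ++ (List.range n).map (fun v => (v, rep v)) ∧ s'.reg 6 = n ∧
      (∀ k, k ∉ [7, 8] → s'.arr k = s.arr k) ∧
      ∀ r, r ∉ [6, 8, 16, 20, 21, 22, 23, 24] → s'.reg r = s.reg r := by
  refine WP.seq (WP.blk ?_ ?_)
  · simp [okOps, Op.ok, h4]; omega
  refine WP.seq ((WP.for n (10 * (Nat.log 2 n + 1) + 20) (fun i s' =>
    (∀ v < i, s'.arr 7 v = rep v ∧ s'.arr 8 (rep v) = s.arr 2 (rep v)) ∧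
    s'.out = s.out ++ (List.range i).map (fun v => (v, rep v)) ∧
    (∀ k, k ∉ [7, 8] → s'.arr k = s.arr k) ∧
    ∀ r, r ∉ [8, 16, 20, 21, 22, 23, 24] → s'.reg r = s.reg r) ?_
    (i := 0) (by omega) ?_ ?_ ?_).mono ?_)
  · rintro i s₁ hi r8 r2 ⟨hl, ho, ha, hr⟩
    have r3 : s₁.reg 3 = 1 := by rw [hr 3 (by decide), h3]
    have r4 : s₁.reg 4 = 0 := by rw [hr 4 (by decide), h4]
    refine WP.seq (WP.blk ?_ ?_)
    · simp [okOps, Op.ok, r4, r8]; omega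
    generalize hs₂ : runOps _ s₁ = s₂
    have f2 : Fr [20, 21, 22, 23, 24] [] s₁ s₂ := by
      subst hs₂; exact (Fr.refl _ _ _).runOps _ (by decide)
    have g20 : s₂.reg 20 = i := by subst hs₂; simp [runOps, Op.run, r8, r4]
    clear hs₂
    refine WP.seq ((wp_find (ks := 2) (rep := rep) hU hn.le (by norm_num)
      (by rw [f2.arr 1 (by decide), f2.arr 2 (by decide), ha 1 (by decide), ha 2 (by decide)]
          exact hu) (by rw [g20]; exact hi) (by rw [f2.reg 4 (by decide), r4])).mono ?_)
    rintro t₃ s₃ ⟨ht₃, q20, f3⟩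
    rw [g20] at q20
    have f3' := f2.trans f3
    have q8 : s₃.reg 8 = i := by rw [f3'.reg 8 (by decide), r8]
    have q3 : s₃.reg 3 = 1 := by rw [f3'.reg 3 (by decide), r3]
    have a2 : s₃.arr 2 = s.arr 2 := by rw [f3'.arr 2 (by decide), ha 2 (by decide)]
    have hri := hu.rep_lt i hi
    refine WP.blk ?_ ⟨?_, ?_, ?_, fun v hv => ⟨?_, ?_⟩, ?_, fun k hk => ?_, fun r hr' => ?_⟩
    · simp [okOps, Op.ok, Op.run, q8, q20, q3, a2]
      omega
    · simp only [costOps, Op.cost]; omega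
    · simp [runOps, Op.run, q8, q3]
    · simp [runOps, Op.run, f3'.reg 2 (by decide), r2]
    · simp [runOps, Op.run, q8, q20, f3'.arr 7 (by decide), Function.update_apply]
      split_ifs with h
      · rw [h]
      · exact (hl v (by omega)).1
    · simp [runOps, Op.run, q8, q20, a2, f3'.arr 8 (by decide), Function.update_apply]
      split_ifs with h
      · rw [h]
      · refine (hl v ?_).2
        rcases Nat.lt_succ_iff_lt_or_eq.1 hv with h' | rfl
        · exact h'
        · exact absurd rfl h
    · rw [List.range_succ, List.map_append, ← List.append_assoc, ← ho, ← f3'.out]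
      simp [runOps, Op.run, q8, q20]
    · rw [← ha k hk, ← f3'.arr k (by simp)]
      simp only [List.mem_cons, List.not_mem_nil, or_false, not_or] at hk
      simp [runOps, Op.run, Function.update_of_ne hk.1, Function.update_of_ne hk.2]
    · rw [← hr r hr', ← f3'.reg r (fun h => hr' ?_)]
      · simp only [List.mem_cons, List.not_mem_nil, or_false, not_or] at hr'
        simp [runOps, Op.run, Function.update_of_ne hr'.1, Function.update_of_ne hr'.2.1]
      · simp at h ⊢; omega
  · simp [runOps, Op.run, h4]
  · simp [runOps, Op.run, h2]
  · refine ⟨fun v hv => by omega, by simp [runOps, Op.run], fun k _ => rfl, fun r hr => ?_⟩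
    simp only [List.mem_cons, List.not_mem_nil, or_false, not_or] at hr
    simp [runOps, Op.run, Function.update_of_ne hr.1]
  · rintro t s₁ ⟨ht, -, r2, hl, ho, ha, hr⟩
    have r4 : s₁.reg 4 = 0 := by rw [hr 4 (by decide), h4]
    refine WP.blk ?_ ⟨?_, hl, ho, ?_, ha, fun r hr' => ?_⟩
    · simp [okOps, Op.ok, r2, r4]; omega
    · simp only [costOps, Op.cost]
      have : n * (10 * (Nat.log 2 n + 1) + 20 + 2) ≤ n * (10 * (Nat.log 2 n + 1) + 25) :=
        Nat.mul_le_mul_left _ (by omega)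
      rw [Nat.sub_zero] at ht
      omega
    · simp [runOps, Op.run, r2, r4]
    · simp only [List.mem_cons, List.not_mem_nil, or_false, not_or] at hr'
      simp [runOps, Op.run, Function.update_of_ne hr'.1, hr r (by simp; omega)]

/-- The candidate for an embedding that the input lists describe. -/
noncomputable def inputCandidate (A : AdjacencyLists G) (q : ℕ) : ℕ :=
  if q < st (dg A) n ∧ own (dg A) q ≠ 0 then inp A q else 0

theorem holds_inputCandidate (A : AdjacencyLists G) : Holds A (inputCandidate A) :=
  fun v j hj => by
  have hj' : j < dg A v := by rwa [dg_val]
  have h1 : st (dg A) v + (1 + j) < st (dg A) n := st_lt _ v.2 (by omega)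
  rw [inputCandidate, if_pos ⟨by omega, by rw [own_dart _ hj']; omega⟩]
  exact holds_inp A v j hj

theorem inputCandidate_lt (A : AdjacencyLists G) (hn : 0 < n) (q : ℕ) : inputCandidate A q < n := by
  unfold inputCandidate
  split_ifs with h
  · exact inp_lt A h.1 h.2
  · exact hn

/-- The sizes kept by union by size serve as the component sizes. -/
theorem componentSize_eq_sz {par sz rep : ℕ → ℕ} (h : UFInv n par sz rep)
    (hrep : ∀ u v : Fin n, rep u = rep v ↔ G.Reachable u v) (v : Fin n) :
    sz (rep v) = componentSize G v := by
  classical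
  rw [h.sz_root _ (h.rep_lt v v.2) (h.root_rep v v.2), componentSize,
    Set.ncard_eq_toFinset_card']
  symm
  refine Finset.card_bij (fun u _ => (u : ℕ)) (fun u hu => ?_) (fun _ _ _ _ h => Fin.ext h)
    fun u hu => ?_
  · rw [Set.mem_toFinset] at hu
    rw [Finset.mem_filter, Finset.mem_range]
    exact ⟨u.2, ((hrep v u).2 hu).symm⟩
  · rw [Finset.mem_filter, Finset.mem_range] at hu
    refine ⟨⟨u, hu.1⟩, ?_, rfl⟩
    rw [Set.mem_toFinset]
    exact (hrep v ⟨u, hu.1⟩).1 hu.2.symm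

/-- The preprocessing. -/
def initCmd : Cmd := scanCmd ;; componentsCmd ;; searchCmd ;; outputCmd

/-- The time bound is only claimed for lists that form a planar embedding; then the search for an
embedding stops at the first candidate, which is the input. -/
theorem wp_init {B U : ℕ} (hU : 16 * B ≤ U) (hB : B = arrLen n) (A : AdjacencyLists G)
    (hG : IsPlanar G) {s : St} (h0 : s.arr 0 = inp A) (hz : ∀ k, k ≠ 0 → s.arr k = fun _ => 0)
    (hout : s.out = []) :
    WP B U initCmd s fun t s' => ∃ (A' : AdjacencyLists G) (ident : Fin n → ℕ),
      A'.IsPlanarEmbedding ∧ Inv A' G ident s' ∧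
      s'.out = (List.finRange n).map (fun v : Fin n => ((v : ℕ), ident v)) ∧
      (A.IsPlanarEmbedding → t ≤ 600 * (st (dg A) n * (Nat.log 2 (st (dg A) n) + 1))) := by
  have hLB := st_le_arrLen A
  rw [← hB] at hLB
  have hBn : n * n + n + 1 = B := hB.symm
  have hnn : n ≤ n * n := Nat.le_mul_self n
  refine WP.seq ((wp_scan hU hB A h0 hz).mono ?_)
  rintro t₁ s₁ ⟨ht₁, g2, g3, g4, g5, g9, hS, g11, gz, go⟩
  refine WP.seq ((wp_components hU hB A g2 g3 g4 g5 hS).mono ?_)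
  rintro t₂ s₂ ⟨ht₂, g19, ⟨rep, hu, hrep⟩, f2⟩
  have e1 : Env A s₁ := ⟨g2, g3, g4, g5, hS.input, g11,
    fun p hp => by rw [hS.owner, if_pos hp], hS.adj⟩
  have e2 := e1.fr f2 (by decide) (by decide)
  have c2 : s₂.arr 13 = inputCandidate A := by
    rw [f2.arr 13 (by decide)]; funext q; exact hS.cand q
  -- if the input is itself an embedding, then the first candidate is the right one
  obtain ⟨A₀, hA₀, hAA₀⟩ : ∃ A₀ : AdjacencyLists G, A₀.IsPlanarEmbedding ∧
      (A.IsPlanarEmbedding → A₀ = A) := by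
    by_cases h : A.IsPlanarEmbedding
    · exact ⟨A, h, fun _ => rfl⟩
    · exact ⟨hG.choose, hG.choose_spec, fun h' => absurd h' h⟩
  refine WP.seq ((wp_search hU hB A e2 (fun hn p _ => by rw [c2]; exact inputCandidate_lt A hn p)
    (fun i => by rw [f2.arr 5 (by decide), gz 5 (by decide)])
    (by rw [f2.reg 9 (by decide), g9]) g19 hA₀ (holds_inputCandidate A₀)
    (fun hn p _ => inputCandidate_lt A₀ hn p)).mono ?_)
  rintro t₃ s₃ ⟨ht₃, ⟨A', hA', hc, hT, hF⟩, f3⟩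
  have e3 := e2.fr f3 (by decide) (by decide)
  have hd := dg_eq A A'
  refine (wp_output hU (by omega) (rep := rep)
    (by rw [f3.arr 1 (by decide), f3.arr 2 (by decide)]; exact hu) e3.r2 e3.r3 e3.r4).mono ?_
  rintro t₄ s₄ ⟨ht₄, hl, ho, r6, ha, hr⟩
  have hcomp := componentSize_eq_sz hu hrep
  refine ⟨A', fun v => rep v, hA', ⟨⟨?_, ?_, ?_, ?_, ?_, ?_⟩, ?_, ?_, ?_, ?_, ?_, hrep, ?_, ?_,
    le_rfl⟩, ?_, fun hA => ?_⟩
  · rw [hr 2 (by decide), e3.r2]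
  · rw [hr 3 (by decide), e3.r3]
  · rw [hr 4 (by decide), e3.r4]
  · intro v hv
    rw [ha 0 (by decide), e3.input, hd, inp_st A hv]
  · rw [ha 11 (by decide), hd]; exact e3.start
  · rw [ha 13 (by decide)]; exact hc
  · rw [ha 5 (by decide)]; exact hT
  · rw [ha 3 (by decide), ha 4 (by decide)]; exact hF
  · exact fun v => (hl v v.2).1
  · intro v
    rw [(hl v v.2).2, f3.arr 2 (by decide), hcomp]
  · intro v
    rw [r6]
    exact (hu.rep_lt v v.2).le
  · intro v
    rw [ha 9 (by decide), f3.arr 9 (by decide), f2.arr 9 (by decide), gz 9 (by decide)]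
    exact Nat.zero_le _
  · rw [r6]
  · rw [ho, f3.out, f2.out, go, hout, List.nil_append, ← List.map_coe_finRange_eq_range,
      List.map_map]
    rfl
  · rw [hAA₀ hA, c2] at ht₃
    have hdist : ∀ M v, cyclicDist M v v = 0 := fun M v => by simp [cyclicDist]
    rw [hdist] at ht₃
    have hnL := st_eq A
    have hlog : Nat.log 2 n ≤ Nat.log 2 (st (dg A) n) := Nat.log_mono_right (by omega)
    set L := st (dg A) n
    set l := Nat.log 2 L + 1
    have h1 : L * (60 * (Nat.log 2 n + 1) + 20) ≤ L * (60 * l + 20) :=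
      Nat.mul_le_mul_left _ (by omega)
    have h2 : n * (10 * (Nat.log 2 n + 1) + 25) ≤ L * (10 * l + 25) :=
      Nat.mul_le_mul (by omega) (by omega)
    have h3 : L * 1 ≤ L * l := Nat.mul_le_mul_left _ (by omega)
    have e1 : L * (60 * l + 20) = 60 * (L * l) + 20 * L := by ring
    have e2 : L * (10 * l + 25) = 10 * (L * l) + 25 * L := by ring
    have e3 : L * (60 * l + 160) = 60 * (L * l) + 160 * L := by ring
    rw [e1] at h1
    rw [e2] at h2
    rw [e3] at ht₃
    omega

end Init

/-! ### The program -/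

section Program

variable {n : ℕ} {G H : SimpleGraph (Fin n)}

/-- Puts the array length `n * n + n + 1` into register `2`. -/
def prologue : List Instr := [.load 3 3, .mul 2 3 3, .add 2 2 3, .const 3 1, .add 2 2 3]

/-- The position at which the program waits for deletions. -/
def waitPos : ℕ := 5 + initCmd.size

/-- The program: the preprocessing, and a loop that handles one deletion after another. -/
def connectivityProgram : Program :=
  prologue ++ (initCmd.code 5 ++ (.await :: (deleteCmd.code (waitPos + 1) ++ [.jump waitPos])))

theorem connectivityProgram_eq : connectivityProgram =
    (prologue ++ (initCmd.code 5 ++ [.await])) ++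
      (deleteCmd.code (waitPos + 1) ++ [.jump waitPos]) := by
  simp [connectivityProgram]

theorem getElem?_waitPos : connectivityProgram[waitPos]? = some .await := by
  refine getElem?_of_eq_append (pre := prologue ++ initCmd.code 5)
    (l := deleteCmd.code (waitPos + 1) ++ [.jump waitPos]) ?_ ?_
  · simp [connectivityProgram]
  · simp [waitPos, prologue, Cmd.code_length]; omega

theorem getElem?_jump :
    connectivityProgram[waitPos + 1 + deleteCmd.size]? = some (.jump waitPos) := by
  refine getElem?_of_eq_append (l := [])
    (pre := prologue ++ (initCmd.code 5 ++ (.await :: deleteCmd.code (waitPos + 1)))) ?_ ?_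
  · simp [connectivityProgram]
  · simp [waitPos, prologue, Cmd.code_length]; omega

theorem inp_le (A : AdjacencyLists G) (i : ℕ) : inp A i ≤ n := by
  have h : ∀ x ∈ A.encode, x ≤ n := by
    intro x hx
    rw [AdjacencyLists.encode, List.mem_cons, List.mem_flatMap] at hx
    rcases hx with rfl | ⟨v, -, hx⟩
    · exact le_rfl
    · rw [List.mem_cons, List.mem_map] at hx
      rcases hx with rfl | ⟨u, -, rfl⟩
      · exact (A.nodup v).length_le_card.trans_eq (Fintype.card_fin n)
      · exact u.2.le
  rw [inp, List.getD_eq_getElem?_getD]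
  by_cases hi : i < A.encode.length
  · rw [List.getElem?_eq_getElem hi]
    exact h _ (List.getElem_mem hi)
  · rw [List.getElem?_eq_none (by omega)]
    exact Nat.zero_le _

/-- The state of the structured language before the preprocessing. -/
noncomputable def startState (A : AdjacencyLists G) : St where
  reg := fun _ => 0
  arr := fun k i => if k = 0 then inp A i else 0
  out := []

theorem steps_prologue {w B : ℕ} (hB : B = arrLen n) (hw : 16 * B ≤ 2 ^ w) (A : AdjacencyLists G) :
    ∃ c, Steps connectivityProgram w (Config.start A.encode) 5 c ∧ Sim w B (startState A) c ∧
      c.pc = 5 := by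
  have hBn : n * n + n + 1 = B := hB.symm
  have hLB := st_le_arrLen A
  rw [← hB] at hLB
  have hn : inp A 0 = n := inp_zero A
  have hP : ∀ k (h : k < 5), connectivityProgram[k]? = some (prologue[k]'h) := by
    intro k h
    rw [connectivityProgram, List.getElem?_append_left h, List.getElem?_eq_getElem h]
  have m1 : n % 2 ^ w = n := Nat.mod_eq_of_lt (by omega)
  have m2 : (n * n) % 2 ^ w = n * n := Nat.mod_eq_of_lt (by omega)
  have m3 : (n * n + n) % 2 ^ w = n * n + n := Nat.mod_eq_of_lt (by omega)
  have m4 : 1 % 2 ^ w = 1 := Nat.mod_eq_of_lt (by omega)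
  have m5 : (n * n + n + 1) % 2 ^ w = n * n + n + 1 := Nat.mod_eq_of_lt (by omega)
  have hn' : (Config.start A.encode).mem 0 = n := hn
  refine ⟨_, .step (hP 0 (by norm_num)) rfl (.step (hP 1 (by norm_num)) rfl
    (.step (hP 2 (by norm_num)) rfl (.step (hP 3 (by norm_num)) rfl
    (.step (hP 4 (by norm_num)) rfl (.refl _))))), ⟨fun r => ?_, ?_, fun k hk i hi => ?_, rfl,
    fun r => ?_, fun a => ?_⟩, rfl⟩
  · have h2 := Op.mreg_ne_two r
    have h3 := Op.mreg_ne_three r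
    simp [Config.setReg, Config.start, startState, Function.update_of_ne h2,
      Function.update_of_ne h3]
  · have e : (Config.start A.encode).reg 3 = 0 := rfl
    simp only [Config.setReg, Function.update_apply, Nat.reduceEqDiff, reduceIte, e, hn', m1, m2,
      m3, m4, m5]
    exact hBn
  · change inp A (k * B + i) = if k = 0 then inp A i else 0
    split_ifs with h
    · rw [h, Nat.zero_mul, Nat.zero_add]
    · refine inp_of_le A ?_
      have : 1 * B ≤ k * B := Nat.mul_le_mul_right B (by omega)
      omega
  · simp only [Config.setReg, Config.start, Function.update_apply]
    split_ifs <;> first | exact Nat.mod_lt _ (by positivity) | positivity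
  · change inp A a < 2 ^ w
    have := inp_le A a
    omega

/-- The configurations in which the program waits for the next deletion. -/
structure Waiting (A : AdjacencyLists G) (w : ℕ) (c : Config) (H : SimpleGraph (Fin n))
    (ident : Fin n → ℕ) : Prop where
  pc : c.pc = waitPos
  state : ∃ s, Sim w (arrLen n) s c ∧ Inv A H ident s

theorem arrLen_pos (n : ℕ) : 0 < arrLen n := Nat.succ_pos _

/-- The preprocessing reaches the first request. The embedding `A'` that it found may differ from the
given lists `A`, but the degrees are those of `A`. -/
theorem exists_runs_init {w : ℕ} (hw : 16 * arrLen n ≤ 2 ^ w) (A : AdjacencyLists G)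
    (hG : IsPlanar G) :
    ∃ (t : ℕ) (c : Config) (A' : AdjacencyLists G) (ident : Fin n → ℕ),
      Runs connectivityProgram w (Config.start A.encode) t c ∧ A'.IsPlanarEmbedding ∧
      Waiting A' w c G ident ∧
      c.out = (List.finRange n).map (fun v : Fin n => ((v : ℕ), ident v)) ∧
      (A.IsPlanarEmbedding →
        t ≤ 600 * (st (dg A) n * (Nat.log 2 (st (dg A) n) + 1)) + 6) := by
  obtain ⟨c₁, h1, h2, h3⟩ := steps_prologue rfl hw A
  obtain ⟨t, s', he, A', ident, hA', hI, hout, ht⟩ := wp_init (U := 2 ^ w) hw rfl A hG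
    (s := startState A) (by funext i; simp [startState])
    (fun k hk => by funext i; simp [startState, hk]) rfl
  obtain ⟨c₂, h4, h5, h6⟩ := he.steps hw (arrLen_pos n) h2
    (P := connectivityProgram) (pre := prologue) (by rw [h3]; rfl) (by rw [h3]; rfl)
  have hpc : c₂.pc = waitPos := by rw [h6, h3]; rfl
  refine ⟨_, c₂, A', ident, h1.runs (h4.runs (.wait (by rw [hpc]; exact getElem?_waitPos))), hA',
    ⟨hpc, s', h5, hI⟩, by rw [h5.out, hout], fun h => ?_⟩
  have := ht h
  omega

/-- A deletion leads from one request to the next; the bound on its time is amortized against the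
potential. -/
theorem Waiting.delete {A : AdjacencyLists G} (hA : A.IsPlanarEmbedding) {w : ℕ}
    (hw : 16 * arrLen n ≤ 2 ^ w) {c : Config} {ident : Fin n → ℕ} (h : Waiting A w c H ident)
    {u v : Fin n} (huv : H.Adj u v) :
    ∃ t c' ident', Runs connectivityProgram w (c.resume u v) t c' ∧
      Waiting A w c' (H.deleteEdges {s(u, v)}) ident' ∧
      ListsIdentifiers c'.out {x | ident' x ≠ ident x} ident' ∧
      (∀ x, ident' x ≠ ident x →
        2 * componentSize (H.deleteEdges {s(u, v)}) x ≤ componentSize H x) ∧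
      t + 220 * potential A (H.deleteEdges {s(u, v)}) ≤
        220 * potential A H + 60 * (Nat.log 2 (st (dg A) n) + 1) + 402 := by
  obtain ⟨hpc, s, hsim, hI⟩ := h
  have hBn : n * n + n + 1 = arrLen n := rfl
  have hnn : n ≤ n * n := Nat.le_mul_self n
  let s₁ : St := ⟨Function.update (Function.update s.reg 0 u) 1 v, s.arr, []⟩
  have hreg : ∀ r, 2 ≤ r → s₁.reg r = s.reg r := fun r hr => by
    have h0 : r ≠ 0 := by omega
    have h1 : r ≠ 1 := by omega
    simp [s₁, Function.update_of_ne h0, Function.update_of_ne h1]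
  have hsim₁ : Sim w (arrLen n) s₁ (c.resume u v) := by
    refine ⟨fun r => ?_, hsim.len, hsim.arr, rfl, fun r => ?_, hsim.mem_lt⟩
    · have h := hsim.reg r
      simp only [Config.resume, s₁, Function.update_apply]
      have h0 : Op.mreg r = 0 ↔ r = 0 := Op.mreg_inj (b := 0)
      have h1 : Op.mreg r = 1 ↔ r = 1 := Op.mreg_inj (b := 1)
      simp only [h0, h1, h]
    · have h := hsim.reg_lt r
      have := u.2
      have := v.2
      simp only [Config.resume, Function.update_apply]
      split_ifs <;> omega
  have hI₁ : Inv A H ident s₁ :=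
    { static := ⟨by rw [hreg 2 le_rfl, hI.static.r2], by rw [hreg 3 (by norm_num), hI.static.r3],
        by rw [hreg 4 (by norm_num), hI.static.r4], hI.static.deg, hI.static.start,
        hI.static.cand⟩
      table := hI.table
      faces := hI.faces
      label := hI.label
      size := hI.size
      ident_le := by rw [hreg 6 (by norm_num)]; exact hI.ident_le
      ident_iff := hI.ident_iff
      mark_le := by rw [hreg 6 (by norm_num)]; exact hI.mark_le
      stamp_le := by rw [hreg 6 (by norm_num)]; exact hI.stamp_le
      le := hI.le }
  obtain ⟨t, s₂, he, ident', hI₂, hlist, hhalf, ht⟩ := wp_delete (U := 2 ^ w) hw rfl hA hI₁ huv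
    (by simp [s₁]) (by simp [s₁]) rfl
  have hpc₁ : (c.resume u v).pc = waitPos + 1 := by rw [← hpc]; rfl
  obtain ⟨c₂, h1, h2, h3⟩ := he.steps hw (arrLen_pos n) hsim₁
    (P := connectivityProgram) (pre := prologue ++ (initCmd.code 5 ++ [.await]))
    (post := [.jump waitPos]) (by rw [hpc₁]; exact connectivityProgram_eq)
    (by rw [hpc₁]; simp [waitPos, prologue, Cmd.code_length]; omega)
  have hjump : connectivityProgram[c₂.pc]? = some (.jump waitPos) := by
    rw [h3, hpc₁]; exact getElem?_jump
  refine ⟨t + 2, { c₂ with pc := waitPos }, ident',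
    h1.runs (.step hjump rfl (.wait getElem?_waitPos)), ⟨rfl, s₂,
      ⟨h2.reg, h2.len, h2.arr, h2.out, h2.reg_lt, h2.mem_lt⟩, hI₂⟩, ?_, hhalf, by omega⟩
  change ListsIdentifiers c₂.out _ _
  rw [h2.out]
  exact hlist

theorem Waiting.ident_lt {A : AdjacencyLists G} {w : ℕ} {c : Config} {ident : Fin n → ℕ}
    (h : Waiting A w c H ident) (x : Fin n) : ident x < arrLen n := by
  obtain ⟨-, s, -, hI⟩ := h
  have h1 := hI.ident_le x
  have h2 := hI.stamp_le
  have h3 := st_eq A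
  have h4 := st_le_arrLen A
  omega

theorem Waiting.isCCIdentifier {A : AdjacencyLists G} {w b : ℕ} {c : Config} {ident : Fin n → ℕ}
    (h : Waiting A w c H ident) (hb : arrLen n ≤ 2 ^ b) : IsCCIdentifier H b ident :=
  ⟨fun x => (h.ident_lt x).trans_le hb, by obtain ⟨-, s, -, hI⟩ := h; exact hI.ident_iff⟩

/-- The total time of all deletions, amortized by the potential. -/
theorem Waiting.handles {A : AdjacencyLists G} (hA : A.IsPlanarEmbedding) {w b : ℕ}
    (hw : 16 * arrLen n ≤ 2 ^ w) (hb : arrLen n ≤ 2 ^ b) (es : List (Fin n × Fin n)) :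
    ∀ {c : Config} {H : SimpleGraph (Fin n)} {ident : Fin n → ℕ}, Waiting A w c H ident →
      IsDeletionSequence H es →
      ∃ T, Handles connectivityProgram w b c H ident es T ∧
        T ≤ 220 * potential A H +
          es.length * (60 * (Nat.log 2 (st (dg A) n) + 1) + 402) := by
  induction es with
  | nil => exact fun _ _ => ⟨0, .nil _ _ _, Nat.zero_le _⟩
  | cons e es ih =>
    obtain ⟨u, v⟩ := e
    intro c H ident h hes
    obtain ⟨t, c', ident', h1, h2, h3, h4, h5⟩ := h.delete hA hw hes.1
    obtain ⟨T, h6, h7⟩ := ih h2 hes.2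
    refine ⟨t + T, .cons rfl h1 h3 (h2.isCCIdentifier hb) h4 h6, ?_⟩
    rw [List.length_cons, Nat.add_mul es.length 1]
    omega

theorem IsDeletionSequence.length_le {es : List (Fin n × Fin n)} :
    ∀ {H : SimpleGraph (Fin n)}, IsDeletionSequence H es → es.length ≤ H.edgeSet.ncard := by
  induction es with
  | nil => exact fun _ => Nat.zero_le _
  | cons e es ih =>
    obtain ⟨u, v⟩ := e
    intro H h
    have h1 := ih h.2
    have h2 := ncard_edgeSet_deleteEdges h.1
    rw [List.length_cons]
    omega

/-- The input length of a planar graph is linear, so all bounds are `O(n log n)`. -/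
theorem time_bounds {m L k T : ℕ} (hn : 2 ≤ n) (hm : m ≤ 3 * n) (hL : L = 1 + n + 2 * m)
    (hk : k ≤ m) (hT : T ≤ 220 * (L * Nat.log 2 n) + k * (60 * (Nat.log 2 L + 1) + 402)) :
    T ≤ 5000 * (n * Nat.log 2 n) ∧
      600 * (L * (Nat.log 2 L + 1)) + 6 ≤ 25000 * (n * Nat.log 2 n) := by
  have hL8 : L ≤ 8 * n := by omega
  have hl : 1 ≤ Nat.log 2 n := Nat.log_pos (by norm_num) hn
  have hlog : Nat.log 2 L ≤ Nat.log 2 n + 3 := by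
    refine (Nat.log_mono_right hL8).trans_eq ?_
    rw [show 8 * n = n * 2 * 2 * 2 by ring, Nat.log_mul_base (by norm_num) (by omega),
      Nat.log_mul_base (by norm_num) (by omega), Nat.log_mul_base (by norm_num) (by omega)]
  set l := Nat.log 2 n
  have h1 : L * l ≤ 8 * n * l := Nat.mul_le_mul_right _ hL8
  have h2 : k * (60 * (Nat.log 2 L + 1) + 402) ≤ (3 * n) * (702 * l) :=
    Nat.mul_le_mul (by omega) (by omega)
  have h3 : L * (Nat.log 2 L + 1) ≤ (8 * n) * (5 * l) := Nat.mul_le_mul hL8 (by omega)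
  have h4 : n * 1 ≤ n * l := Nat.mul_le_mul_left n hl
  rw [show 8 * n * l = 8 * (n * l) by ring] at h1
  rw [show 3 * n * (702 * l) = 2106 * (n * l) by ring] at h2
  rw [show 8 * n * (5 * l) = 40 * (n * l) by ring] at h3
  omega

theorem arrLen_le_two_pow {b : ℕ} (h : 2 * (Nat.log 2 n + 1) ≤ b) : arrLen n ≤ 2 ^ b := by
  have h1 : n + 1 ≤ 2 ^ (Nat.log 2 n + 1) := Nat.lt_pow_succ_log_self (by norm_num) n
  calc arrLen n ≤ (n + 1) * (n + 1) := by unfold arrLen; nlinarith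
    _ ≤ 2 ^ (Nat.log 2 n + 1) * 2 ^ (Nat.log 2 n + 1) := Nat.mul_le_mul h1 h1
    _ = 2 ^ (2 * (Nat.log 2 n + 1)) := by rw [← pow_add]; congr 1; ring
    _ ≤ 2 ^ b := Nat.pow_le_pow_right (by norm_num) h

theorem sixteen_mul_arrLen_le {w : ℕ} (h : 6 * (Nat.log 2 n + 1) ≤ w) : 16 * arrLen n ≤ 2 ^ w := by
  have h1 := arrLen_le_two_pow (n := n) (b := w - 4) (by omega)
  calc 16 * arrLen n ≤ 2 ^ 4 * 2 ^ (w - 4) := by omega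
    _ = 2 ^ w := by rw [← pow_add]; congr 1; omega

end Program
end DecrementalConnectivity

open DecrementalConnectivity
theorem mainTheorem7 :
    ∃ (P : Program) (C : ℕ), ∀ (n : ℕ) (G : SimpleGraph (Fin n)) (A : AdjacencyLists G) (w : ℕ),
      IsPlanar G → C * (Nat.log 2 n + 1) ≤ w →
      ∃ (t₀ : ℕ) (c₀ : Config) (ident₀ : Fin n → ℕ),
        Runs P w (Config.start A.encode) t₀ c₀ ∧
        ListsIdentifiers c₀.out Set.univ ident₀ ∧
        IsCCIdentifier G (C * (Nat.log 2 n + 1)) ident₀ ∧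
        ∀ es : List (Fin n × Fin n), IsDeletionSequence G es →
          ∃ T : ℕ, Handles P w (C * (Nat.log 2 n + 1)) c₀ G ident₀ es T ∧
            (T : ℝ) ≤ C * (n * Real.logb 2 n) ∧
            (A.IsPlanarEmbedding → 2 ≤ n → (t₀ + T : ℝ) ≤ C * (n * Real.logb 2 n)) := by
  refine ⟨connectivityProgram, 30000, fun n G A w hG hw => ?_⟩
  have hw' := sixteen_mul_arrLen_le (n := n) (w := w) (by omega)
  have hb := arrLen_le_two_pow (n := n) (b := 30000 * (Nat.log 2 n + 1)) (by omega)
  obtain ⟨t₀, c₀, A', ident, hrun, hA', hwait, hout, ht₀⟩ := exists_runs_init hw' A hG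
  refine ⟨t₀, c₀, ident, hrun, ⟨List.finRange n, List.nodup_finRange n,
    fun v => iff_of_true (List.mem_finRange v) trivial, hout⟩, hwait.isCCIdentifier hb,
    fun es hes => ?_⟩
  obtain ⟨T, hT, hTle⟩ := hwait.handles hA' hw' hb es hes
  have hk := hes.length_le
  have hpot := potential_le A' G
  have hm := hA'.ncard_edgeSet_le
  rw [dg_eq A A'] at hTle hpot
  have hlog : ((n * Nat.log 2 n : ℕ) : ℝ) ≤ n * Real.logb 2 n := by
    rw [Nat.cast_mul]
    exact mul_le_mul_of_nonneg_left (Real.natLog_le_logb n 2) (Nat.cast_nonneg n)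
  have hreal : ∀ x : ℕ, x ≤ 30000 * (n * Nat.log 2 n) →
      (x : ℝ) ≤ (30000 : ℕ) * (n * Real.logb 2 n) := fun x hx => by
    have h : (x : ℝ) ≤ ((30000 * (n * Nat.log 2 n) : ℕ) : ℝ) := Nat.cast_le.2 hx
    rw [Nat.cast_mul] at h
    exact h.trans (mul_le_mul_of_nonneg_left hlog (Nat.cast_nonneg _))
  have hT' : T ≤ 220 * (st (dg A) n * Nat.log 2 n) +
      es.length * (60 * (Nat.log 2 (st (dg A) n) + 1) + 402) := by omega
  refine ⟨T, hT, hreal T ?_, fun hA hn => ?_⟩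
  · by_cases hn : 2 ≤ n
    · have := (time_bounds hn hm (st_eq A) hk hT').1
      omega
    · -- a graph with at most one vertex has no edges, and both sides vanish
      have hl : Nat.log 2 n = 0 := Nat.log_of_lt (by omega)
      have hm2 := two_mul_edges_le A
      have hn1 : n * n ≤ 1 * 1 := Nat.mul_le_mul (by omega) (by omega)
      have hes0 : es.length = 0 := by omega
      rw [hes0, Nat.zero_mul, Nat.add_zero] at hTle
      rw [hl, Nat.mul_zero] at hpot
      omega
  · obtain ⟨h1, h2⟩ := time_bounds hn hm (st_eq A) hk hT'
    have h3 := ht₀ hA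
    rw [← Nat.cast_add]
    exact hreal _ (by omega)
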